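/- Let $K$ be a unital commutative ring and let $A=A_{\bar 0}\oplus A_{\bar 1}$ be an associative unital $K$-superalgebra which is free as a $K$-module with a $K$-basis containing $1$. A Lie superalgebra over $K$ is a $\mathbb Z/2$-graded $K$-module with an even bilinear bracket such that $[x,y]=-(-1)^{|x||y|}[y,x]$, the super Jacobi identity holds, and $[x,x]=0$ for even $x$. A central extension of $L$ is a surjective (even) homomorphism onto $L$ with central kernel; it is universal if it maps to every central extension of $L$ by a unique homomorphism over $L$. Give the indices $1,2$ parity $\bar 0$ and $3,4$ parity $\bar 1$. Let $\mathfrak{gl}(2,2,A)$ be the $4\times4$ matrices over $A$, where $E_{ij}(a)$ has parity $|i|+|j|+|a|$, with the super commutator as bracket, and $\mathfrak{sl}(2,2,A)=[\mathfrak{gl}(2,2,A),\mathfrak{gl}(2,2,A)]$. Let $\mathfrak{st}(2,2,A)$ be the Lie superalgebra generated by $F_{ij}(a)$ ($1\le i\ne j\le 4$, $a\in A$ homogeneous), of parity $|i|+|j|+|a|$, with the relations: $a\mapsto F_{ij}(a)$ is $K$-linear; $[F_{ij}(a),F_{jk}(b)]=F_{ik}(ab)$ for distinct $i,j,k$; $[F_{ij}(a),F_{kl}(b)]=0$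 for $j\ne k$, $i\ne l$. Let $\mathcal H$ be its subalgebra generated by all $[F_{ij}(a),F_{ji}(b)]$, and let $\varphi\colon\mathfrak{st}(2,2,A)\to\mathfrak{sl}(2,2,A)$, $F_{ij}(a)\mapsto E_{ij}(a)$, be the canonical homomorphism. For $m\ge 0$ let $A_m$ be the quotient of $A$ by the two-sided ideal generated by all $ma$ and all $ab-(-1)^{|a||b|}ba$, and let $W=A_2^4\oplus A_0^2$ with the induced grading; $\epsilon_m(\bar a)$ denotes $\bar a$ in the $m$-th summand. The quadruples $(i,j,k,l)$ of distinct indices fall into six cosets $P_1,\dots,P_6$ of four elements under exchanging $i,k$ and exchanging $j,l$; let $P_5$ be the coset with $\{i,k\}=\{1,2\}$ and $P_6$ the one with $\{i,k\}=\{3,4\}$, and let $\theta(i,j,k,l)=m$ on $P_m$. Let $\sigma=1$ on $P_1,\dots,P_4$ and on $(1,3,2,4),(2,4,1,3),(3,1,4,2),(4,2,3,1)$, and $\sigma=-1$ on $(1,4,2,3),(2,3,1,4),(3,2,4,1),(4,1,3,2)$. Then there is a unique $K$-bilinear map $\psi\colon\mathfrak{st}(2,2,A)\times\mathfrak{st}(2,2,A)\to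 W$ such that for homogeneous $a,b$ $$\psi(F_{ij}(a),F_{kl}(b))=\begin{cases}\epsilon_{\theta(i,j,k,l)}(\overline{ab}) & (i,j,k,l)\in P_1\cup\dots\cup P_4,\\ (-1)^{|b|}\sigma(i,j,k,l)\,\epsilon_{\theta(i,j,k,l)}(\overline{ab}) & (i,j,k,l)\in P_5\cup P_6,\\ 0 & i,j,k,l\text{ not distinct,}\end{cases}$$ and $\psi(x,y)=0$ if $x$ or $y$ lies in $\mathcal H$. It is an even super 2-cocycle, i.e. $|\psi(x,y)|=|x|+|y|$, $\psi(x,y)=-(-1)^{|x||y|}\psi(y,x)$, $(-1)^{|x||z|}\psi([x,y],z)+(-1)^{|x||y|}\psi([y,z],x)+(-1)^{|y||z|}\psi([z,x],y)=0$ for homogeneous $x,y,z$, and $\psi(x,x)=0$ for even $x$. Let $\mathfrak{st}(2,2,A)^\sharp$ be the Lie superalgebra generated by $F^\sharp_{ij}(a)$, of parity $|i|+|j|+|a|$, and by the homogeneous elements of $W$, with the relations: $a\mapsto F^\sharp_{ij}(a)$ and the inclusion of $W$ are $K$-linear; $[W,W]=[F^\sharp_{ij}(a),W]=0$; $[F^\sharp_{ij}(a),F^\sharp_{jk}(b)]=F^\sharp_{ik}(ab)$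 for distinct $i,j,k$; $[F^\sharp_{ij}(a),F^\sharp_{kl}(b)]=\psi(F_{ij}(a),F_{kl}(b))$ for $j\ne k$, $i\ne l$. It is isomorphic to $\mathfrak{st}(2,2,A)\oplus W$ with the bracket $[(x,w),(y,w')]=([x,y],\psi(x,y))$, by $F^\sharp_{ij}(a)\mapsto(F_{ij}(a),0)$ and $w\mapsto(0,w)$. The sequence $$0\to W\to\mathfrak{st}(2,2,A)^\sharp\xrightarrow{\ \pi\ }\mathfrak{st}(2,2,A)\to 0,\qquad \pi(F^\sharp_{ij}(a))=F_{ij}(a),\ \pi(W)=0,$$ is exact and is a universal central extension of $\mathfrak{st}(2,2,A)$. Hence $\psi$ induces an isomorphism of $K$-supermodules $H_2(\mathfrak{st}(2,2,A))\cong A_2^4\oplus A_0^2$ (second Chevalley–Eilenberg homology with trivial coefficients), and $\varphi\circ\pi\colon\mathfrak{st}(2,2,A)^\sharp\to\mathfrak{sl}(2,2,A)$ is a universal central extension of $\mathfrak{sl}(2,2,A)$. -/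

import Mathlib

universe u v w t

noncomputable section

namespace SteinbergSuper

set_option linter.unusedSectionVars false

/-! ## Lie superalgebras over a commutative ring -/

/-- A Lie superalgebra over a commutative ring `K` (in which `2` and `3` need not be invertible):
a `ZMod 2`-graded module with an even bilinear bracket which is super-antisymmetric, satisfies the
super Jacobi identity, and satisfies `[x, x] = 0` for even `x`. -/
class LieSuperalgebra (K : Type u) (L : Type v) [CommRing K] [AddCommGroup L] [Module K L] where
  /-- the homogeneous part of parity `d` -/
  par (K) : ZMod 2 → Submodule K L
  /-- the module is the direct sum of its even and its odd part -/
  isCompl : IsCompl (par 0) (par 1)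
  /-- the bracket -/
  br (K) : L →ₗ[K] L →ₗ[K] L
  br_mem : ∀ {d e : ZMod 2} {x y : L}, x ∈ par d → y ∈ par e → br x y ∈ par (d + e)
  skew : ∀ {d e : ZMod 2} {x y : L}, x ∈ par d → y ∈ par e →
    br x y = -((-1 : ℤˣ) ^ (d * e) • br y x)
  jacobi : ∀ {d e f : ZMod 2} {x y z : L}, x ∈ par d → y ∈ par e → z ∈ par f →
    (-1 : ℤˣ) ^ (d * f) • br (br x y) z + (-1 : ℤˣ) ^ (d * e) • br (br y z) x
      + (-1 : ℤˣ) ^ (e * f) • br (br z x) y = 0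
  alt : ∀ {x : L}, x ∈ par 0 → br x x = 0

open LieSuperalgebra

section General

variable (K : Type u) [CommRing K]

/-- Homomorphisms of Lie superalgebras: even linear maps that preserve the bracket. -/
structure Hom (L : Type v) (M : Type w) [AddCommGroup L] [Module K L] [LieSuperalgebra K L]
    [AddCommGroup M] [Module K M] [LieSuperalgebra K M] extends L →ₗ[K] M where
  map_par : ∀ (d : ZMod 2) (x : L), x ∈ par K d → toFun x ∈ (par K d : Submodule K M)
  map_br : ∀ x y : L, toFun (br K x y) = br K (toFun x) (toFun y)

instance (L : Type v) (M : Type w) [AddCommGroup L] [Module K L] [LieSuperalgebra K L]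
    [AddCommGroup M] [Module K M] [LieSuperalgebra K M] : CoeFun (Hom K L M) (fun _ => L → M) :=
  ⟨fun f => f.toLinearMap⟩

variable {K}

/-- Composition of homomorphisms. -/
def Hom.comp {L : Type v} {M : Type w} {N : Type t}
    [AddCommGroup L] [Module K L] [LieSuperalgebra K L]
    [AddCommGroup M] [Module K M] [LieSuperalgebra K M]
    [AddCommGroup N] [Module K N] [LieSuperalgebra K N]
    (g : Hom K M N) (f : Hom K L M) : Hom K L N where
  toLinearMap := g.toLinearMap.comp f.toLinearMap
  map_par d x hx := g.map_par d _ (f.map_par d x hx)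
  map_br x y := (congrArg g (f.map_br x y)).trans (g.map_br _ _)

/-- A central extension of `L`: a surjective homomorphism whose kernel lies in the centre. -/
def IsCentralExtension {E : Type v} {L : Type w}
    [AddCommGroup E] [Module K E] [LieSuperalgebra K E]
    [AddCommGroup L] [Module K L] [LieSuperalgebra K L] (τ : Hom K E L) : Prop :=
  Function.Surjective τ ∧ ∀ x : E, τ x = 0 → ∀ y : E, br K x y = 0

/-- A central extension of `L` is universal if it maps uniquely, over `L`, to every central
extension of `L` (here: to those whose underlying type lives in an arbitrary universe `t`). -/
def IsUniversalCentralExtension {E : Type v} {L : Type w}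
    [AddCommGroup E] [Module K E] [LieSuperalgebra K E]
    [AddCommGroup L] [Module K L] [LieSuperalgebra K L] (π : Hom K E L) : Prop :=
  IsCentralExtension π ∧
    ∀ (E' : Type t) [AddCommGroup E'] [Module K E'] [LieSuperalgebra K E'] (τ : Hom K E' L),
      IsCentralExtension τ → ∃! ρ : Hom K E E', ∀ x : E, τ (ρ x) = π x

/-- An even super 2-cocycle on `L` with values in a module `W` whose homogeneous parts are
`Wpar 0` and `Wpar 1`. -/
structure IsEvenSuperCocycle {L : Type v} [AddCommGroup L] [Module K L] [LieSuperalgebra K L]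
    {W : Type w} [AddCommGroup W] [Module K W] (Wpar : ZMod 2 → Submodule K W)
    (ψ : L →ₗ[K] L →ₗ[K] W) : Prop where
  even : ∀ {d e : ZMod 2} {x y : L}, x ∈ par K d → y ∈ par K e → ψ x y ∈ Wpar (d + e)
  skew : ∀ {d e : ZMod 2} {x y : L}, x ∈ par K d → y ∈ par K e →
    ψ x y = -((-1 : ℤˣ) ^ (d * e) • ψ y x)
  cyclic : ∀ {d e f : ZMod 2} {x y z : L}, x ∈ par K d → y ∈ par K e → z ∈ par K f →
    (-1 : ℤˣ) ^ (d * f) • ψ (br K x y) z + (-1 : ℤˣ) ^ (d * e) • ψ (br K y z) x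
      + (-1 : ℤˣ) ^ (e * f) • ψ (br K z x) y = 0
  alt : ∀ {x : L}, x ∈ par K 0 → ψ x x = 0

variable (K)

/-- The Lie subalgebra generated by a set. -/
def subalgebraGenerated {L : Type v} [AddCommGroup L] [Module K L] [LieSuperalgebra K L]
    (s : Set L) : Submodule K L :=
  sInf {S : Submodule K L | s ⊆ S ∧ ∀ x ∈ S, ∀ y ∈ S, br K x y ∈ S}

/-! ### Second homology

The Chevalley-Eilenberg complex with trivial coefficients in degrees `3 → 2 → 1` is
`Λ³ L → Λ² L → L`, where the super exterior square `Λ² L` is the quotient of `L ⊗ L` by the elements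
`x ⊗ y + (-1)^{|x||y|} y ⊗ x` and `x₀ ⊗ x₀` with `x₀` even. We describe its homology
in the middle as a subquotient of `L ⊗ L`. -/

section Homology

variable (L : Type v) [AddCommGroup L] [Module K L] [LieSuperalgebra K L]

open scoped TensorProduct

/-- 2-cycles: the kernel of the bracket on `L ⊗ L`. -/
def cycles₂ : Submodule K (L ⊗[K] L) := LinearMap.ker (TensorProduct.lift (br K : L →ₗ[K] L →ₗ[K] L))

/-- The span of the relations that define `Λ² L` and of the boundaries of 3-chains. -/
def boundaries₂ : Submodule K (L ⊗[K] L) :=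
  Submodule.span K
    ({ξ | ∃ (d e : ZMod 2) (x y : L), x ∈ par K d ∧ y ∈ par K e ∧
        ξ = x ⊗ₜ[K] y + (-1 : ℤˣ) ^ (d * e) • y ⊗ₜ[K] x} ∪
      {ξ | ∃ x : L, x ∈ par K 0 ∧ ξ = x ⊗ₜ[K] x} ∪
      {ξ | ∃ (d e f : ZMod 2) (x y z : L), x ∈ par K d ∧ y ∈ par K e ∧ z ∈ par K f ∧
        ξ = (-1 : ℤˣ) ^ (d * f) • br K x y ⊗ₜ[K] z + (-1 : ℤˣ) ^ (d * e) • br K y z ⊗ₜ[K] x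
          + (-1 : ℤˣ) ^ (e * f) • br K z x ⊗ₜ[K] y})

/-- The second homology of `L` with trivial coefficients. -/
abbrev H₂ : Type v := cycles₂ K L ⧸ (boundaries₂ K L).comap (cycles₂ K L).subtype

/-- The part of parity `d` of `L ⊗ L`. -/
def tensorPar (d : ZMod 2) : Submodule K (L ⊗[K] L) :=
  Submodule.span K {ξ | ∃ (e f : ZMod 2) (x y : L), e + f = d ∧ x ∈ par K e ∧ y ∈ par K f ∧
    ξ = x ⊗ₜ[K] y}

/-- The part of parity `d` of the second homology: the classes of cycles of parity `d`. -/
def H₂par (d : ZMod 2) : Submodule K (H₂ K L) :=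
  ((tensorPar K L d).comap (cycles₂ K L).subtype).map (Submodule.mkQ _)

end Homology

end General

/-! ## The derived subalgebra -/

section Derived

variable (K : Type u) [CommRing K] (L : Type v) [AddCommGroup L] [Module K L] [LieSuperalgebra K L]

/-- The derived algebra `[L, L]`, spanned by all brackets. -/
def derived : Submodule K L := Submodule.span K {z | ∃ x y : L, z = br K x y}

variable {K L}

theorem br_mem_derived (x y : L) : br K x y ∈ derived K L := Submodule.subset_span ⟨x, y, rfl⟩

theorem exists_add (x : L) : ∃ y ∈ par K 0, ∃ z ∈ par K 1, y + z = x := by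
  have h := (isCompl (K := K) (L := L)).sup_eq_top
  exact Submodule.mem_sup.1 (h ▸ Submodule.mem_top)

theorem derived_graded {x : L} (hx : x ∈ derived K L) :
    ∃ y ∈ derived K L ⊓ par K 0, ∃ z ∈ derived K L ⊓ par K 1, y + z = x := by
  suffices h : derived K L ≤ (derived K L ⊓ par K 0) ⊔ (derived K L ⊓ par K 1) from
    Submodule.mem_sup.1 (h hx)
  refine Submodule.span_le.2 ?_
  rintro _ ⟨x, y, rfl⟩
  obtain ⟨x0, hx0, x1, hx1, rfl⟩ := exists_add (K := K) x
  obtain ⟨y0, hy0, y1, hy1, rfl⟩ := exists_add (K := K) y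
  refine Submodule.mem_sup.2 ⟨br K x0 y0 + br K x1 y1, ⟨?_, ?_⟩, br K x0 y1 + br K x1 y0, ⟨?_, ?_⟩, ?_⟩
  · exact add_mem (br_mem_derived _ _) (br_mem_derived _ _)
  · exact add_mem (br_mem hx0 hy0) (br_mem hx1 hy1)
  · exact add_mem (br_mem_derived _ _) (br_mem_derived _ _)
  · exact add_mem (by simpa using br_mem hx0 hy1) (by simpa using br_mem hx1 hy0)
  · simp only [map_add, LinearMap.add_apply]; abel

/-- The derived algebra is a Lie superalgebra with the restricted bracket and grading. -/
instance : LieSuperalgebra K (derived K L) where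
  par d := (par K d).comap (derived K L).subtype
  isCompl := by
    have h := isCompl (K := K) (L := L)
    constructor
    · rw [Submodule.disjoint_def]
      intro x h0 h1
      exact Subtype.ext (Submodule.disjoint_def.1 h.disjoint _ h0 h1)
    · rw [codisjoint_iff, eq_top_iff]
      rintro ⟨x, hx⟩ -
      obtain ⟨y, hy, z, hz, rfl⟩ := derived_graded hx
      exact Submodule.mem_sup.2 ⟨⟨y, hy.1⟩, hy.2, ⟨z, hz.1⟩, hz.2, rfl⟩
  br := LinearMap.mk₂ K (fun x y => ⟨br K (x : L) (y : L), br_mem_derived _ _⟩)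
    (fun _ _ _ => Subtype.ext (by simp)) (fun _ _ _ => Subtype.ext (by simp))
    (fun _ _ _ => Subtype.ext (by simp)) (fun _ _ _ => Subtype.ext (by simp))
  br_mem hx hy := br_mem (L := L) hx hy
  skew hx hy := Subtype.ext (skew (L := L) hx hy)
  jacobi hx hy hz := Subtype.ext (jacobi (L := L) hx hy hz)
  alt hx := Subtype.ext (alt (L := L) hx)

end Derived

/-! ## Lie superalgebras presented by generators and relations -/

section Presented

variable (K : Type u) [CommRing K] {X : Type v} (p : X → ZMod 2)

/-- The parity of a nonassociative word in generators `x` of parity `p x`. -/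
def wordPar : FreeMagma X → ZMod 2
  | .of x => p x
  | .mul a b => wordPar a + wordPar b

/-- The part of parity `d` of the free nonassociative algebra. -/
def freePar (d : ZMod 2) : Submodule K (FreeNonUnitalNonAssocAlgebra K X) :=
  MonoidAlgebra.supported K K {a : FreeMagma X | wordPar p a = d}

/-- The elements of the free nonassociative algebra that have to vanish in the Lie superalgebra with
relators `R`: the relators, the axioms of a Lie superalgebra, and products with all of these. -/
inductive Relator (R : Set (FreeNonUnitalNonAssocAlgebra K X)) :
    FreeNonUnitalNonAssocAlgebra K X → Prop
  | rel {r} : r ∈ R → Relator R r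
  | skew {d e x y} : x ∈ freePar K p d → y ∈ freePar K p e →
      Relator R (x * y + (-1 : ℤˣ) ^ (d * e) • (y * x))
  | jacobi {d e f x y z} : x ∈ freePar K p d → y ∈ freePar K p e → z ∈ freePar K p f →
      Relator R ((-1 : ℤˣ) ^ (d * f) • (x * y * z) + (-1 : ℤˣ) ^ (d * e) • (y * z * x)
        + (-1 : ℤˣ) ^ (e * f) • (z * x * y))
  | alt {x} : x ∈ freePar K p 0 → Relator R (x * x)
  | mul_left {d x r} : x ∈ freePar K p d → Relator R r → Relator R (x * r)
  | mul_right {d x r} : x ∈ freePar K p d → Relator R r → Relator R (r * x)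

/-- The ideal of relations. -/
def relIdeal (R : Set (FreeNonUnitalNonAssocAlgebra K X)) :
    Submodule K (FreeNonUnitalNonAssocAlgebra K X) := Submodule.span K {r | Relator K p R r}

/-- The underlying module of the Lie superalgebra with generators `x : X` of parity `p x` and
relators `R`. -/
abbrev Presented (R : Set (FreeNonUnitalNonAssocAlgebra K X)) : Type (max u v) :=
  FreeNonUnitalNonAssocAlgebra K X ⧸ relIdeal K p R

variable {K p}

theorem mem_freePar {d : ZMod 2} {x : FreeNonUnitalNonAssocAlgebra K X} :
    x ∈ freePar K p d ↔ ∀ a, wordPar p a ≠ d → x.coeff a = 0 := by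
  change x.coeff ∈ Finsupp.supported K K _ ↔ _
  rw [Finsupp.mem_supported']
  rfl

theorem of_mem_freePar (x : X) : FreeNonUnitalNonAssocAlgebra.of K x ∈ freePar K p (p x) := by
  classical
  rw [mem_freePar]
  intro a ha
  change (MonoidAlgebra.single (FreeMagma.of x) (1 : K)).coeff a = 0
  rw [MonoidAlgebra.coeff_single, Finsupp.single_apply, if_neg]
  rintro rfl
  exact ha rfl

variable (K p) in
/-- The projection of the free nonassociative algebra to its part of parity `d`. -/
def freeProj (d : ZMod 2) :
    FreeNonUnitalNonAssocAlgebra K X →ₗ[K] FreeNonUnitalNonAssocAlgebra K X :=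
  (MonoidAlgebra.coeffLinearEquiv K).symm.toLinearMap ∘ₗ
    (Finsupp.supported K K {a : FreeMagma X | wordPar p a = d}).subtype ∘ₗ
    Finsupp.restrictDom K K {a : FreeMagma X | wordPar p a = d} ∘ₗ
    (MonoidAlgebra.coeffLinearEquiv K).toLinearMap

theorem coeff_freeProj (d : ZMod 2) (x : FreeNonUnitalNonAssocAlgebra K X) (a : FreeMagma X) :
    (freeProj K p d x).coeff a = if wordPar p a = d then x.coeff a else 0 := by
  classical
  change (Finsupp.restrictDom K K {a : FreeMagma X | wordPar p a = d} x.coeff :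
    FreeMagma X →₀ K) a = _
  rw [Finsupp.restrictDom_apply, Finsupp.filter_apply]
  rfl

theorem freeProj_mem (d : ZMod 2) (x : FreeNonUnitalNonAssocAlgebra K X) :
    freeProj K p d x ∈ freePar K p d := by
  rw [mem_freePar]
  intro a ha
  rw [coeff_freeProj, if_neg ha]

theorem freeProj_of_mem {d : ZMod 2} {x : FreeNonUnitalNonAssocAlgebra K X}
    (hx : x ∈ freePar K p d) : freeProj K p d x = x := by
  ext a
  rw [coeff_freeProj]
  split_ifs with h
  · rfl
  · exact (mem_freePar.1 hx a h).symm

theorem freeProj_of_mem_ne {d e : ZMod 2} (hde : d ≠ e) {x : FreeNonUnitalNonAssocAlgebra K X}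
    (hx : x ∈ freePar K p d) : freeProj K p e x = 0 := by
  ext a
  rw [coeff_freeProj]
  split_ifs with h
  · exact mem_freePar.1 hx a (by rw [h]; exact hde.symm)
  · rfl

theorem freeProj_add (x : FreeNonUnitalNonAssocAlgebra K X) :
    freeProj K p 0 x + freeProj K p 1 x = x := by
  ext a
  change (freeProj K p 0 x).coeff a + (freeProj K p 1 x).coeff a = _
  rw [coeff_freeProj, coeff_freeProj]
  have h0 : ∀ d : ZMod 2, d = 0 ∨ d = 1 := by decide
  rcases h0 (wordPar p a) with h | h <;> simp [h]

theorem single_mem_freePar (a : FreeMagma X) (c : K) :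
    MonoidAlgebra.single a c ∈ freePar K p (wordPar p a) := by
  classical
  rw [mem_freePar]
  intro b hb
  rw [MonoidAlgebra.coeff_single, Finsupp.single_apply, if_neg]
  rintro rfl
  exact hb rfl

theorem freePar_eq_span (d : ZMod 2) : freePar K p d =
    Submodule.span K {x | ∃ a : FreeMagma X, wordPar p a = d ∧ x = MonoidAlgebra.single a (1 : K)} := by
  classical
  apply le_antisymm
  · intro x hx
    rw [← freeProj_of_mem hx]
    clear hx
    induction x using MonoidAlgebra.induction_linear with
    | zero => simp
    | add x y hx hy => rw [map_add]; exact add_mem hx hy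
    | single a c =>
      by_cases h : wordPar p a = d
      · rw [freeProj_of_mem (h ▸ single_mem_freePar a c)]
        have : (MonoidAlgebra.single a c : FreeNonUnitalNonAssocAlgebra K X)
            = c • MonoidAlgebra.single a (1 : K) := by simp
        rw [this]
        exact Submodule.smul_mem _ _ (Submodule.subset_span ⟨a, h, rfl⟩)
      · rw [freeProj_of_mem_ne h (single_mem_freePar a c)]
        exact zero_mem _
  · refine Submodule.span_le.2 ?_
    rintro _ ⟨a, rfl, rfl⟩
    exact single_mem_freePar a 1

theorem mul_mem_freePar {d e : ZMod 2} {x y : FreeNonUnitalNonAssocAlgebra K X}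
    (hx : x ∈ freePar K p d) (hy : y ∈ freePar K p e) : x * y ∈ freePar K p (d + e) := by
  rw [freePar_eq_span] at hx hy
  induction hx using Submodule.span_induction with
  | zero => simp
  | add x x' _ _ h h' => rw [add_mul]; exact add_mem h h'
  | smul c x _ h => rw [smul_mul_assoc]; exact Submodule.smul_mem _ _ h
  | mem x hx =>
    obtain ⟨a, rfl, rfl⟩ := hx
    induction hy using Submodule.span_induction with
    | zero => simp
    | add y y' _ _ h h' => rw [mul_add]; exact add_mem h h'
    | smul c y _ h => rw [mul_smul_comm]; exact Submodule.smul_mem _ _ h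
    | mem y hy =>
      obtain ⟨b, rfl, rfl⟩ := hy
      rw [MonoidAlgebra.single_mul_single]
      exact single_mem_freePar (p := p) (a * b) _

theorem units_smul_mem {M : Type w} [AddCommGroup M] [Module K M] (S : Submodule K M) (s : ℤˣ)
    {x : M} (hx : x ∈ S) : s • x ∈ S := by
  rcases Int.units_eq_one_or s with rfl | rfl
  · simpa using hx
  · simpa using hx

variable {R : Set (FreeNonUnitalNonAssocAlgebra K X)}

theorem Relator.homogeneous (hR : ∀ r ∈ R, ∃ d, r ∈ freePar K p d)
    {r : FreeNonUnitalNonAssocAlgebra K X} (h : Relator K p R r) : ∃ d, r ∈ freePar K p d := by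
  induction h with
  | rel h => exact hR _ h
  | @skew d e x y hx hy =>
    exact ⟨d + e, add_mem (mul_mem_freePar hx hy)
      (units_smul_mem _ _ (add_comm e d ▸ mul_mem_freePar hy hx))⟩
  | @jacobi d e f x y z hx hy hz =>
    refine ⟨d + e + f, add_mem (add_mem (units_smul_mem _ _ ?_) (units_smul_mem _ _ ?_))
      (units_smul_mem _ _ ?_)⟩
    · exact mul_mem_freePar (mul_mem_freePar hx hy) hz
    · have := mul_mem_freePar (mul_mem_freePar hy hz) hx
      rwa [show e + f + d = d + e + f by ring] at this
    · have := mul_mem_freePar (mul_mem_freePar hz hx) hy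
      rwa [show f + d + e = d + e + f by ring] at this
  | alt hx => exact ⟨_, mul_mem_freePar hx hx⟩
  | mul_left hx _ ih => exact ⟨_, mul_mem_freePar hx ih.choose_spec⟩
  | mul_right hx _ ih => exact ⟨_, mul_mem_freePar ih.choose_spec hx⟩

theorem freeProj_mem_relIdeal (hR : ∀ r ∈ R, ∃ d, r ∈ freePar K p d) (d : ZMod 2)
    {x : FreeNonUnitalNonAssocAlgebra K X} (hx : x ∈ relIdeal K p R) :
    freeProj K p d x ∈ relIdeal K p R := by
  induction hx using Submodule.span_induction with
  | zero => simp
  | add x y _ _ h h' => rw [map_add]; exact add_mem h h'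
  | smul c x _ h => rw [map_smul]; exact Submodule.smul_mem _ _ h
  | mem x hx =>
    obtain ⟨e, he⟩ := hx.homogeneous hR
    by_cases h : e = d
    · subst h
      rw [freeProj_of_mem he]
      exact Submodule.subset_span hx
    · rw [freeProj_of_mem_ne h he]
      exact zero_mem _

theorem mul_mem_relIdeal_left (x : FreeNonUnitalNonAssocAlgebra K X)
    {r : FreeNonUnitalNonAssocAlgebra K X} (hr : r ∈ relIdeal K p R) :
    x * r ∈ relIdeal K p R := by
  induction hr using Submodule.span_induction with
  | zero => simp
  | add y y' _ _ h h' => rw [mul_add]; exact add_mem h h'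
  | smul c y _ h => rw [mul_smul_comm]; exact Submodule.smul_mem _ _ h
  | mem r hr =>
    rw [← freeProj_add (p := p) x, add_mul]
    exact add_mem (Submodule.subset_span (.mul_left (freeProj_mem 0 x) hr))
      (Submodule.subset_span (.mul_left (freeProj_mem 1 x) hr))

theorem mul_mem_relIdeal_right (x : FreeNonUnitalNonAssocAlgebra K X)
    {r : FreeNonUnitalNonAssocAlgebra K X} (hr : r ∈ relIdeal K p R) :
    r * x ∈ relIdeal K p R := by
  induction hr using Submodule.span_induction with
  | zero => simp
  | add y y' _ _ h h' => rw [add_mul]; exact add_mem h h'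
  | smul c y _ h => rw [smul_mul_assoc]; exact Submodule.smul_mem _ _ h
  | mem r hr =>
    rw [← freeProj_add (p := p) x, mul_add]
    exact add_mem (Submodule.subset_span (.mul_right (freeProj_mem 0 x) hr))
      (Submodule.subset_span (.mul_right (freeProj_mem 1 x) hr))

variable (K p R) in
/-- The bracket of a presented Lie superalgebra: the product of representatives. -/
def presentedBr : Presented K p R →ₗ[K] Presented K p R →ₗ[K] Presented K p R :=
  LinearMap.liftQ₂ (relIdeal K p R) (relIdeal K p R)
    ((LinearMap.mul K (FreeNonUnitalNonAssocAlgebra K X)).compr₂ (relIdeal K p R).mkQ)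
    (fun _ hr => LinearMap.ext fun x =>
      (Submodule.Quotient.mk_eq_zero _).2 (mul_mem_relIdeal_right x hr))
    (fun _ hr => LinearMap.ext fun x =>
      (Submodule.Quotient.mk_eq_zero _).2 (mul_mem_relIdeal_left x hr))

theorem presentedBr_mk (x y : FreeNonUnitalNonAssocAlgebra K X) :
    presentedBr K p R ((relIdeal K p R).mkQ x) ((relIdeal K p R).mkQ y)
      = (relIdeal K p R).mkQ (x * y) := rfl

theorem mkQ_units_smul (s : ℤˣ) (x : FreeNonUnitalNonAssocAlgebra K X) :
    (relIdeal K p R).mkQ (s • x) = s • (relIdeal K p R).mkQ x := by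
  rcases Int.units_eq_one_or s with rfl | rfl <;> simp

/-- The Lie superalgebra with generators `x : X` of parity `p x` and homogeneous relators `R`. -/
@[reducible] def presentedLie (hR : ∀ r ∈ R, ∃ d, r ∈ freePar K p d) : LieSuperalgebra K (Presented K p R) where
  par d := (freePar K p d).map (relIdeal K p R).mkQ
  isCompl := by
    constructor
    · rw [Submodule.disjoint_def]
      rintro _ ⟨x, hx, rfl⟩ ⟨y, hy, hxy⟩
      have hxy' : y - x ∈ relIdeal K p R := by
        rw [← Submodule.Quotient.mk_eq_zero, Submodule.Quotient.mk_sub]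
        exact sub_eq_zero.2 hxy
      have h := freeProj_mem_relIdeal hR 0 hxy'
      rw [map_sub, freeProj_of_mem_ne (by decide) hy, freeProj_of_mem hx, zero_sub, neg_mem_iff] at h
      exact (Submodule.Quotient.mk_eq_zero _).2 h
    · rw [codisjoint_iff, eq_top_iff]
      intro x _
      obtain ⟨x, rfl⟩ := (relIdeal K p R).mkQ_surjective x
      rw [← freeProj_add (p := p) x, map_add]
      exact Submodule.add_mem_sup ⟨_, freeProj_mem 0 x, rfl⟩ ⟨_, freeProj_mem 1 x, rfl⟩
  br := presentedBr K p R
  br_mem := by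
    rintro d e _ _ ⟨x, hx, rfl⟩ ⟨y, hy, rfl⟩
    exact ⟨x * y, mul_mem_freePar hx hy, rfl⟩
  skew := by
    rintro d e _ _ ⟨x, hx, rfl⟩ ⟨y, hy, rfl⟩
    rw [presentedBr_mk, presentedBr_mk, ← mkQ_units_smul, eq_neg_iff_add_eq_zero, ← map_add]
    exact (Submodule.Quotient.mk_eq_zero _).2 (Submodule.subset_span (.skew hx hy))
  jacobi := by
    rintro d e f _ _ _ ⟨x, hx, rfl⟩ ⟨y, hy, rfl⟩ ⟨z, hz, rfl⟩
    simp only [presentedBr_mk, ← mkQ_units_smul, ← map_add]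
    exact (Submodule.Quotient.mk_eq_zero _).2 (Submodule.subset_span (.jacobi hx hy hz))
  alt := by
    rintro _ ⟨x, hx, rfl⟩
    exact (Submodule.Quotient.mk_eq_zero _).2 (Submodule.subset_span (.alt hx))

end Presented

/-! ## The general and special linear Lie superalgebras over a superalgebra

Here `A` is an associative unital superalgebra with homogeneous parts `𝒜 0` and `𝒜 1`, and rows and
columns of the matrices are indexed by a finite set `I` whose elements `i` have parity `p i`. -/

section Linear

variable {K : Type u} [CommRing K] {A : Type v} [Ring A] [Algebra K A]
  (𝒜 : ZMod 2 → Submodule K A) [GradedAlgebra 𝒜] {I : Type} [Fintype I] [DecidableEq I]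
  (p : I → ZMod 2)

set_option linter.unusedVariables false in
/-- The underlying module of the general linear Lie superalgebra. -/
def GenLin (𝒜 : ZMod 2 → Submodule K A) (p : I → ZMod 2) : Type v := Matrix I I A

instance : AddCommGroup (GenLin 𝒜 p) := inferInstanceAs (AddCommGroup (Matrix I I A))
instance : Module K (GenLin 𝒜 p) := inferInstanceAs (Module K (Matrix I I A))

/-- Matrices of parity `d`: the entry at `(i, j)` has parity `d + |i| + |j|`. -/
def matPar (d : ZMod 2) : Submodule K (Matrix I I A) where
  carrier := {x | ∀ i j, x i j ∈ 𝒜 (d + p i + p j)}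
  zero_mem' _ _ := zero_mem _
  add_mem' hx hy i j := add_mem (hx i j) (hy i j)
  smul_mem' c _ hx i j := Submodule.smul_mem _ c (hx i j)

/-- The component of parity `d` of a matrix. -/
def matProj (d : ZMod 2) : Matrix I I A →ₗ[K] Matrix I I A where
  toFun x := Matrix.of fun i j => GradedAlgebra.proj 𝒜 (d + p i + p j) (x i j)
  map_add' x y := by ext i j; simp
  map_smul' c x := by ext i j; simp

/-- The super commutator of matrices, `[x, y] = x y - ∑ (-1)^{d e} y_e x_d`, where the sum
is over the homogeneous components `x_d` of `x` and `y_e` of `y`. -/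
def matBr : Matrix I I A →ₗ[K] Matrix I I A →ₗ[K] Matrix I I A :=
  LinearMap.mul K (Matrix I I A) - ∑ d : ZMod 2, ∑ e : ZMod 2, (-1 : ℤˣ) ^ (d * e) •
    (LinearMap.mul K (Matrix I I A)).flip.compl₁₂ (matProj 𝒜 p d) (matProj 𝒜 p e)

variable {𝒜 p}

theorem matProj_mem (d : ZMod 2) (x : Matrix I I A) : matProj 𝒜 p d x ∈ matPar 𝒜 p d :=
  fun i j => by simp [matProj, GradedAlgebra.proj_apply]

theorem matProj_of_mem {d : ZMod 2} {x : Matrix I I A} (hx : x ∈ matPar 𝒜 p d) :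
    matProj 𝒜 p d x = x := by
  ext i j
  simpa [matProj, GradedAlgebra.proj_apply] using DirectSum.decompose_of_mem_same 𝒜 (hx i j)

theorem matProj_of_mem_ne {d e : ZMod 2} (hde : d ≠ e) {x : Matrix I I A}
    (hx : x ∈ matPar 𝒜 p d) : matProj 𝒜 p e x = 0 := by
  ext i j
  simpa [matProj, GradedAlgebra.proj_apply] using
    DirectSum.decompose_of_mem_ne 𝒜 (hx i j) (fun h => hde (by simpa using h))

theorem matProj_add (x : Matrix I I A) : matProj 𝒜 p 0 x + matProj 𝒜 p 1 x = x := by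
  ext i j
  classical
  have hs : ∀ f : ZMod 2 → A, ∑ d, f d = f 0 + f 1 := fun f => Fin.sum_univ_two f
  have h' : ∑ d : ZMod 2, (DirectSum.decompose 𝒜 (x i j) d : A) = x i j := by
    conv_rhs => rw [← DirectSum.sum_support_decompose 𝒜 (x i j)]
    refine (Finset.sum_subset (Finset.subset_univ _) ?_).symm
    intro d _ hd
    simpa using hd
  rw [hs] at h'
  have h0 : ∀ d : ZMod 2, d = 0 ∨ d = 1 := by decide
  have h2 : ∀ c d : ZMod 2, c ≠ d → (DirectSum.decompose 𝒜 (x i j) c : A)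
      + (DirectSum.decompose 𝒜 (x i j) d : A) = x i j := by
    intro c d hcd
    rcases h0 c with rfl | rfl <;> rcases h0 d with rfl | rfl
    · exact absurd rfl hcd
    · exact h'
    · exact (add_comm _ _).trans h'
    · exact absurd rfl hcd
  exact h2 _ _ (by simp)

theorem mul_mem_matPar {d e : ZMod 2} {x y : Matrix I I A} (hx : x ∈ matPar 𝒜 p d)
    (hy : y ∈ matPar 𝒜 p e) : x * y ∈ matPar 𝒜 p (d + e) := by
  intro i j
  rw [Matrix.mul_apply]
  refine Submodule.sum_mem _ fun k _ => ?_
  have h := SetLike.mul_mem_graded (hx i k) (hy k j)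
  have h2 : p k + p k = 0 := CharTwo.add_self_eq_zero _
  rwa [show d + p i + p k + (e + p k + p j) = d + e + p i + p j by linear_combination h2] at h

theorem matBr_of_mem {d e : ZMod 2} {x y : Matrix I I A} (hx : x ∈ matPar 𝒜 p d)
    (hy : y ∈ matPar 𝒜 p e) : matBr 𝒜 p x y = x * y - (-1 : ℤˣ) ^ (d * e) • (y * x) := by
  have hs : ∀ {M : Type v} [AddCommGroup M] (f : ZMod 2 → M), ∑ d, f d = f 0 + f 1 :=
    fun f => Fin.sum_univ_two f
  have key : matBr 𝒜 p x y = x * y - ∑ d' : ZMod 2, ∑ e' : ZMod 2,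
      (-1 : ℤˣ) ^ (d' * e') • (matProj 𝒜 p e' y * matProj 𝒜 p d' x) := by
    simp [matBr, LinearMap.sum_apply, LinearMap.compl₁₂_apply, Units.smul_def]
  rw [key, Finset.sum_eq_single d, Finset.sum_eq_single e, matProj_of_mem hx, matProj_of_mem hy]
  · intro e' _ h
    rw [matProj_of_mem_ne h.symm hy]; simp
  · simp
  · intro d' _ h
    rw [matProj_of_mem_ne h.symm hx]; simp
  · simp

variable (𝒜 p) in
/-- The Lie superalgebra of matrices with the super commutator as its bracket. -/
@[reducible] def matLie : LieSuperalgebra K (Matrix I I A) where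
  par d := matPar 𝒜 p d
  isCompl := by
    constructor
    · rw [Submodule.disjoint_def]
      intro x h0 h1
      rw [← matProj_of_mem h0]
      exact matProj_of_mem_ne (by decide) h1
    · rw [codisjoint_iff, eq_top_iff]
      intro x _
      rw [← matProj_add (𝒜 := 𝒜) (p := p) x]
      exact Submodule.add_mem_sup (matProj_mem 0 x) (matProj_mem 1 x)
  br := matBr 𝒜 p
  br_mem {d e x y} hx hy := by
    rw [matBr_of_mem hx hy]
    exact sub_mem (mul_mem_matPar hx hy)
      (units_smul_mem _ _ (add_comm e d ▸ mul_mem_matPar hy hx))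
  skew {d e x y} hx hy := by
    rw [matBr_of_mem hx hy, matBr_of_mem hy hx, mul_comm e d]
    rcases Int.units_eq_one_or ((-1 : ℤˣ) ^ (d * e)) with h | h <;> rw [h] <;> simp [add_comm]
  jacobi {d e f x y z} hx hy hz := by
    have hbr : ∀ {d e : ZMod 2} {x y : Matrix I I A}, x ∈ matPar 𝒜 p d → y ∈ matPar 𝒜 p e →
        matBr 𝒜 p x y ∈ matPar 𝒜 p (d + e) := by
      intro d e x y hx hy
      rw [matBr_of_mem hx hy]
      exact sub_mem (mul_mem_matPar hx hy)
        (units_smul_mem _ _ (add_comm e d ▸ mul_mem_matPar hy hx))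
    rw [matBr_of_mem (hbr hx hy) hz, matBr_of_mem (hbr hy hz) hx, matBr_of_mem (hbr hz hx) hy,
      matBr_of_mem hx hy, matBr_of_mem hy hz, matBr_of_mem hz hx]
    have h0 : ∀ a : ZMod 2, a = 0 ∨ a = 1 := by decide
    have h2 : (1 + 1 : ZMod 2) = 0 := by decide
    rcases h0 d with rfl | rfl <;> rcases h0 e with rfl | rfl <;> rcases h0 f with rfl | rfl <;>
      simp [h2] <;> noncomm_ring
  alt {x} hx := by
    rw [matBr_of_mem hx hx]; simp

/-- The general linear Lie superalgebra. -/
instance : LieSuperalgebra K (GenLin 𝒜 p) := matLie 𝒜 p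

variable (𝒜 p) in
/-- The special linear Lie superalgebra, `[𝔤𝔩, 𝔤𝔩]`. -/
abbrev SpecLin : Type v := derived K (GenLin 𝒜 p)

variable (𝒜 p) in
/-- The matrix `E_{ij}(a)`. -/
def elemMat (i j : I) (a : A) : GenLin 𝒜 p := Matrix.single i j a

end Linear

/-! ## The Steinberg Lie superalgebra -/

section Steinberg

variable {K : Type u} [CommRing K] {A : Type v} [Ring A] [Algebra K A]
  (𝒜 : ZMod 2 → Submodule K A) {I : Type} (p : I → ZMod 2)

/-- The generators `F_{ij}(a)`, with `i ≠ j` and `a` homogeneous. -/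
structure FGen (𝒜 : ZMod 2 → Submodule K A) (I : Type) : Type v where
  i : I
  j : I
  ne : i ≠ j
  d : ZMod 2
  a : 𝒜 d

/-- The parity of a generator is `|i| + |j| + |a|`. -/
def FGen.par (x : FGen 𝒜 I) : ZMod 2 := p x.i + p x.j + x.d

/-- The generator `F_{ij}(a)` in the free nonassociative algebra. -/
def freeF {i j : I} (h : i ≠ j) {d : ZMod 2} (a : 𝒜 d) :
    FreeNonUnitalNonAssocAlgebra K (FGen 𝒜 I) :=
  FreeNonUnitalNonAssocAlgebra.of K ⟨i, j, h, d, a⟩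

/-- The defining relators of the Steinberg Lie superalgebra. -/
inductive StRel [GradedAlgebra 𝒜] (I : Type) : FreeNonUnitalNonAssocAlgebra K (FGen 𝒜 I) → Prop
  | add {i j : I} (h : i ≠ j) {d : ZMod 2} (a b : 𝒜 d) :
      StRel I (freeF 𝒜 h (a + b) - freeF 𝒜 h a - freeF 𝒜 h b)
  | smul {i j : I} (h : i ≠ j) {d : ZMod 2} (c : K) (a : 𝒜 d) :
      StRel I (freeF 𝒜 h (c • a) - c • freeF 𝒜 h a)
  | mul {i j k : I} (hij : i ≠ j) (hjk : j ≠ k) (hik : i ≠ k) {d e : ZMod 2} (a : 𝒜 d) (b : 𝒜 e) :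
      StRel I (freeF 𝒜 hij a * freeF 𝒜 hjk b
        - freeF 𝒜 hik (⟨a * b, SetLike.mul_mem_graded a.2 b.2⟩ : 𝒜 (d + e)))
  | zero {i j k l : I} (hij : i ≠ j) (hkl : k ≠ l) (hjk : j ≠ k) (hil : i ≠ l) {d e : ZMod 2}
      (a : 𝒜 d) (b : 𝒜 e) :
      StRel I (freeF 𝒜 hij a * freeF 𝒜 hkl b)

theorem freeF_mem {i j : I} (h : i ≠ j) {d : ZMod 2} (a : 𝒜 d) :
    freeF 𝒜 h a ∈ freePar K (FGen.par 𝒜 p) (p i + p j + d) :=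
  of_mem_freePar (p := FGen.par 𝒜 p) (⟨i, j, h, d, a⟩ : FGen 𝒜 I)

variable [GradedAlgebra 𝒜]

theorem stRel_homogeneous (r : FreeNonUnitalNonAssocAlgebra K (FGen 𝒜 I)) (hr : StRel 𝒜 I r) :
    ∃ d, r ∈ freePar K (FGen.par 𝒜 p) d := by
  cases hr with
  | add h a b => exact ⟨_, sub_mem (sub_mem (freeF_mem 𝒜 p h _) (freeF_mem 𝒜 p h _)) (freeF_mem 𝒜 p h _)⟩
  | smul h c a =>
    exact ⟨_, sub_mem (freeF_mem 𝒜 p h _) (Submodule.smul_mem _ _ (freeF_mem 𝒜 p h _))⟩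
  | @mul i j k hij hjk hik d e a b =>
    refine ⟨_, sub_mem (mul_mem_freePar (freeF_mem 𝒜 p hij a) (freeF_mem 𝒜 p hjk b)) ?_⟩
    have h2 : p j + p j = 0 := CharTwo.add_self_eq_zero _
    rw [show p i + p j + d + (p j + p k + e) = p i + p k + (d + e) by linear_combination h2]
    exact freeF_mem 𝒜 p hik _
  | zero hij hkl hjk hil a b =>
    exact ⟨_, mul_mem_freePar (freeF_mem 𝒜 p hij a) (freeF_mem 𝒜 p hkl b)⟩

/-- The Steinberg Lie superalgebra. -/
def St : Type (max u v) := Presented K (FGen.par 𝒜 p) {r | StRel 𝒜 I r}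

instance : AddCommGroup (St 𝒜 p) :=
  inferInstanceAs (AddCommGroup (Presented K (FGen.par 𝒜 p) {r | StRel 𝒜 I r}))
instance : Module K (St 𝒜 p) :=
  inferInstanceAs (Module K (Presented K (FGen.par 𝒜 p) {r | StRel 𝒜 I r}))
instance : LieSuperalgebra K (St 𝒜 p) := presentedLie (stRel_homogeneous 𝒜 p)

/-- The element `F_{ij}(a)` of the Steinberg Lie superalgebra. -/
def stF {i j : I} (h : i ≠ j) {d : ZMod 2} (a : 𝒜 d) : St 𝒜 p :=
  (relIdeal K (FGen.par 𝒜 p) {r | StRel 𝒜 I r}).mkQ (freeF 𝒜 h a)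

/-- The subalgebra `ℋ` generated by the elements `H_{ij}(a, b) = [F_{ij}(a), F_{ji}(b)]`. -/
def stH : Submodule K (St 𝒜 p) :=
  subalgebraGenerated K {x | ∃ (i j : I) (h : i ≠ j) (d e : ZMod 2) (a : 𝒜 d) (b : 𝒜 e),
    x = br K (stF 𝒜 p h a) (stF 𝒜 p h.symm b)}

end Steinberg

/-! ## The cocycle on `𝔰𝔱(2, 2, A)` -/

section TwoTwo

variable {K : Type u} [CommRing K] {A : Type v} [Ring A] [Algebra K A]
  (𝒜 : ZMod 2 → Submodule K A)

/-- The parity of the indices of `𝔰𝔱(2, 2, A)`; the indices `1, 2, 3, 4` are written `0, 1, 2, 3`. -/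
def par22 : Fin 4 → ZMod 2 := ![0, 0, 1, 1]

/-- The two-sided ideal of `A` generated by all `m a` and all super commutators
`a b - (-1)^{|a||b|} b a`. -/
def commIdeal (m : ℕ) : Submodule K A :=
  Submodule.span K {x | ∃ u v g : A, ((∃ a : A, g = m • a) ∨
    ∃ (d e : ZMod 2) (a b : A), a ∈ 𝒜 d ∧ b ∈ 𝒜 e ∧ g = a * b - (-1 : ℤˣ) ^ (d * e) • (b * a)) ∧
    x = u * g * v}

/-- The six summands of `W`: four with `m = 2` and two with `m = 0`. -/
def torsion : Fin 6 → ℕ := ![2, 2, 2, 2, 0, 0]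

/-- `W = A₂⁴ ⊕ A₀²`, where `A_m` is the quotient of `A` by `commIdeal m`. -/
abbrev W : Type v := (m : Fin 6) → A ⧸ commIdeal 𝒜 (torsion m)

/-- The part of parity `d` of `W`, all of whose summands carry the grading induced from `A`. -/
def Wpar (d : ZMod 2) : Submodule K (W 𝒜) :=
  Submodule.pi Set.univ fun m => (𝒜 d).map (commIdeal 𝒜 (torsion m)).mkQ

/-- `ε_m(ā)`: the class of `a` in the summand `m`. -/
def eps (m : Fin 6) (a : A) : W 𝒜 := Pi.single m ((commIdeal 𝒜 (torsion m)).mkQ a)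

/-- Quadruples of distinct indices. -/
def AllDistinct (i j k l : Fin 4) : Prop := i ≠ j ∧ i ≠ k ∧ i ≠ l ∧ j ≠ k ∧ j ≠ l ∧ k ≠ l

instance (i j k l : Fin 4) : Decidable (AllDistinct i j k l) := by
  unfold AllDistinct; infer_instance

/-- The coset of a quadruple `(i, j, k, l)` of distinct indices modulo the Klein group generated by
the exchange of the entries `i, k` and the exchange of the entries `j, l`. It is determined by the
set `{i, k}`. The two cosets in which `|i| = |k|` are the last two, `P₅` with `{i, k} = {1, 2}` and
`P₆` with `{i, k} = {3, 4}`; these have the numbers `4` and `5` here. -/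
def theta (i k : Fin 4) : Fin 6 :=
  if ({i, k} : Finset (Fin 4)) = {0, 2} then 0
  else if ({i, k} : Finset (Fin 4)) = {0, 3} then 1
  else if ({i, k} : Finset (Fin 4)) = {1, 2} then 2
  else if ({i, k} : Finset (Fin 4)) = {1, 3} then 3
  else if ({i, k} : Finset (Fin 4)) = {0, 1} then 4
  else 5

/-- The sign `σ(i, j, k, l)`: on `P₅` and `P₆` it is `1` if `(i, j)` and `(k, l)` are ordered in the
same way, that is, on `(1,3,2,4), (2,4,1,3), (3,1,4,2), (4,2,3,1)`, and `-1` on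
`(1,4,2,3), (2,3,1,4), (3,2,4,1), (4,1,3,2)`; elsewhere it is `1`. -/
def sigma (i j k l : Fin 4) : ℤˣ :=
  if theta i k = 4 ∨ theta i k = 5 then (if (i < k ↔ j < l) then 1 else -1) else 1

/-- The value of the cocycle at `(F_{ij}(a), F_{kl}(b))` as a function of the indices, the
parity `e` of `b`, and the product `c = a b`. -/
def psiVal (i j k l : Fin 4) (e : ZMod 2) (c : A) : W 𝒜 :=
  if AllDistinct i j k l then
    if theta i k = 4 ∨ theta i k = 5 then ((-1 : ℤˣ) ^ e * sigma i j k l) • eps 𝒜 (theta i k) c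
    else eps 𝒜 (theta i k) c
  else 0

variable {𝒜} in
theorem psiVal_mem (i j k l : Fin 4) (e : ZMod 2) {d : ZMod 2} {c : A} (hc : c ∈ 𝒜 d) :
    psiVal 𝒜 i j k l e c ∈ Wpar 𝒜 d := by
  have h : ∀ m, eps 𝒜 m c ∈ Wpar 𝒜 d := by
    intro m m' _
    by_cases hm : m' = m
    · subst hm
      rw [eps, Pi.single_eq_same]
      exact Submodule.mem_map_of_mem hc
    · simp only [eps, Pi.single_eq_of_ne hm]
      exact zero_mem _
  unfold psiVal
  split_ifs
  · exact units_smul_mem _ _ (h _)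
  · exact h _
  · exact zero_mem _

variable [GradedAlgebra 𝒜]

/-- The values of the bilinear map `ψ` on `𝔰𝔱(2, 2, A)`: it is given by `psiVal` on pairs of
generators and vanishes when one of the arguments lies in `ℋ`. -/
def HasPsiValues (ψ : St 𝒜 par22 →ₗ[K] St 𝒜 par22 →ₗ[K] W 𝒜) : Prop :=
  (∀ (i j k l : Fin 4) (hij : i ≠ j) (hkl : k ≠ l) (d e : ZMod 2) (a : 𝒜 d) (b : 𝒜 e),
    ψ (stF 𝒜 par22 hij a) (stF 𝒜 par22 hkl b) = psiVal 𝒜 i j k l e ((a : A) * b)) ∧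
  ∀ x y : St 𝒜 par22, x ∈ stH 𝒜 par22 ∨ y ∈ stH 𝒜 par22 → ψ x y = 0

/-- The generators of `𝔰𝔱(2, 2, A)^♯`: the `F^♯_{ij}(a)` and the homogeneous elements of `W`. -/
inductive SharpGen : Type v
  | F : FGen 𝒜 (Fin 4) → SharpGen
  | W (d : ZMod 2) : Wpar 𝒜 d → SharpGen

/-- The parities of the generators. -/
def SharpGen.par : SharpGen 𝒜 → ZMod 2
  | .F x => FGen.par 𝒜 par22 x
  | .W d _ => d

/-- The generator `F^♯_{ij}(a)` in the free nonassociative algebra. -/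
def freeSharpF {i j : Fin 4} (h : i ≠ j) {d : ZMod 2} (a : 𝒜 d) :
    FreeNonUnitalNonAssocAlgebra K (SharpGen 𝒜) :=
  FreeNonUnitalNonAssocAlgebra.of K (.F ⟨i, j, h, d, a⟩)

/-- The generator `w` in the free nonassociative algebra. -/
def freeSharpW {d : ZMod 2} (w : Wpar 𝒜 d) : FreeNonUnitalNonAssocAlgebra K (SharpGen 𝒜) :=
  FreeNonUnitalNonAssocAlgebra.of K (.W d w)

/-- The defining relators of `𝔰𝔱(2, 2, A)^♯`. -/
inductive SharpRel : FreeNonUnitalNonAssocAlgebra K (SharpGen 𝒜) → Prop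
  | addF {i j : Fin 4} (h : i ≠ j) {d : ZMod 2} (a b : 𝒜 d) :
      SharpRel (freeSharpF 𝒜 h (a + b) - freeSharpF 𝒜 h a - freeSharpF 𝒜 h b)
  | smulF {i j : Fin 4} (h : i ≠ j) {d : ZMod 2} (c : K) (a : 𝒜 d) :
      SharpRel (freeSharpF 𝒜 h (c • a) - c • freeSharpF 𝒜 h a)
  | addW {d : ZMod 2} (w w' : Wpar 𝒜 d) :
      SharpRel (freeSharpW 𝒜 (w + w') - freeSharpW 𝒜 w - freeSharpW 𝒜 w')
  | smulW {d : ZMod 2} (c : K) (w : Wpar 𝒜 d) :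
      SharpRel (freeSharpW 𝒜 (c • w) - c • freeSharpW 𝒜 w)
  | centralW {d e : ZMod 2} (w : Wpar 𝒜 d) (w' : Wpar 𝒜 e) :
      SharpRel (freeSharpW 𝒜 w * freeSharpW 𝒜 w')
  | centralF {i j : Fin 4} (h : i ≠ j) {d e : ZMod 2} (a : 𝒜 d) (w : Wpar 𝒜 e) :
      SharpRel (freeSharpF 𝒜 h a * freeSharpW 𝒜 w)
  | mul {i j k : Fin 4} (hij : i ≠ j) (hjk : j ≠ k) (hik : i ≠ k) {d e : ZMod 2}
      (a : 𝒜 d) (b : 𝒜 e) :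
      SharpRel (freeSharpF 𝒜 hij a * freeSharpF 𝒜 hjk b
        - freeSharpF 𝒜 hik (⟨a * b, SetLike.mul_mem_graded a.2 b.2⟩ : 𝒜 (d + e)))
  | zero {i j k l : Fin 4} (hij : i ≠ j) (hkl : k ≠ l) (hjk : j ≠ k) (hil : i ≠ l)
      (h : i = k ∨ j = l) {d e : ZMod 2} (a : 𝒜 d) (b : 𝒜 e) :
      SharpRel (freeSharpF 𝒜 hij a * freeSharpF 𝒜 hkl b)
  | psi {i j k l : Fin 4} (hij : i ≠ j) (hkl : k ≠ l) (h : AllDistinct i j k l) {d e : ZMod 2}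
      (a : 𝒜 d) (b : 𝒜 e) :
      SharpRel (freeSharpF 𝒜 hij a * freeSharpF 𝒜 hkl b
        - freeSharpW 𝒜 (⟨psiVal 𝒜 i j k l e ((a : A) * b),
            psiVal_mem i j k l e (SetLike.mul_mem_graded a.2 b.2)⟩ : Wpar 𝒜 (d + e)))

theorem freeSharpF_mem {i j : Fin 4} (h : i ≠ j) {d : ZMod 2} (a : 𝒜 d) :
    freeSharpF 𝒜 h a ∈ freePar K (SharpGen.par 𝒜) (par22 i + par22 j + d) :=
  of_mem_freePar (p := SharpGen.par 𝒜) (.F ⟨i, j, h, d, a⟩ : SharpGen 𝒜)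

theorem freeSharpW_mem {d : ZMod 2} (w : Wpar 𝒜 d) :
    freeSharpW 𝒜 w ∈ freePar K (SharpGen.par 𝒜) d :=
  of_mem_freePar (p := SharpGen.par 𝒜) (.W d w : SharpGen 𝒜)

theorem par22_sum {i j k l : Fin 4} (h : AllDistinct i j k l) :
    par22 i + par22 j + (par22 k + par22 l) = 0 := by
  revert i j k l; decide

theorem sharpRel_homogeneous (r : FreeNonUnitalNonAssocAlgebra K (SharpGen 𝒜))
    (hr : SharpRel 𝒜 r) : ∃ d, r ∈ freePar K (SharpGen.par 𝒜) d := by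
  cases hr with
  | addF h a b =>
    exact ⟨_, sub_mem (sub_mem (freeSharpF_mem 𝒜 h _) (freeSharpF_mem 𝒜 h _))
      (freeSharpF_mem 𝒜 h _)⟩
  | smulF h c a =>
    exact ⟨_, sub_mem (freeSharpF_mem 𝒜 h _) (Submodule.smul_mem _ _ (freeSharpF_mem 𝒜 h _))⟩
  | addW w w' =>
    exact ⟨_, sub_mem (sub_mem (freeSharpW_mem 𝒜 _) (freeSharpW_mem 𝒜 _)) (freeSharpW_mem 𝒜 _)⟩
  | smulW c w =>
    exact ⟨_, sub_mem (freeSharpW_mem 𝒜 _) (Submodule.smul_mem _ _ (freeSharpW_mem 𝒜 _))⟩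
  | centralW w w' => exact ⟨_, mul_mem_freePar (freeSharpW_mem 𝒜 w) (freeSharpW_mem 𝒜 w')⟩
  | centralF h a w => exact ⟨_, mul_mem_freePar (freeSharpF_mem 𝒜 h a) (freeSharpW_mem 𝒜 w)⟩
  | @mul i j k hij hjk hik d e a b =>
    refine ⟨_, sub_mem (mul_mem_freePar (freeSharpF_mem 𝒜 hij a) (freeSharpF_mem 𝒜 hjk b)) ?_⟩
    have h2 : par22 j + par22 j = 0 := CharTwo.add_self_eq_zero _
    rw [show par22 i + par22 j + d + (par22 j + par22 k + e) = par22 i + par22 k + (d + e) by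
      linear_combination h2]
    exact freeSharpF_mem 𝒜 hik _
  | zero hij hkl hjk hil h a b =>
    exact ⟨_, mul_mem_freePar (freeSharpF_mem 𝒜 hij a) (freeSharpF_mem 𝒜 hkl b)⟩
  | @psi i j k l hij hkl h d e a b =>
    refine ⟨_, sub_mem (mul_mem_freePar (freeSharpF_mem 𝒜 hij a) (freeSharpF_mem 𝒜 hkl b)) ?_⟩
    rw [show par22 i + par22 j + d + (par22 k + par22 l + e) = d + e by
      linear_combination par22_sum h]
    exact freeSharpW_mem 𝒜 _

/-- The Lie superalgebra `𝔰𝔱(2, 2, A)^♯`. -/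
def Sharp : Type (max u v) := Presented K (SharpGen.par 𝒜) {r | SharpRel 𝒜 r}

instance : AddCommGroup (Sharp 𝒜) :=
  inferInstanceAs (AddCommGroup (Presented K (SharpGen.par 𝒜) {r | SharpRel 𝒜 r}))
instance : Module K (Sharp 𝒜) :=
  inferInstanceAs (Module K (Presented K (SharpGen.par 𝒜) {r | SharpRel 𝒜 r}))
instance : LieSuperalgebra K (Sharp 𝒜) := presentedLie (sharpRel_homogeneous 𝒜)

/-- The element `F^♯_{ij}(a)` of `𝔰𝔱(2, 2, A)^♯`. -/
def sharpF {i j : Fin 4} (h : i ≠ j) {d : ZMod 2} (a : 𝒜 d) : Sharp 𝒜 :=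
  (relIdeal K (SharpGen.par 𝒜) {r | SharpRel 𝒜 r}).mkQ (freeSharpF 𝒜 h a)

/-- The element of `𝔰𝔱(2, 2, A)^♯` given by a homogeneous element `w` of `W`. -/
def sharpW {d : ZMod 2} (w : Wpar 𝒜 d) : Sharp 𝒜 :=
  (relIdeal K (SharpGen.par 𝒜) {r | SharpRel 𝒜 r}).mkQ (freeSharpW 𝒜 w)

end TwoTwo

end SteinbergSuper

end

open SteinbergSuper SteinbergSuper.LieSuperalgebra

/-! The matrix homomorphism is itself a central extension. The algebra `St` is the sum of ℋ and the
root modules F_ij(A), and ℋ preserves each root module. Matrices remember every root component, so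
the kernel lies in ℋ. A kernel element sends F_ij(A) into F_ij(A) and at the same time to the zero
matrix, hence commutes with every F_ij(a) (`br_eq_zero_of_stToMat_eq_zero`). Cocycles may therefore
be constructed on matrices whose supertrace vanishes modulo supercommutators.

Existence of ψ. Take the polarized 2×2 minor with rows i, k and columns j, l. In the simplest even
case a diagonal matrix h acts on the product of the entries (i, j) and (k, l) with weight h_i - h_j
+ h_k - h_l, and the cocycle identity forces this weight to act by zero. If the rows have one parity
and the columns the other (P₅ and P₆), the weight is the supertrace up to sign, so the minor is a
cocycle over the supercommutative quotient A₀. For the other four splittings the weight agrees with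
the trace only modulo 2, and the minor is a cocycle over A₂. The computations are `polar_cyclic`,
`polar_cyclic_of_char_two` and `strZero_of_mem_derived`.

Completeness. Let β be any even cocycle on `St`. Substituting F_kl(bc) = [F_ki(b), F_il(c)] into the
Leibniz form of the cocycle identity exchanges the rows i and k (`apply_transfer`). Two exchanges
return to the start with the sign -1 if |i| and |k| differ, so these values are annihilated by 2.
Moving a product bc from one argument to the other in one step or in two shows that supercommutators
are killed. Hence the values on four distinct indices factor through W (`apply_eq_wMap`). The value
on F_ij(a), F_jk(b) depends only on i, k and ab, and pairs with a common row or column give 0. These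
facts are the relations of `Sharp` twisted by β, so there is a linear ρ on `Sharp` with ρ[x, y] =
β(πx, πy) (`exists_sharp_map`).

Consequences. Lifting the presentation along ψ itself splits `Sharp` as `St` ⊕ W. If β is the
bracket of a central extension, ρ is the required lift, and it is unique because `Sharp` is perfect;
the same argument serves extensions of 𝔰𝔩, as a composite of central extensions with perfect source
is central. If β is the universal cocycle x ∧ y, then ρ is inverse to (bracket, ψ), and restriction
to cycles computes H₂. -/

namespace SteinbergSuper

noncomputable section

open LieSuperalgebra

set_option linter.unusedSectionVars false
set_option linter.unusedSimpArgs false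

/-! ## Maps out of presented Lie superalgebras -/

section FreeLift

variable {K : Type u} [CommRing K] {X : Type v} {M : Type w} [AddCommGroup M] [Module K M]
  (μ : M →ₗ[K] M →ₗ[K] M) (f : X → M)

/-- The value of a nonassociative word for the product `μ`. -/
def wordEval : FreeMagma X → M
  | .of x => f x
  | .mul a b => μ (wordEval a) (wordEval b)

/-- The homomorphism from the free nonassociative algebra to a module with product `μ`. -/
def freeLift : FreeNonUnitalNonAssocAlgebra K X →ₗ[K] M :=
  Finsupp.linearCombination K (wordEval μ f) ∘ₗ (MonoidAlgebra.coeffLinearEquiv K).toLinearMap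

theorem freeLift_single (a : FreeMagma X) (c : K) :
    freeLift μ f (MonoidAlgebra.single a c) = c • wordEval μ f a := by
  change Finsupp.linearCombination K (wordEval μ f) (Finsupp.single a c) = _
  simp

theorem freeLift_of (x : X) : freeLift μ f (FreeNonUnitalNonAssocAlgebra.of K x) = f x := by
  change freeLift μ f (MonoidAlgebra.single (FreeMagma.of x) 1) = _
  rw [freeLift_single, one_smul]
  rfl

theorem freeLift_mul (x y : FreeNonUnitalNonAssocAlgebra K X) :
    freeLift μ f (x * y) = μ (freeLift μ f x) (freeLift μ f y) := by
  induction x using MonoidAlgebra.induction_linear with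
  | zero => simp
  | add x x' h h' => simp [add_mul, h, h']
  | single a c =>
    induction y using MonoidAlgebra.induction_linear with
    | zero => simp
    | add y y' h h' => simp [mul_add, h, h']
    | single b c' =>
      rw [MonoidAlgebra.single_mul_single, freeLift_single, freeLift_single, freeLift_single]
      simp only [map_smul, LinearMap.smul_apply, smul_smul]
      rw [mul_comm]
      congr 1

theorem map_units_smul {M' : Type t} [AddCommGroup M'] [Module K M'] (g : M →ₗ[K] M') (s : ℤˣ)
    (x : M) : g (s • x) = s • g x := by
  rcases Int.units_eq_one_or s with rfl | rfl <;> simp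

theorem map_units_smul₂ {M' : Type t} [AddCommGroup M'] [Module K M'] (g : M →ₗ[K] M →ₗ[K] M')
    (s : ℤˣ) (x y : M) : g (s • x) y = s • g x y := by
  rcases Int.units_eq_one_or s with rfl | rfl <;> simp

variable {μ f}

theorem freeLift_mem {p : X → ZMod 2} {P : ZMod 2 → Submodule K M} (hf : ∀ x, f x ∈ P (p x))
    (hμ : ∀ {d e x y}, x ∈ P d → y ∈ P e → μ x y ∈ P (d + e)) {d : ZMod 2}
    {x : FreeNonUnitalNonAssocAlgebra K X} (hx : x ∈ freePar K p d) : freeLift μ f x ∈ P d := by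
  have hw : ∀ a : FreeMagma X, wordEval μ f a ∈ P (wordPar p a) := by
    intro a
    induction a with
    | ih1 x => exact hf x
    | ih2 a b ha hb => exact hμ ha hb
  rw [freePar_eq_span] at hx
  induction hx using Submodule.span_induction with
  | zero => simp
  | add x y _ _ h h' => rw [map_add]; exact add_mem h h'
  | smul c x _ h => rw [map_smul]; exact Submodule.smul_mem _ _ h
  | mem x hx =>
    obtain ⟨a, rfl, rfl⟩ := hx
    rw [freeLift_single, one_smul]
    exact hw a

/-- The ideal of relations is mapped to `N` if `N` is an ideal, the product is that of a Lie
superalgebra modulo `N`, and the relators are mapped to `N`. -/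
theorem freeLift_mem_of_mem_relIdeal {p : X → ZMod 2} {P : ZMod 2 → Submodule K M}
    {N : Submodule K M} {R : Set (FreeNonUnitalNonAssocAlgebra K X)}
    (hf : ∀ x, f x ∈ P (p x)) (hμ : ∀ {d e x y}, x ∈ P d → y ∈ P e → μ x y ∈ P (d + e))
    (hN : ∀ x, ∀ n ∈ N, μ x n ∈ N ∧ μ n x ∈ N)
    (hskew : ∀ {d e x y}, x ∈ P d → y ∈ P e → μ x y + (-1 : ℤˣ) ^ (d * e) • μ y x ∈ N)
    (hjacobi : ∀ {d e f x y z}, x ∈ P d → y ∈ P e → z ∈ P f →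
      (-1 : ℤˣ) ^ (d * f) • μ (μ x y) z + (-1 : ℤˣ) ^ (d * e) • μ (μ y z) x
        + (-1 : ℤˣ) ^ (e * f) • μ (μ z x) y ∈ N)
    (halt : ∀ {x}, x ∈ P 0 → μ x x ∈ N) (hR : ∀ r ∈ R, freeLift μ f r ∈ N)
    {r : FreeNonUnitalNonAssocAlgebra K X} (hr : r ∈ relIdeal K p R) : freeLift μ f r ∈ N := by
  induction hr using Submodule.span_induction with
  | zero => simp
  | add x y _ _ h h' => rw [map_add]; exact add_mem h h'
  | smul c x _ h => rw [map_smul]; exact Submodule.smul_mem _ _ h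
  | mem r hr =>
    induction hr with
    | rel h => exact hR _ h
    | skew hx hy =>
      simpa only [map_add, map_units_smul, freeLift_mul] using
        hskew (freeLift_mem hf hμ hx) (freeLift_mem hf hμ hy)
    | jacobi hx hy hz =>
      simpa only [map_add, map_units_smul, freeLift_mul] using
        hjacobi (freeLift_mem hf hμ hx) (freeLift_mem hf hμ hy) (freeLift_mem hf hμ hz)
    | alt hx =>
      simpa only [freeLift_mul] using halt (freeLift_mem hf hμ hx)
    | mul_left _ _ ih => rw [freeLift_mul]; exact (hN _ _ ih).1
    | mul_right _ _ ih => rw [freeLift_mul]; exact (hN _ _ ih).2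

theorem freeLift_eq_zero_of_mem_relIdeal {L : Type w} [AddCommGroup L] [Module K L]
    [LieSuperalgebra K L] {f : X → L} {p : X → ZMod 2}
    {R : Set (FreeNonUnitalNonAssocAlgebra K X)} (hf : ∀ x, f x ∈ par K (p x))
    (hR : ∀ r ∈ R, freeLift (br K) f r = 0)
    {r : FreeNonUnitalNonAssocAlgebra K X} (hr : r ∈ relIdeal K p R) :
    freeLift (br K) f r = 0 := by
  refine (Submodule.mem_bot K).1 (freeLift_mem_of_mem_relIdeal hf br_mem ?_ ?_ ?_ ?_ ?_ hr)
  · rintro x n hn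
    rw [(Submodule.mem_bot K).1 hn]
    simp
  · intro d e x y hx hy
    rw [skew hx hy, neg_add_cancel]
    exact zero_mem _
  · intro d e f x y z hx hy hz
    rw [jacobi hx hy hz]
    exact zero_mem _
  · intro x hx
    rw [alt hx]
    exact zero_mem _
  · intro r hr
    rw [hR r hr]
    exact zero_mem _

end FreeLift

section PresentedHom

variable {K : Type u} [CommRing K] {X : Type v} {p : X → ZMod 2}
  {R : Set (FreeNonUnitalNonAssocAlgebra K X)} {L : Type w} [AddCommGroup L] [Module K L]
  [LieSuperalgebra K L]

/-- The homomorphism from a presented Lie superalgebra given by images of the generators which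
satisfy the relations. -/
def presentedHom (hR : ∀ r ∈ R, ∃ d, r ∈ freePar K p d) (f : X → L)
    (hf : ∀ x, f x ∈ par K (p x)) (hrel : ∀ r ∈ R, freeLift (br K) f r = 0) :
    letI := presentedLie hR
    Hom K (Presented K p R) L :=
  letI := presentedLie hR
  { toLinearMap := (relIdeal K p R).liftQ (freeLift (br K) f)
      fun _ hr => freeLift_eq_zero_of_mem_relIdeal hf hrel hr
    map_par := by
      rintro d _ ⟨x, hx, rfl⟩
      exact freeLift_mem hf br_mem hx
    map_br := by
      intro x y
      obtain ⟨x, rfl⟩ := (relIdeal K p R).mkQ_surjective x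
      obtain ⟨y, rfl⟩ := (relIdeal K p R).mkQ_surjective y
      exact freeLift_mul (br K) f x y }

theorem presentedHom_of (hR : ∀ r ∈ R, ∃ d, r ∈ freePar K p d) (f : X → L)
    (hf : ∀ x, f x ∈ par K (p x)) (hrel : ∀ r ∈ R, freeLift (br K) f r = 0) (x : X) :
    letI := presentedLie hR
    presentedHom hR f hf hrel ((relIdeal K p R).mkQ (FreeNonUnitalNonAssocAlgebra.of K x)) = f x :=
  freeLift_of (br K) f x

/-- A submodule of a presented Lie superalgebra which contains the generators and is closed under
brackets is everything. -/
theorem presented_mem (S : Submodule K (Presented K p R))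
    (hS : ∀ x, (relIdeal K p R).mkQ (FreeNonUnitalNonAssocAlgebra.of K x) ∈ S)
    (hbr : ∀ x ∈ S, ∀ y ∈ S, presentedBr K p R x y ∈ S) (x : Presented K p R) : x ∈ S := by
  obtain ⟨x, rfl⟩ := (relIdeal K p R).mkQ_surjective x
  have hw : ∀ a : FreeMagma X, (relIdeal K p R).mkQ (MonoidAlgebra.single a (1 : K)) ∈ S := by
    intro a
    induction a with
    | ih1 x => exact hS x
    | ih2 a b ha hb =>
      have h := hbr _ ha _ hb
      rw [presentedBr_mk, MonoidAlgebra.single_mul_single, one_mul] at h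
      exact h
  induction x using MonoidAlgebra.induction_linear with
  | zero => rw [map_zero]; exact zero_mem _
  | add x y h h' => rw [map_add]; exact add_mem h h'
  | single a c =>
    have : (MonoidAlgebra.single a c : FreeNonUnitalNonAssocAlgebra K X)
        = c • MonoidAlgebra.single a (1 : K) := by simp
    rw [this, map_smul]
    exact Submodule.smul_mem _ _ (hw a)

end PresentedHom

/-! ## Bilinear identities in Lie superalgebras -/

section Leibniz

theorem apply₂_mem_of_span {K : Type u} [CommRing K] {L : Type v} [AddCommGroup L] [Module K L]
    {M' : Type t} [AddCommGroup M'] [Module K M'] (β : L →ₗ[K] L →ₗ[K] M')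
    {s s' : Set L} {N : Submodule K M'} (h : ∀ x ∈ s, ∀ y ∈ s', β x y ∈ N) {x y : L}
    (hx : x ∈ Submodule.span K s) (hy : y ∈ Submodule.span K s') : β x y ∈ N := by
  induction hx using Submodule.span_induction with
  | zero => simp
  | add x x' _ _ h h' => rw [map_add]; exact add_mem h h'
  | smul c x _ h => rw [map_smul]; exact Submodule.smul_mem _ _ h
  | mem x hx =>
    induction hy using Submodule.span_induction with
    | zero => simp
    | add y y' _ _ h h' => rw [map_add]; exact add_mem h h'
    | smul c y _ h => rw [map_smul]; exact Submodule.smul_mem _ _ h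
    | mem y hy => exact h x hx y hy

variable {K : Type u} [CommRing K] {L : Type v} [AddCommGroup L] [Module K L]
  [LieSuperalgebra K L] {M : Type w} [AddCommGroup M] [Module K M]

theorem zmod_two_cases (d : ZMod 2) : d = 0 ∨ d = 1 := by revert d; decide

/-- The axioms of the bracket are those of a cocycle with values in the algebra itself, so whatever
is proved for cocycles also holds for brackets. -/
theorem isEvenSuperCocycle_br : IsEvenSuperCocycle (par K) (br K : L →ₗ[K] L →ₗ[K] L) where
  even := br_mem
  skew := skew
  cyclic := jacobi
  alt := alt

/-- Super-antisymmetry turns the cyclic identity into the derivation rule. The only sign left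
involves the parities of `x` and `y`, which is why `z` may be inhomogeneous. -/
theorem IsEvenSuperCocycle.leibniz {Wpar : ZMod 2 → Submodule K M} {β : L →ₗ[K] L →ₗ[K] M}
    (hβ : IsEvenSuperCocycle Wpar β) {d e : ZMod 2} {x y : L} (hx : x ∈ par K d)
    (hy : y ∈ par K e) (z : L) :
    β x (br K y z) = β (br K x y) z + (-1 : ℤˣ) ^ (d * e) • β y (br K x z) := by
  have key : ∀ {f : ZMod 2} {z : L}, z ∈ par K f →
      β x (br K y z) = β (br K x y) z + (-1 : ℤˣ) ^ (d * e) • β y (br K x z) := by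
    intro f z hz
    have h := hβ.cyclic hx hy hz
    rw [hβ.skew (br_mem hy hz) hx, LieSuperalgebra.skew hz hx, map_neg, LinearMap.neg_apply, map_units_smul₂,
      hβ.skew (br_mem hx hz) hy] at h
    have h2 : (1 + 1 : ZMod 2) = 0 := by decide
    rcases zmod_two_cases d with rfl | rfl <;> rcases zmod_two_cases e with rfl | rfl <;>
      rcases zmod_two_cases f with rfl | rfl <;>
      simp only [mul_zero, zero_mul, mul_one, one_mul, add_zero, zero_add, h2, uzpow_zero,
        uzpow_one, one_smul, Units.neg_smul, neg_neg, smul_neg] at h ⊢ <;>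
      first
      | linear_combination (norm := module) h
      | linear_combination (norm := module) -h
  obtain ⟨z0, h0, z1, h1, rfl⟩ := exists_add (K := K) z
  simp only [map_add, key h0, key h1, smul_add]
  abel

theorem leibniz {d e : ZMod 2} {x y : L} (hx : x ∈ par K d) (hy : y ∈ par K e) (z : L) :
    br K x (br K y z) = br K (br K x y) z + (-1 : ℤˣ) ^ (d * e) • br K y (br K x z) :=
  isEvenSuperCocycle_br.leibniz hx hy z

/-- Together with `br_mem_br`, this lets the derivation rule be used for membership in a submodule
without tracking signs. -/
theorem br_br_mem {N : Submodule K L} {d e : ZMod 2} {x y z : L} (hx : x ∈ par K d)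
    (hy : y ∈ par K e) (h : br K x (br K y z) ∈ N) (h' : br K y (br K x z) ∈ N) :
    br K (br K x y) z ∈ N := by
  rw [eq_sub_iff_add_eq.2 (leibniz hx hy z).symm]
  exact sub_mem h (units_smul_mem _ _ h')

theorem br_mem_br {N : Submodule K L} {d e : ZMod 2} {x y z : L} (hx : x ∈ par K d)
    (hy : y ∈ par K e) (h : br K (br K x y) z ∈ N) (h' : br K y (br K x z) ∈ N) :
    br K x (br K y z) ∈ N := by
  rw [leibniz hx hy z]
  exact add_mem h (units_smul_mem _ _ h')

theorem par_eq_zero {x y : L} (hx : x ∈ par K 0) (hy : y ∈ par K 1) (h : x + y = 0) :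
    x = 0 ∧ y = 0 := by
  have hx' : x = 0 := Submodule.disjoint_def.1 isCompl.disjoint x hx
    (by rw [eq_neg_of_add_eq_zero_left h]; exact neg_mem hy)
  exact ⟨hx', by simpa [hx'] using h⟩

end Leibniz

/-! ## The structure of Steinberg Lie superalgebras -/

section Steinberg

variable {K : Type u} [CommRing K] {A : Type v} [Ring A] [Algebra K A]
  (𝒜 : ZMod 2 → Submodule K A) [GradedAlgebra 𝒜] {I : Type} (p : I → ZMod 2)

theorem stF_add {i j : I} (h : i ≠ j) {d : ZMod 2} (a b : 𝒜 d) :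
    stF 𝒜 p h (a + b) = stF 𝒜 p h a + stF 𝒜 p h b := by
  rw [← sub_eq_zero, ← sub_sub]
  exact (Submodule.Quotient.mk_eq_zero _).2 (Submodule.subset_span (.rel (.add h a b)))

theorem stF_smul {i j : I} (h : i ≠ j) {d : ZMod 2} (c : K) (a : 𝒜 d) :
    stF 𝒜 p h (c • a) = c • stF 𝒜 p h a := by
  rw [← sub_eq_zero]
  exact (Submodule.Quotient.mk_eq_zero _).2 (Submodule.subset_span (.rel (.smul h c a)))

theorem br_stF_stF {i j k : I} (hij : i ≠ j) (hjk : j ≠ k) (hik : i ≠ k) {d e : ZMod 2}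
    (a : 𝒜 d) (b : 𝒜 e) : br K (stF 𝒜 p hij a) (stF 𝒜 p hjk b)
      = stF 𝒜 p hik (⟨a * b, SetLike.mul_mem_graded a.2 b.2⟩ : 𝒜 (d + e)) := by
  rw [← sub_eq_zero]
  exact (Submodule.Quotient.mk_eq_zero _).2 (Submodule.subset_span (.rel (.mul hij hjk hik a b)))

theorem br_stF_stF_eq_zero {i j k l : I} (hij : i ≠ j) (hkl : k ≠ l) (hjk : j ≠ k) (hil : i ≠ l)
    {d e : ZMod 2} (a : 𝒜 d) (b : 𝒜 e) : br K (stF 𝒜 p hij a) (stF 𝒜 p hkl b) = 0 :=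
  (Submodule.Quotient.mk_eq_zero _).2 (Submodule.subset_span (.rel (.zero hij hkl hjk hil a b)))

theorem stF_mem {i j : I} (h : i ≠ j) {d : ZMod 2} (a : 𝒜 d) :
    stF 𝒜 p h a ∈ par K (p i + p j + d) :=
  ⟨_, freeF_mem 𝒜 p h a, rfl⟩

/-- Elements of the Steinberg Lie superalgebra lie in every submodule that contains the generators
and is closed under brackets. -/
theorem st_mem {S : Submodule K (St 𝒜 p)}
    (hS : ∀ (i j : I) (h : i ≠ j) (d : ZMod 2) (a : 𝒜 d), stF 𝒜 p h a ∈ S)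
    (hbr : ∀ x ∈ S, ∀ y ∈ S, br K x y ∈ S) (x : St 𝒜 p) : x ∈ S :=
  presented_mem (p := FGen.par 𝒜 p) (R := {r | StRel 𝒜 I r}) S
    (fun ⟨i, j, h, d, a⟩ => hS i j h d a) hbr x

variable [DecidableEq I]

/-- The map `a ↦ F_{ij}(a)` on all of `A`, which is taken to be zero if `i = j`. -/
def stLin (i j : I) : A →ₗ[K] St 𝒜 p :=
  if h : i = j then 0 else
    DirectSum.toModule K (ZMod 2) (St 𝒜 p) (fun d =>
      { toFun := fun a : 𝒜 d => stF 𝒜 p h a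
        map_add' := stF_add 𝒜 p h
        map_smul' := stF_smul 𝒜 p h }) ∘ₗ (DirectSum.decomposeLinearEquiv 𝒜).toLinearMap

variable {p}

theorem stLin_self (i : I) : stLin 𝒜 p i i = 0 := dif_pos rfl

theorem stF_eq {i j : I} (h : i ≠ j) {d : ZMod 2} (a : 𝒜 d) :
    stF 𝒜 p h a = stLin 𝒜 p i j a := by
  rw [stLin, dif_neg h]
  simp

theorem stLin_eq {i j : I} (h : i ≠ j) {d : ZMod 2} {a : A} (ha : a ∈ 𝒜 d) :
    stLin 𝒜 p i j a = stF 𝒜 p h (⟨a, ha⟩ : 𝒜 d) :=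
  (stF_eq 𝒜 h ⟨a, ha⟩).symm

variable {𝒜}

theorem graded_induction {P : A → Prop} (h : ∀ {d a}, a ∈ 𝒜 d → P a)
    (hadd : ∀ {a b}, P a → P b → P (a + b)) (a : A) : P a :=
  DirectSum.Decomposition.inductionOn 𝒜 (h (zero_mem (𝒜 0))) (fun a => h a.2)
    (fun _ _ => hadd) a

theorem stLin_mem {i j : I} {d : ZMod 2} {a : A} (ha : a ∈ 𝒜 d) :
    stLin 𝒜 p i j a ∈ par K (p i + p j + d) := by
  by_cases h : i = j
  · rw [stLin, dif_pos h]
    exact zero_mem _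
  · rw [stLin_eq 𝒜 h ha]
    exact stF_mem 𝒜 p h _

theorem br_stLin {i j k : I} (hij : i ≠ j) (hjk : j ≠ k) (hik : i ≠ k) (a b : A) :
    br K (stLin 𝒜 p i j a) (stLin 𝒜 p j k b) = stLin 𝒜 p i k (a * b) := by
  induction a using graded_induction (𝒜 := 𝒜) with
  | hadd h h' => simp [add_mul, h, h']
  | h ha =>
    induction b using graded_induction (𝒜 := 𝒜) with
    | hadd h h' => simp [mul_add, h, h']
    | h hb =>
      rw [stLin_eq 𝒜 hij ha, stLin_eq 𝒜 hjk hb, br_stF_stF 𝒜 p hij hjk hik,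
        stLin_eq 𝒜 hik (SetLike.mul_mem_graded ha hb)]

theorem br_stLin_eq_zero {i j k l : I} (hjk : j ≠ k) (hil : i ≠ l) (a b : A) :
    br K (stLin 𝒜 p i j a) (stLin 𝒜 p k l b) = 0 := by
  by_cases hij : i = j
  · rw [hij, stLin_self]; simp
  by_cases hkl : k = l
  · rw [hkl, stLin_self]; simp
  induction a using graded_induction (𝒜 := 𝒜) with
  | hadd h h' => simp [h, h']
  | h ha =>
    induction b using graded_induction (𝒜 := 𝒜) with
    | hadd h h' => simp [h, h']
    | h hb => rw [stLin_eq 𝒜 hij ha, stLin_eq 𝒜 hkl hb, br_stF_stF_eq_zero 𝒜 p hij hkl hjk hil]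

theorem skew_mem {L : Type w} [AddCommGroup L] [Module K L] [LieSuperalgebra K L]
    {N : Submodule K L} {d e : ZMod 2} {x y : L} (hx : x ∈ par K d) (hy : y ∈ par K e)
    (h : br K y x ∈ N) : br K x y ∈ N := by
  rw [skew hx hy]
  exact neg_mem (units_smul_mem _ _ h)

theorem br_stLin_mem {i j k : I} (hij : i ≠ j) (hjk : j ≠ k) (hik : i ≠ k) (a b : A) :
    br K (stLin 𝒜 p i j a) (stLin 𝒜 p j k b) ∈ LinearMap.range (stLin 𝒜 p i k) :=
  ⟨_, (br_stLin hij hjk hik a b).symm⟩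

theorem br_stLin_mem' {i j k : I} (hij : i ≠ j) (hjk : j ≠ k) (hik : i ≠ k) (a b : A) :
    br K (stLin 𝒜 p j k a) (stLin 𝒜 p i j b) ∈ LinearMap.range (stLin 𝒜 p i k) := by
  induction a using graded_induction (𝒜 := 𝒜) with
  | hadd h h' => rw [map_add, map_add, LinearMap.add_apply]; exact add_mem h h'
  | h ha =>
    induction b using graded_induction (𝒜 := 𝒜) with
    | hadd h h' => rw [map_add, map_add]; exact add_mem h h'
    | h hb => exact skew_mem (stLin_mem ha) (stLin_mem hb) (br_stLin_mem hij hjk hik _ _)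

theorem br_mem_range {i j k : I} (hij : i ≠ j) (hjk : j ≠ k) (hik : i ≠ k) {x y : St 𝒜 p}
    (hx : x ∈ LinearMap.range (stLin 𝒜 p i j)) (hy : y ∈ LinearMap.range (stLin 𝒜 p j k)) :
    br K x y ∈ LinearMap.range (stLin 𝒜 p i k) := by
  obtain ⟨a, rfl⟩ := hx
  obtain ⟨b, rfl⟩ := hy
  exact br_stLin_mem hij hjk hik a b

theorem br_mem_range' {i j k : I} (hij : i ≠ j) (hjk : j ≠ k) (hik : i ≠ k) {x y : St 𝒜 p}
    (hx : x ∈ LinearMap.range (stLin 𝒜 p j k)) (hy : y ∈ LinearMap.range (stLin 𝒜 p i j)) :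
    br K x y ∈ LinearMap.range (stLin 𝒜 p i k) := by
  obtain ⟨a, rfl⟩ := hx
  obtain ⟨b, rfl⟩ := hy
  exact br_stLin_mem' hij hjk hik a b

variable (𝒜 p) in
/-- The brackets `[F_{ij}(a), F_{ji}(b)]` with homogeneous `a` and `b`. -/
def hGen : Set (St 𝒜 p) :=
  {x | ∃ (i j : I) (d e : ZMod 2) (a b : A), i ≠ j ∧ a ∈ 𝒜 d ∧ b ∈ 𝒜 e ∧
    x = br K (stLin 𝒜 p i j a) (stLin 𝒜 p j i b)}

theorem hGen_mem_par {h : St 𝒜 p} (hh : h ∈ hGen 𝒜 p) : ∃ d, h ∈ par K d := by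
  obtain ⟨i, j, d, e, a, b, -, ha, hb, rfl⟩ := hh
  exact ⟨_, br_mem (stLin_mem ha) (stLin_mem hb)⟩

/-- By the derivation rule the action is that of F_kl and F_lk in succession. Outside the two
excluded positions no bracket of opposite roots F_ij, F_ji occurs, so the defining relations lead
back to F_ij(A) or give 0. -/
theorem br_hGen_mem_of_ne {i j k l : I} (hij : i ≠ j) (hkl : k ≠ l)
    (h1 : ¬ (k = i ∧ l = j)) (h2 : ¬ (k = j ∧ l = i)) {d e : ZMod 2} {b c : A} (hb : b ∈ 𝒜 d)
    (hc : c ∈ 𝒜 e) (a : A) :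
    br K (br K (stLin 𝒜 p k l b) (stLin 𝒜 p l k c)) (stLin 𝒜 p i j a)
      ∈ LinearMap.range (stLin 𝒜 p i j) := by
  apply br_br_mem (stLin_mem hb) (stLin_mem hc)
  · by_cases hki : k = i
    · subst hki
      have hlj : l ≠ j := fun h => h1 ⟨rfl, h⟩
      exact br_mem_range hkl hlj hij ⟨_, rfl⟩ (br_stLin_mem hkl.symm hij hlj _ _)
    by_cases hlj : l = j
    · subst hlj
      exact br_mem_range' (Ne.symm hki) hkl hij ⟨_, rfl⟩
        (br_stLin_mem' hij hkl.symm (Ne.symm hki) _ _)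
    · rw [br_stLin_eq_zero hki hlj, map_zero]
      exact zero_mem _
  · by_cases hli : l = i
    · subst hli
      have hkj : k ≠ j := fun h => h2 ⟨h, rfl⟩
      exact br_mem_range hkl.symm hkj hij ⟨_, rfl⟩ (br_stLin_mem hkl hij hkj _ _)
    by_cases hkj : k = j
    · subst hkj
      exact br_mem_range' (Ne.symm hli) hkl.symm hij ⟨_, rfl⟩
        (br_stLin_mem' hij hkl (Ne.symm hli) _ _)
    · rw [br_stLin_eq_zero hli hkj, map_zero]
      exact zero_mem _

end Steinberg

/-! ### Four indices: decomposition into ℋ and the root modules -/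

section FourIndices

variable {K : Type u} [CommRing K] {A : Type v} [Ring A] [Algebra K A]
  {𝒜 : ZMod 2 → Submodule K A} [GradedAlgebra 𝒜] {p : Fin 4 → ZMod 2}

theorem exists_third (i j : Fin 4) : ∃ m, m ≠ i ∧ m ≠ j := by revert i j; decide

theorem br_hGen_mem {h : St 𝒜 p} (hh : h ∈ hGen 𝒜 p) (i j : Fin 4) (a : A) :
    br K h (stLin 𝒜 p i j a) ∈ LinearMap.range (stLin 𝒜 p i j) := by
  by_cases hij : i = j
  · subst hij
    rw [stLin_self]; simp
  have hh' := hh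
  obtain ⟨k, l, d, e, b, c, hkl, hb, hc, rfl⟩ := hh'
  by_cases h12 : (k = i ∧ l = j) ∨ (k = j ∧ l = i)
  -- In the position excluded before, F_ij(a) = [F_im(a), F_mj(1)] is split through a third index;
  -- the element of ℋ acts on both factors by the case already known.
  · obtain ⟨m, hmi, hmj⟩ := exists_third i j
    have him : ∀ a, br K (br K (stLin 𝒜 p k l b) (stLin 𝒜 p l k c)) (stLin 𝒜 p i m a)
        ∈ LinearMap.range (stLin 𝒜 p i m) := fun a => by
      apply br_hGen_mem_of_ne hmi.symm hkl _ _ hb hc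
      · rintro ⟨rfl, rfl⟩
        tauto
      · rintro ⟨rfl, rfl⟩
        tauto
    have hjm : ∀ a, br K (br K (stLin 𝒜 p k l b) (stLin 𝒜 p l k c)) (stLin 𝒜 p m j a)
        ∈ LinearMap.range (stLin 𝒜 p m j) := fun a => by
      apply br_hGen_mem_of_ne hmj hkl _ _ hb hc
      · rintro ⟨rfl, rfl⟩
        tauto
      · rintro ⟨rfl, rfl⟩
        tauto
    induction a using graded_induction (𝒜 := 𝒜) with
    | hadd h h' => rw [map_add, map_add]; exact add_mem h h'
    | @h f a ha =>
      have hm : stLin 𝒜 p i j a = br K (stLin 𝒜 p i m a) (stLin 𝒜 p m j 1) := by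
        rw [br_stLin hmi.symm hmj hij, mul_one]
      rw [hm]
      exact br_mem_br (br_mem (stLin_mem hb) (stLin_mem hc)) (stLin_mem ha)
        (br_mem_range hmi.symm hmj hij (him a) ⟨_, rfl⟩)
        (br_mem_range hmi.symm hmj hij ⟨_, rfl⟩ (hjm 1))
  · exact br_hGen_mem_of_ne hij hkl (fun h => h12 (.inl h)) (fun h => h12 (.inr h)) hb hc a

theorem br_stLin_mem_span {i j : Fin 4} (hij : i ≠ j) (a b : A) :
    br K (stLin 𝒜 p i j a) (stLin 𝒜 p j i b) ∈ Submodule.span K (hGen 𝒜 p) := by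
  induction a using graded_induction (𝒜 := 𝒜) with
  | hadd h h' => rw [map_add, map_add, LinearMap.add_apply]; exact add_mem h h'
  | h ha =>
    induction b using graded_induction (𝒜 := 𝒜) with
    | hadd h h' => rw [map_add, map_add]; exact add_mem h h'
    | h hb => exact Submodule.subset_span ⟨i, j, _, _, _, _, hij, ha, hb, rfl⟩

/-- An element of ℋ acts as a superderivation preserving F_ij(A) and F_ji(A), hence it preserves the
span of their brackets. So this span is already closed under the bracket and equals ℋ. -/
theorem br_hGen_hGen {x y : St 𝒜 p} (hx : x ∈ hGen 𝒜 p) (hy : y ∈ hGen 𝒜 p) :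
    br K x y ∈ Submodule.span K (hGen 𝒜 p) := by
  obtain ⟨d, hd⟩ := hGen_mem_par hx
  obtain ⟨i, j, _, _, a, b, hij, ha, hb, rfl⟩ := hy
  apply br_mem_br hd (stLin_mem ha)
  · obtain ⟨a', h⟩ := br_hGen_mem hx i j a
    rw [← h]
    exact br_stLin_mem_span hij _ _
  · obtain ⟨b', h⟩ := br_hGen_mem hx j i b
    rw [← h]
    exact br_stLin_mem_span hij _ _

theorem stH_eq_span : stH 𝒜 p = Submodule.span K (hGen 𝒜 p) := by
  apply le_antisymm
  · refine sInf_le ⟨?_, fun x hx y hy =>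
      apply₂_mem_of_span (br K) (fun x hx y hy => br_hGen_hGen hx hy) hx hy⟩
    rintro _ ⟨i, j, h, d, e, a, b, rfl⟩
    rw [stF_eq, stF_eq]
    exact br_stLin_mem_span h _ _
  · refine le_sInf fun S hS => Submodule.span_le.2 ?_
    rintro _ ⟨i, j, d, e, a, b, hij, ha, hb, rfl⟩
    rw [stLin_eq 𝒜 hij ha, stLin_eq 𝒜 hij.symm hb]
    exact hS.1 ⟨i, j, hij, d, e, _, _, rfl⟩

/-- The Steinberg Lie superalgebra is the sum of `ℋ` and the modules `F_{ij}(A)`. -/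
theorem span_hGen_union (x : St 𝒜 p) :
    x ∈ Submodule.span K (hGen 𝒜 p ∪
      {x | ∃ (i j : Fin 4) (d : ZMod 2) (a : A), a ∈ 𝒜 d ∧ x = stLin 𝒜 p i j a}) := by
  set S := Submodule.span K (hGen 𝒜 p ∪
      {x | ∃ (i j : Fin 4) (d : ZMod 2) (a : A), a ∈ 𝒜 d ∧ x = stLin 𝒜 p i j a}) with hS
  have hH : Submodule.span K (hGen 𝒜 p) ≤ S := Submodule.span_mono Set.subset_union_left
  have hF : ∀ i j a, stLin 𝒜 p i j a ∈ S := by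
    intro i j a
    induction a using graded_induction (𝒜 := 𝒜) with
    | hadd h h' => rw [map_add]; exact add_mem h h'
    | h ha => exact Submodule.subset_span (.inr ⟨_, _, _, _, ha, rfl⟩)
  have hR : ∀ i j, LinearMap.range (stLin 𝒜 p i j) ≤ S := by
    rintro i j _ ⟨a, rfl⟩
    exact hF i j a
  refine st_mem 𝒜 p (fun i j h d a => by rw [stF_eq]; exact hF i j a) (fun x hx y hy => ?_) x
  refine apply₂_mem_of_span (br K) ?_ hx hy
  rintro x (hx | ⟨i, j, d, a, ha, rfl⟩) y (hy | ⟨k, l, e, b, hb, rfl⟩)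
  · exact hH (br_hGen_hGen hx hy)
  · exact hR _ _ (br_hGen_mem hx k l b)
  · obtain ⟨d, hd⟩ := hGen_mem_par hy
    exact hR _ _ (skew_mem (stLin_mem ha) hd (br_hGen_mem hy i j a))
  · by_cases hij : i = j
    · subst hij; rw [stLin_self]; simp
    by_cases hkl : k = l
    · subst hkl; rw [stLin_self]; simp
    by_cases hjk : j = k
    · subst hjk
      by_cases hil : i = l
      · subst hil
        exact hH (br_stLin_mem_span hij a b)
      · exact hR _ _ (br_stLin_mem hij hkl hil a b)
    · by_cases hil : i = l
      · subst hil
        exact hR _ _ (br_stLin_mem' hkl hij (Ne.symm hjk) a b)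
      · rw [br_stLin_eq_zero hjk hil]
        exact zero_mem _

theorem exists_stH_add (x : St 𝒜 p) :
    ∃ h ∈ stH 𝒜 p, ∃ a : Fin 4 → Fin 4 → A, x = h + ∑ i, ∑ j, stLin 𝒜 p i j (a i j) := by
  have hx := span_hGen_union x
  induction hx using Submodule.span_induction with
  | zero => exact ⟨0, zero_mem _, 0, by simp⟩
  | add x y _ _ h h' =>
    obtain ⟨h, hh, a, rfl⟩ := h
    obtain ⟨h', hh', a', rfl⟩ := h'
    refine ⟨h + h', add_mem hh hh', a + a', ?_⟩
    simp only [Pi.add_apply, map_add, Finset.sum_add_distrib]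
    abel
  | smul c x _ h =>
    obtain ⟨h, hh, a, rfl⟩ := h
    refine ⟨c • h, Submodule.smul_mem _ _ hh, c • a, ?_⟩
    simp only [Pi.smul_apply, map_smul, smul_add, Finset.smul_sum]
  | mem x hx =>
    rcases hx with hx | ⟨i, j, d, a, ha, rfl⟩
    · exact ⟨x, stH_eq_span (𝒜 := 𝒜) ▸ Submodule.subset_span hx, 0, by simp⟩
    · refine ⟨0, zero_mem _, Pi.single i (Pi.single j a), ?_⟩
      rw [Finset.sum_eq_single i, Finset.sum_eq_single j]
      · simp
      · intro j' _ h; simp [h]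
      · simp
      · intro i' _ h; simp [h]
      · simp

theorem br_stH_mem {h : St 𝒜 p} (hh : h ∈ stH 𝒜 p) (i j : Fin 4) (a : A) :
    br K h (stLin 𝒜 p i j a) ∈ LinearMap.range (stLin 𝒜 p i j) := by
  rw [stH_eq_span] at hh
  induction hh using Submodule.span_induction with
  | zero => simp
  | add x x' _ _ h h' => rw [map_add]; exact add_mem h h'
  | smul c x _ h => rw [map_smul]; exact Submodule.smul_mem _ _ h
  | mem x hx => exact br_hGen_mem hx i j a

end FourIndices

/-! ## The cocycle on matrices -/

section Parity

variable {K : Type u} [CommRing K] {A : Type v} [Ring A] [Algebra K A]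
  (𝒜 : ZMod 2 → Submodule K A) [GradedAlgebra 𝒜]

/-- The parity involution of a superalgebra. -/
def parityInv : A →ₗ[K] A := GradedAlgebra.proj 𝒜 0 - GradedAlgebra.proj 𝒜 1

variable {𝒜}

theorem proj_of_mem {d : ZMod 2} {a : A} (ha : a ∈ 𝒜 d) (e : ZMod 2) :
    GradedAlgebra.proj 𝒜 e a = if d = e then a else 0 := by
  rw [GradedAlgebra.proj_apply]
  split_ifs with h
  · subst h; exact DirectSum.decompose_of_mem_same 𝒜 ha
  · exact DirectSum.decompose_of_mem_ne 𝒜 ha h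

theorem parityInv_of_mem {d : ZMod 2} {a : A} (ha : a ∈ 𝒜 d) :
    parityInv 𝒜 a = (-1 : ℤˣ) ^ d • a := by
  rw [parityInv, LinearMap.sub_apply, proj_of_mem ha, proj_of_mem ha]
  rcases zmod_two_cases d with rfl | rfl <;> simp

theorem proj_zero_add (a : A) : GradedAlgebra.proj 𝒜 0 a + GradedAlgebra.proj 𝒜 1 a = a := by
  induction a using graded_induction (𝒜 := 𝒜) with
  | hadd h h' => simp only [map_add]; rw [add_add_add_comm, h, h']
  | @h d a ha =>
    rw [proj_of_mem ha, proj_of_mem ha]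
    rcases zmod_two_cases d with rfl | rfl <;> simp

variable {n : ℕ}

theorem mkQ_mul_sub_mul {d e : ZMod 2} {a b : A} (ha : a ∈ 𝒜 d) (hb : b ∈ 𝒜 e) (x y : A) :
    (commIdeal 𝒜 n).mkQ (x * (a * b) * y) = (-1 : ℤˣ) ^ (d * e) • (commIdeal 𝒜 n).mkQ (x * (b * a) * y) := by
  rw [← sub_eq_zero, ← map_units_smul, ← map_sub]
  refine (Submodule.Quotient.mk_eq_zero _).2 (Submodule.subset_span
    ⟨x, y, _, .inr ⟨d, e, a, b, ha, hb, rfl⟩, ?_⟩)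
  rw [mul_sub, sub_mul, mul_smul_comm, smul_mul_assoc]

theorem mkQ_nsmul (a : A) : n • (commIdeal 𝒜 n).mkQ a = 0 := by
  rw [← map_nsmul]
  exact (Submodule.Quotient.mk_eq_zero _).2 (Submodule.subset_span
    ⟨1, 1, _, .inl ⟨a, rfl⟩, by simp⟩)

/-- The span that defines `commIdeal` is a two-sided ideal because its generators already carry
arbitrary left and right factors. -/
theorem mul_mem_commIdeal {a : A} (ha : a ∈ commIdeal 𝒜 n) (x y : A) :
    x * a * y ∈ commIdeal 𝒜 n := by
  induction ha using Submodule.span_induction with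
  | zero => simp
  | add a b _ _ h h' => rw [mul_add, add_mul]; exact add_mem h h'
  | smul c a _ h => rw [mul_smul_comm, smul_mul_assoc]; exact Submodule.smul_mem _ _ h
  | mem a ha =>
    obtain ⟨x', y', g, hg, rfl⟩ := ha
    exact Submodule.subset_span ⟨x * x', y' * y, g, hg, by simp only [mul_assoc]⟩

end Parity

/-! ### Polarized 2×2 minors with super signs -/

section Polar

variable {K : Type u} [CommRing K] {A : Type v} [Ring A] [Algebra K A]
  (𝒜 : ZMod 2 → Submodule K A) [GradedAlgebra 𝒜]

/-- The polarized determinant of the minor with rows `i`, `k` and columns `j`, `l`, with the signs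
of the super setting. -/
def polar (i j k l : Fin 4) :
    Matrix (Fin 4) (Fin 4) A →ₗ[K] Matrix (Fin 4) (Fin 4) A →ₗ[K] A :=
  LinearMap.mk₂ K (fun x y => x i j * parityInv 𝒜 (y k l) + x k l * parityInv 𝒜 (y i j)
      - x i l * parityInv 𝒜 (y k j) - x k j * parityInv 𝒜 (y i l))
    (fun _ _ _ => by simp only [Matrix.add_apply, add_mul]; abel)
    (fun _ _ _ => by simp only [Matrix.smul_apply, smul_mul_assoc, smul_add, smul_sub])
    (fun _ _ _ => by simp only [Matrix.add_apply, map_add, mul_add]; abel)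
    (fun _ _ _ => by
      simp only [Matrix.smul_apply, map_smul, mul_smul_comm, smul_add, smul_sub])

theorem polar_apply (i j k l : Fin 4) (x y : Matrix (Fin 4) (Fin 4) A) :
    polar 𝒜 i j k l x y = x i j * parityInv 𝒜 (y k l) + x k l * parityInv 𝒜 (y i j)
      - x i l * parityInv 𝒜 (y k j) - x k j * parityInv 𝒜 (y i l) := rfl

variable {𝒜} {N : Type w} [AddCommGroup N] [Module K N] {q : A →ₗ[K] N} {p : Fin 4 → ZMod 2}
  {i j k l : Fin 4} {d e f : ZMod 2} {x y z : Matrix (Fin 4) (Fin 4) A}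

theorem sum_eq_of_allDistinct (h : AllDistinct i j k l) {M : Type w} [AddCommMonoid M]
    (g : Fin 4 → M) : ∑ m, g m = g i + g j + g k + g l := by
  have hu : (Finset.univ : Finset (Fin 4)) = {i, j, k, l} := by
    revert i j k l; decide
  obtain ⟨h1, h2, h3, h4, h5, h6⟩ := h
  rw [hu, Finset.sum_insert (by simp [h1, h2, h3]), Finset.sum_insert (by simp [h4, h5]),
    Finset.sum_insert (by simp [h6]), Finset.sum_singleton]
  simp only [add_assoc]

variable (𝒜 q) in
/-- The linear map `q` vanishes on the ideal generated by the super commutators. -/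
def KillsComm : Prop := ∀ ⦃d e : ZMod 2⦄ ⦃a b : A⦄ (x y : A), a ∈ 𝒜 d → b ∈ 𝒜 e →
  q (x * (a * b) * y) = (-1 : ℤˣ) ^ (d * e) • q (x * (b * a) * y)

section Swap

variable {a b c : A}

theorem KillsComm.swap (hq : KillsComm 𝒜 q) (ha : a ∈ 𝒜 d) (hb : b ∈ 𝒜 e) :
    q (b * a) = (-1 : ℤˣ) ^ (d * e) • q (a * b) := by
  have h := hq 1 1 hb ha
  rwa [one_mul, mul_one, one_mul, mul_one, mul_comm e d] at h

theorem KillsComm.swap₁₂ (hq : KillsComm 𝒜 q) (ha : a ∈ 𝒜 d) (hb : b ∈ 𝒜 e) (c : A) :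
    q (b * a * c) = (-1 : ℤˣ) ^ (d * e) • q (a * b * c) := by
  have h := hq 1 c hb ha
  rwa [one_mul, one_mul, mul_comm e d] at h

theorem KillsComm.swap₂₃ (hq : KillsComm 𝒜 q) (a : A) (hb : b ∈ 𝒜 e) (hc : c ∈ 𝒜 f) :
    q (a * c * b) = (-1 : ℤˣ) ^ (e * f) • q (a * b * c) := by
  have h := hq a 1 hc hb
  rwa [mul_one, mul_one, ← mul_assoc, ← mul_assoc, mul_comm f e] at h

theorem KillsComm.rotate₁ (hq : KillsComm 𝒜 q) (ha : a ∈ 𝒜 d) (hb : b ∈ 𝒜 e) (hc : c ∈ 𝒜 f) :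
    q (b * c * a) = (-1 : ℤˣ) ^ (d * f + d * e) • q (a * b * c) := by
  rw [hq.swap₂₃ b ha hc, hq.swap₁₂ ha hb, smul_smul, uzpow_add]

theorem KillsComm.rotate₂ (hq : KillsComm 𝒜 q) (ha : a ∈ 𝒜 d) (hb : b ∈ 𝒜 e) (hc : c ∈ 𝒜 f) :
    q (c * a * b) = (-1 : ℤˣ) ^ (d * f + e * f) • q (a * b * c) := by
  rw [hq.swap₁₂ ha hc b, hq.swap₂₃ a hb hc, smul_smul, uzpow_add]

theorem KillsComm.reverse (hq : KillsComm 𝒜 q) (ha : a ∈ 𝒜 d) (hb : b ∈ 𝒜 e) (hc : c ∈ 𝒜 f) :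
    q (c * b * a) = (-1 : ℤˣ) ^ (e * f + (d * f + d * e)) • q (a * b * c) := by
  rw [hq.swap₁₂ hb hc a, hq.rotate₁ ha hb hc, smul_smul, ← uzpow_add]

end Swap

/-- The supertrace of homogeneous `z` is annihilated, even after multiplication. -/
def StrZero (q : A →ₗ[K] N) (p : Fin 4 → ZMod 2) (d : ZMod 2)
    (z : Matrix (Fin 4) (Fin 4) A) : Prop :=
  ∀ a b : A, ∑ m, (-1 : ℤˣ) ^ (p m * (1 + d)) • q (a * z m m * b) = 0

/-- Solves the supertrace condition for the diagonal entry at `l`. The rows `i`, `k` and the columns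
`j`, `l` have opposite parities, so the coefficients separate the two groups of diagonal entries. -/
theorem StrZero.eq (hd : AllDistinct i j k l) (hp : p k = p i) (hj : p j = p i + 1)
    (hl : p l = p i + 1) (hz : StrZero q p d z) (a b : A) :
    q (a * z l l * b) = - q (a * z j j * b)
      + (-1 : ℤˣ) ^ d • (q (a * z i i * b) + q (a * z k k * b)) := by
  have h := hz a b
  rw [sum_eq_of_allDistinct hd, hp, hj, hl] at h
  have h2 : (1 + 1 : ZMod 2) = 0 := by decide
  rcases zmod_two_cases d with rfl | rfl <;> rcases zmod_two_cases (p i) with hi | hi <;>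
    simp only [hi, mul_zero, zero_mul, mul_one, add_zero, zero_add, h2, uzpow_zero,
        uzpow_one, one_smul, Units.neg_smul] at h ⊢ <;>
    first
    | linear_combination (norm := module) h
    | linear_combination (norm := module) -h

theorem StrZero.eq_left (hd : AllDistinct i j k l) (hp : p k = p i) (hj : p j = p i + 1)
    (hl : p l = p i + 1) (hz : StrZero q p d z) (a b : A) :
    q (z l l * a * b) = - q (z j j * a * b)
      + (-1 : ℤˣ) ^ d • (q (z i i * a * b) + q (z k k * a * b)) := by
  simpa only [one_mul, ← mul_assoc] using hz.eq hd hp hj hl 1 (a * b)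

theorem StrZero.eq_right (hd : AllDistinct i j k l) (hp : p k = p i) (hj : p j = p i + 1)
    (hl : p l = p i + 1) (hz : StrZero q p d z) (a b : A) :
    q (a * b * z l l) = - q (a * b * z j j)
      + (-1 : ℤˣ) ^ d • (q (a * b * z i i) + q (a * b * z k k)) := by
  simpa only [mul_one] using hz.eq hd hp hj hl (a * b) 1

set_option maxHeartbeats 4000000 in
-- All terms are brought to words in x, y, z in this order by supercommutativity. A diagonal entry
-- then meets the product of two complementary entries of the minor with a weight proportional to
-- the supertrace, and removing the `l`-th diagonal entry by `StrZero` leaves a sum that cancels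
-- identically.
theorem polar_cyclic (hd : AllDistinct i j k l) (hp : p k = p i) (hj : p j = p i + 1)
    (hl : p l = p i + 1) (hq : KillsComm 𝒜 q)
    (hx : x ∈ matPar 𝒜 p d) (hy : y ∈ matPar 𝒜 p e) (hz : z ∈ matPar 𝒜 p f)
    (sx : StrZero q p d x) (sy : StrZero q p e y) (sz : StrZero q p f z) :
    (-1 : ℤˣ) ^ (d * f) • q (polar 𝒜 i j k l (matBr 𝒜 p x y) z)
      + (-1 : ℤˣ) ^ (d * e) • q (polar 𝒜 i j k l (matBr 𝒜 p y z) x)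
      + (-1 : ℤˣ) ^ (e * f) • q (polar 𝒜 i j k l (matBr 𝒜 p z x) y) = 0 := by
  -- In an ordered word x stands on the left, y in the middle and z on the right; the supertrace
  -- relation is needed in these three positions.
  have sx' := sx.eq_left hd hp hj hl
  have sy' := sy.eq hd hp hj hl
  have sz' := sz.eq_right hd hp hj hl
  -- One rewriting rule, with its Koszul sign, for each of the five other orders of three entries.
  have h1 : ∀ a b c a' b' c', q (y a a' * x b b' * z c c') = _ := fun a b c a' b' c' =>
    hq.swap₁₂ (hx b b') (hy a a') (z c c')
  have h2 : ∀ a b c a' b' c', q (x a a' * z b b' * y c c') = _ := fun a b c a' b' c' =>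
    hq.swap₂₃ (x a a') (hy c c') (hz b b')
  have h3 : ∀ a b c a' b' c', q (y a a' * z b b' * x c c') = _ := fun a b c a' b' c' =>
    hq.rotate₁ (hx c c') (hy a a') (hz b b')
  have h4 : ∀ a b c a' b' c', q (z a a' * x b b' * y c c') = _ := fun a b c a' b' c' =>
    hq.rotate₂ (hx b b') (hy c c') (hz a a')
  have h5 : ∀ a b c a' b' c', q (z a a' * y b b' * x c c') = _ := fun a b c a' b' c' =>
    hq.reverse (hx c c') (hy b b') (hz a a')
  rw [matBr_of_mem hx hy, matBr_of_mem hy hz, matBr_of_mem hz hx]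
  simp only [polar_apply]
  simp only [parityInv_of_mem (hx _ _), parityInv_of_mem (hy _ _),
    parityInv_of_mem (hz _ _), Matrix.sub_apply, Matrix.smul_apply, Matrix.mul_apply,
    sum_eq_of_allDistinct hd, mul_smul_comm, smul_mul_assoc, sub_mul, add_mul, map_add, map_sub,
    map_units_smul, h1, h2, h3, h4, h5, sx', sy', sz', hp, hj, hl]
  have hs : (1 + 1 : ZMod 2) = 0 := by decide
  -- Once all parities are fixed every sign is a numeral and the identity is linear in the ordered
  -- words.
  rcases zmod_two_cases (p i) with hi | hi <;> rcases zmod_two_cases d with rfl | rfl <;>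
    rcases zmod_two_cases e with rfl | rfl <;> rcases zmod_two_cases f with rfl | rfl <;>
    simp only [hi, mul_zero, zero_mul, mul_one, add_zero, zero_add, hs, uzpow_zero,
        uzpow_one, one_smul, Units.neg_smul] <;> module

end Polar

section Polar

variable {K : Type u} [CommRing K] {A : Type v} [Ring A] [Algebra K A]
  {𝒜 : ZMod 2 → Submodule K A} [GradedAlgebra 𝒜]
  {N : Type w} [AddCommGroup N] [Module K N] {q : A →ₗ[K] N} {p : Fin 4 → ZMod 2}
  {i j k l : Fin 4} {d e f : ZMod 2} {x y z : Matrix (Fin 4) (Fin 4) A}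

theorem polar_mem (hp : p i + p j + p k + p l = 0)
    (hx : x ∈ matPar 𝒜 p d) (hy : y ∈ matPar 𝒜 p e) : polar 𝒜 i j k l x y ∈ 𝒜 (d + e) := by
  have key : ∀ a b a' b', p a + p b + p a' + p b' = 0 →
      x a b * parityInv 𝒜 (y a' b') ∈ 𝒜 (d + e) := by
    intro a b a' b' h
    rw [parityInv_of_mem (hy _ _), mul_smul_comm]
    refine units_smul_mem _ _ ?_
    have h' := SetLike.mul_mem_graded (hx a b) (hy a' b')
    rwa [show d + p a + p b + (e + p a' + p b') = d + e by linear_combination h] at h'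
  rw [polar_apply]
  exact sub_mem (sub_mem (add_mem (key _ _ _ _ hp) (key _ _ _ _ (by linear_combination hp)))
    (key _ _ _ _ (by linear_combination hp))) (key _ _ _ _ (by linear_combination hp))

theorem polar_skew (hp : p k = p i) (hj : p j = p i + 1)
    (hl : p l = p i + 1) (hq : KillsComm 𝒜 q)
    (hx : x ∈ matPar 𝒜 p d) (hy : y ∈ matPar 𝒜 p e) :
    q (polar 𝒜 i j k l x y) = -((-1 : ℤˣ) ^ (d * e) • q (polar 𝒜 i j k l y x)) := by
  have h1 : ∀ a b a' b', q (y a a' * x b b') = _ := fun a b a' b' =>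
    hq.swap (hx b b') (hy a a')
  simp only [polar_apply, parityInv_of_mem (hx _ _), parityInv_of_mem (hy _ _), mul_smul_comm,
    map_add, map_sub, map_units_smul, h1, hp, hj, hl]
  have hs : (1 + 1 : ZMod 2) = 0 := by decide
  rcases zmod_two_cases (p i) with hi | hi <;> rcases zmod_two_cases d with rfl | rfl <;>
    rcases zmod_two_cases e with rfl | rfl <;>
    simp only [hi, mul_zero, zero_mul, mul_one, add_zero, zero_add, hs, uzpow_zero,
        uzpow_one, one_smul, Units.neg_smul] <;> module

/-- Antisymmetry alone would only give twice the value. For even `x` the entries at rows `i`, `k`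
and columns `j`, `l` are odd, and odd elements anticommute under `q`, so each of the two pairs of
products cancels. -/
theorem polar_alt (hp : p k = p i) (hj : p j = p i + 1)
    (hl : p l = p i + 1) (hq : KillsComm 𝒜 q) (hx : x ∈ matPar 𝒜 p 0) :
    q (polar 𝒜 i j k l x x) = 0 := by
  have h1 := hq.swap (hx i j) (hx k l)
  have h2 := hq.swap (hx i l) (hx k j)
  simp only [polar_apply, parityInv_of_mem (hx _ _), mul_smul_comm,
    map_add, map_sub, map_units_smul, h1, h2, hp, hj, hl]
  have hs : (1 + 1 : ZMod 2) = 0 := by decide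
  rcases zmod_two_cases (p i) with hi | hi <;>
    simp only [hi, mul_zero, zero_mul, mul_one, add_zero, zero_add, hs, uzpow_zero,
        uzpow_one, one_smul, Units.neg_smul] <;> module

/-! ### Minors with values annihilated by 2 -/

section CharTwo

theorem units_smul_eq_of_char_two (h2 : ∀ a, q a + q a = 0) (s : ℤˣ) (a : A) : s • q a = q a := by
  rcases Int.units_eq_one_or s with rfl | rfl
  · simp
  · rw [Units.neg_smul, one_smul, neg_eq_of_add_eq_zero_left (h2 a)]

theorem mul_parityInv_of_char_two (h2 : ∀ a, q a + q a = 0) (a b : A) :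
    q (a * parityInv 𝒜 b) = q (a * b) := by
  induction b using graded_induction (𝒜 := 𝒜) with
  | hadd h h' => rw [map_add, mul_add, mul_add, map_add, map_add, h, h']
  | h hb => rw [parityInv_of_mem hb, mul_smul_comm, map_units_smul,
      units_smul_eq_of_char_two h2]

theorem KillsComm.comm_of_char_two (h2 : ∀ a, q a + q a = 0) (hq : KillsComm 𝒜 q) (a b c c' : A) :
    q (c * (a * b) * c') = q (c * (b * a) * c') := by
  induction a using graded_induction (𝒜 := 𝒜) with
  | hadd h h' => simp only [mul_add, add_mul, map_add, h, h']
  | h ha =>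
    induction b using graded_induction (𝒜 := 𝒜) with
    | hadd h h' => simp only [mul_add, add_mul, map_add, h, h']
    | h hb => rw [hq c c' ha hb, units_smul_eq_of_char_two h2]

/-- Without signs the minor is a polarized permanent, so parities no longer distinguish rows from
columns. -/
theorem polar_of_char_two (h2 : ∀ a, q a + q a = 0) (i j k l : Fin 4) (x y : Matrix (Fin 4)
    (Fin 4) A) :
    q (polar 𝒜 i j k l x y)
      = q (x i j * y k l) + q (x k l * y i j) + q (x i l * y k j) + q (x k j * y i l) := by
  have hn : ∀ a, - q a = q a := fun a => neg_eq_of_add_eq_zero_left (h2 a)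
  rw [polar_apply, map_sub, map_sub, map_add]
  simp only [mul_parityInv_of_char_two h2, sub_eq_add_neg, hn]

theorem polar_skew_of_char_two (h2 : ∀ a, q a + q a = 0) (hq : KillsComm 𝒜 q) (s : ℤˣ) :
    q (polar 𝒜 i j k l x y) = -(s • q (polar 𝒜 i j k l y x)) := by
  have hn : ∀ a, - q a = q a := fun a => neg_eq_of_add_eq_zero_left (h2 a)
  have hc : ∀ a b, q (a * b) = q (b * a) := fun a b => by
    simpa using hq.comm_of_char_two h2 a b 1 1
  rw [units_smul_eq_of_char_two h2, hn, polar_of_char_two h2, polar_of_char_two h2,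
    hc (y i j), hc (y k l), hc (y i l), hc (y k j)]
  abel

theorem polar_alt_of_char_two (h2 : ∀ a, q a + q a = 0) (hq : KillsComm 𝒜 q) :
    q (polar 𝒜 i j k l x x) = 0 := by
  have hc : ∀ a b, q (a * b) = q (b * a) := fun a b => by
    simpa using hq.comm_of_char_two h2 a b 1 1
  rw [polar_of_char_two h2, hc (x k l), hc (x k j), h2, zero_add, h2]

theorem StrZero.eq_of_char_two (h2 : ∀ a, q a + q a = 0) (hd : AllDistinct i j k l)
    (hz : StrZero q p d z) (a b : A) :
    q (a * z l l * b) = q (a * z i i * b) + q (a * z j j * b) + q (a * z k k * b) := by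
  have h := hz a b
  rw [sum_eq_of_allDistinct hd] at h
  simp only [units_smul_eq_of_char_two h2] at h
  rw [← neg_eq_of_add_eq_zero_left h, neg_eq_of_add_eq_zero_left (h2 _)]

set_option maxHeartbeats 4000000 in
-- The argument of `polar_cyclic` with all signs dropped. The weight of a diagonal entry is now the
-- trace for every splitting of the indices into rows and columns, so no assumption on `p` is needed
-- and the outer signs are arbitrary.
theorem polar_cyclic_of_char_two (h2 : ∀ a, q a + q a = 0) (hd : AllDistinct i j k l)
    (hq : KillsComm 𝒜 q)
    (hx : x ∈ matPar 𝒜 p d) (hy : y ∈ matPar 𝒜 p e) (hz : z ∈ matPar 𝒜 p f)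
    (sx : StrZero q p d x) (sy : StrZero q p e y) (sz : StrZero q p f z) (s s' s'' : ℤˣ) :
    s • q (polar 𝒜 i j k l (matBr 𝒜 p x y) z) + s' • q (polar 𝒜 i j k l (matBr 𝒜 p y z) x)
      + s'' • q (polar 𝒜 i j k l (matBr 𝒜 p z x) y) = 0 := by
  have hn : ∀ a, - q a = q a := fun a => neg_eq_of_add_eq_zero_left (h2 a)
  have hz2 : ∀ a, (2 : ℤ) • q a = 0 := fun a => by rw [two_zsmul, h2]
  have h1 : ∀ a b c, q (b * a * c) = q (a * b * c) := fun a b c => by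
    simpa using hq.comm_of_char_two h2 b a 1 c
  have h3 : ∀ a b c, q (a * c * b) = q (a * b * c) := fun a b c => by
    simpa [mul_assoc] using hq.comm_of_char_two h2 c b a 1
  have sx' : ∀ b c, q (x l l * b * c) = q (x i i * b * c) + q (x j j * b * c) + q (x k k * b * c) :=
    fun b c => by simpa only [one_mul, ← mul_assoc] using sx.eq_of_char_two h2 hd 1 (b * c)
  have sy' := sy.eq_of_char_two h2 hd
  have sz' : ∀ b c, q (b * c * z l l) = q (b * c * z i i) + q (b * c * z j j) + q (b * c * z k k) :=
    fun b c => by simpa only [mul_one] using sz.eq_of_char_two h2 hd (b * c) 1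
  rw [matBr_of_mem hx hy, matBr_of_mem hy hz, matBr_of_mem hz hx]
  simp only [polar_of_char_two h2, units_smul_eq_of_char_two h2]
  have e1 : ∀ a a' b b' c c', q (y a a' * x b b' * z c c') = q (x b b' * y a a' * z c c') :=
    fun _ _ _ _ _ _ => h1 _ _ _
  have e2 : ∀ a a' b b' c c', q (x a a' * z b b' * y c c') = q (x a a' * y c c' * z b b') :=
    fun _ _ _ _ _ _ => h3 _ _ _
  have e3 : ∀ a a' b b' c c', q (y a a' * z b b' * x c c') = q (x c c' * y a a' * z b b') :=
    fun _ _ _ _ _ _ => by rw [h3, h1]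
  have e4 : ∀ a a' b b' c c', q (z a a' * x b b' * y c c') = q (x b b' * y c c' * z a a') :=
    fun _ _ _ _ _ _ => by rw [h1, h3]
  have e5 : ∀ a a' b b' c c', q (z a a' * y b b' * x c c') = q (x c c' * y b b' * z a a') :=
    fun _ _ _ _ _ _ => by rw [h1, h3, h1]
  simp only [Matrix.sub_apply, Matrix.smul_apply, Matrix.mul_apply,
    sum_eq_of_allDistinct hd, smul_mul_assoc, sub_mul, add_mul, smul_add, map_add, map_sub,
    map_units_smul, units_smul_eq_of_char_two h2, sub_eq_add_neg, neg_add, neg_mul, map_neg, hn,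
    e1, e2, e3, e4, e5, sx', sy', sz']
  -- After ordering the words and eliminating one diagonal entry, every monomial that survives
  -- collection has coefficient 2.
  abel_nf
  simp only [hz2, add_zero, zero_add]

end CharTwo

end Polar

/-! ## The supertrace -/

section Supertrace

variable {K : Type u} [CommRing K] {A : Type v} [Ring A] [Algebra K A]
  (𝒜 : ZMod 2 → Submodule K A) [GradedAlgebra 𝒜] (p : Fin 4 → ZMod 2)

/-- The supertrace of a matrix. -/
def supertrace : Matrix (Fin 4) (Fin 4) A →ₗ[K] A where
  toFun z := ∑ m, ((-1 : ℤˣ) ^ p m • GradedAlgebra.proj 𝒜 0 (z m m)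
    + GradedAlgebra.proj 𝒜 1 (z m m))
  map_add' x y := by
    simp only [Matrix.add_apply, map_add, smul_add, ← Finset.sum_add_distrib]
    refine Finset.sum_congr rfl fun _ _ => ?_
    abel
  map_smul' c x := by
    simp only [Matrix.smul_apply, map_smul, RingHom.id_apply, Finset.smul_sum, smul_add]
    refine Finset.sum_congr rfl fun _ _ => ?_
    rw [smul_comm]

variable {𝒜 p}

theorem supertrace_apply (z : Matrix (Fin 4) (Fin 4) A) :
    supertrace 𝒜 p z = ∑ m, ((-1 : ℤˣ) ^ p m • GradedAlgebra.proj 𝒜 0 (z m m)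
      + GradedAlgebra.proj 𝒜 1 (z m m)) := rfl

theorem supertrace_of_mem {d : ZMod 2} {z : Matrix (Fin 4) (Fin 4) A} (hz : z ∈ matPar 𝒜 p d) :
    supertrace 𝒜 p z = ∑ m, (-1 : ℤˣ) ^ (p m * (1 + d)) • z m m := by
  rw [supertrace_apply]
  refine Finset.sum_congr rfl fun m _ => ?_
  have h : z m m ∈ 𝒜 d := by
    have h := hz m m
    rwa [add_assoc, CharTwo.add_self_eq_zero, add_zero] at h
  have hs : (1 + 1 : ZMod 2) = 0 := by decide
  rw [proj_of_mem h, proj_of_mem h]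
  rcases zmod_two_cases d with rfl | rfl <;> simp [hs]

theorem supertrace_br {n : ℕ} {d e : ZMod 2} {x y : Matrix (Fin 4) (Fin 4) A}
    (hx : x ∈ matPar 𝒜 p d) (hy : y ∈ matPar 𝒜 p e) :
    supertrace 𝒜 p (matBr 𝒜 p x y) ∈ commIdeal 𝒜 n := by
  have hq : KillsComm 𝒜 (commIdeal 𝒜 n).mkQ := fun _ _ _ _ x y ha hb => mkQ_mul_sub_mul ha hb x y
  have hxy : matBr 𝒜 p x y ∈ matPar 𝒜 p (d + e) :=
    br_mem (K := K) (L := GenLin 𝒜 p) (d := d) (e := e) (x := x) (y := y) hx hy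
  rw [supertrace_of_mem hxy, ← Submodule.Quotient.mk_eq_zero]
  change (commIdeal 𝒜 n).mkQ _ = 0
  rw [matBr_of_mem hx hy]
  simp only [Matrix.sub_apply, Matrix.smul_apply, Matrix.mul_apply, map_sum, map_units_smul,
    map_sub, smul_sub, hq.swap (hx _ _) (hy _ _), Finset.sum_sub_distrib, Finset.smul_sum]
  rw [sub_eq_zero]
  conv_rhs => rw [Finset.sum_comm]
  refine Finset.sum_congr rfl fun m _ => Finset.sum_congr rfl fun k _ => ?_
  rw [smul_smul, smul_smul, ← uzpow_add, ← uzpow_add]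
  congr 2
  -- Balance of signs: the supertrace weights of the two diagonal places differ exactly by the sign
  -- of the supercommutator times the Koszul sign of exchanging the two entries.
  have h : ∀ a b d e : ZMod 2,
      a * (1 + (d + e)) = b * (1 + (d + e)) + (d * e + (d + a + b) * (e + b + a)) := by decide
  exact (h _ _ _ _).trans (add_assoc _ _ _).symm

/-- The supertrace of a supercommutator is a combination of supercommutators in A. Since `commIdeal`
is a two-sided ideal, outer factors `a` and `b` do no harm. -/
theorem strZero_of_mem_derived {n : ℕ} {d : ZMod 2} {z : GenLin 𝒜 p}
    (hz : z ∈ derived K (GenLin 𝒜 p)) (hd : z ∈ par K d) :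
    StrZero (commIdeal 𝒜 n).mkQ p d (z : Matrix (Fin 4) (Fin 4) A) := by
  have key : derived K (GenLin 𝒜 p) ≤ (commIdeal 𝒜 n).comap (supertrace 𝒜 p) := by
    refine Submodule.span_le.2 ?_
    rintro _ ⟨x, y, rfl⟩
    obtain ⟨x0, hx0, x1, hx1, rfl⟩ := exists_add (K := K) x
    obtain ⟨y0, hy0, y1, hy1, rfl⟩ := exists_add (K := K) y
    simp only [map_add, LinearMap.add_apply]
    exact add_mem (add_mem (supertrace_br hx0 hy0) (supertrace_br hx1 hy0))
      (add_mem (supertrace_br hx0 hy1) (supertrace_br hx1 hy1))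
  intro a b
  have h := mul_mem_commIdeal (key hz) a b
  rw [supertrace_of_mem hd, ← Submodule.Quotient.mk_eq_zero, Finset.mul_sum, Finset.sum_mul] at h
  change (commIdeal 𝒜 n).mkQ _ = 0 at h
  simpa only [map_sum, mul_smul_comm, smul_mul_assoc, map_units_smul] using h

end Supertrace

/-! ## The canonical homomorphism to matrices -/

section CanonicalHom

variable {K : Type u} [CommRing K] {A : Type v} [Ring A] [Algebra K A]
  {𝒜 : ZMod 2 → Submodule K A} [GradedAlgebra 𝒜] {p : Fin 4 → ZMod 2}

theorem elemMat_mem (i j : Fin 4) {d : ZMod 2} {a : A} (ha : a ∈ 𝒜 d) :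
    elemMat 𝒜 p i j a ∈ par K (p i + p j + d) := by
  intro i' j'
  change Matrix.single i j a i' j' ∈ _
  rw [Matrix.single_apply]
  split_ifs with h
  · obtain ⟨rfl, rfl⟩ := h
    have hi : p i + p i = 0 := CharTwo.add_self_eq_zero _
    have hj : p j + p j = 0 := CharTwo.add_self_eq_zero _
    rwa [show p i + p j + d + p i + p j = d by linear_combination hi + hj]
  · exact zero_mem _

theorem br_elemMat (i j k l : Fin 4) {d e : ZMod 2} {a b : A} (ha : a ∈ 𝒜 d) (hb : b ∈ 𝒜 e) :
    br K (elemMat 𝒜 p i j a) (elemMat 𝒜 p k l b)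
      = (if j = k then elemMat 𝒜 p i l (a * b) else 0)
        - (-1 : ℤˣ) ^ ((p i + p j + d) * (p k + p l + e)) •
          (if l = i then elemMat 𝒜 p k j (b * a) else 0) := by
  refine (matBr_of_mem (elemMat_mem i j ha) (elemMat_mem k l hb)).trans ?_
  have h : ∀ (i j k l : Fin 4) (a b : A), (Matrix.single i j a * Matrix.single k l b :
      Matrix (Fin 4) (Fin 4) A) = if j = k then Matrix.single i l (a * b) else 0 := by
    intro i j k l a b
    split_ifs with h
    · subst h; simp
    · simp [h]
  rw [elemMat, elemMat, h, h]
  rfl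

theorem elemMat_add (i j : Fin 4) (a b : A) :
    elemMat 𝒜 p i j (a + b) = elemMat 𝒜 p i j a + elemMat 𝒜 p i j b :=
  Matrix.single_add i j a b

theorem elemMat_smul (i j : Fin 4) (c : K) (a : A) :
    elemMat 𝒜 p i j (c • a) = c • elemMat 𝒜 p i j a :=
  (Matrix.smul_single c i j a).symm

variable (𝒜 p) in
/-- The entries of a matrix. -/
def matEntry (i j : Fin 4) : GenLin 𝒜 p →ₗ[K] A where
  toFun x := (x : Matrix (Fin 4) (Fin 4) A) i j
  map_add' _ _ := rfl
  map_smul' _ _ := rfl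

theorem matEntry_elemMat (i j k l : Fin 4) (a : A) :
    matEntry 𝒜 p i j (elemMat 𝒜 p k l a) = if k = i ∧ l = j then a else 0 :=
  Matrix.single_apply _ _ _ _ _

theorem elemMat_mem_derived {i j : Fin 4} (hij : i ≠ j) {d : ZMod 2} {a : A} (ha : a ∈ 𝒜 d) :
    elemMat 𝒜 p i j a ∈ derived K (GenLin 𝒜 p) := by
  obtain ⟨m, hmi, hmj⟩ := exists_third i j
  have h := br_elemMat (p := p) i m m j ha (SetLike.one_mem_graded 𝒜)
  rw [if_pos rfl, if_neg hij.symm, smul_zero, sub_zero, mul_one] at h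
  rw [← h]
  exact br_mem_derived _ _

variable (𝒜 p) in
/-- The canonical homomorphism from the Steinberg Lie superalgebra to the special linear one. -/
def stToSpecLin : Hom K (St 𝒜 p) (SpecLin 𝒜 p) :=
  presentedHom (stRel_homogeneous 𝒜 p)
    (fun x => ⟨elemMat 𝒜 p x.i x.j x.a, elemMat_mem_derived x.ne x.a.2⟩)
    (fun x => elemMat_mem (p := p) x.i x.j x.a.2)
    (by
      rintro r (⟨h, a, b⟩ | ⟨h, c, a⟩ | ⟨hij, hjk, hik, a, b⟩ | ⟨hij, hkl, hjk, hil, a, b⟩) <;>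
        apply Subtype.ext <;>
        simp only [map_sub, map_smul, freeLift_mul, freeF, freeLift_of]
      · refine sub_eq_zero.2 (sub_eq_of_eq_add' ?_)
        exact elemMat_add _ _ _ _
      · exact sub_eq_zero.2 (elemMat_smul _ _ _ _)
      · refine (congrArg (· - _) (br_elemMat (p := p) _ _ _ _ a.2 b.2)).trans ?_
        rw [if_pos rfl, if_neg hik.symm, smul_zero, sub_zero]
        exact sub_self _
      · refine (br_elemMat (p := p) _ _ _ _ a.2 b.2).trans ?_
        rw [if_neg hjk, if_neg hil.symm, smul_zero, sub_zero]
        rfl)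

theorem stToSpecLin_stF {i j : Fin 4} (h : i ≠ j) {d : ZMod 2} (a : 𝒜 d) :
    (stToSpecLin 𝒜 p (stF 𝒜 p h a) : GenLin 𝒜 p) = elemMat 𝒜 p i j a :=
  congrArg Subtype.val (presentedHom_of (stRel_homogeneous 𝒜 p) _ _ _ _)

variable (𝒜 p) in
/-- The canonical map from the Steinberg Lie superalgebra to matrices. -/
def stToMat : St 𝒜 p →ₗ[K] GenLin 𝒜 p :=
  (derived K (GenLin 𝒜 p)).subtype ∘ₗ (stToSpecLin 𝒜 p).toLinearMap

theorem stToMat_apply (x : St 𝒜 p) :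
    stToMat 𝒜 p x = (stToSpecLin 𝒜 p x : GenLin 𝒜 p) := rfl

theorem stToMat_mem_derived (x : St 𝒜 p) : stToMat 𝒜 p x ∈ derived K (GenLin 𝒜 p) :=
  (stToSpecLin 𝒜 p x).2

theorem stToMat_mem {d : ZMod 2} {x : St 𝒜 p} (hx : x ∈ par K d) :
    stToMat 𝒜 p x ∈ par K d :=
  (stToSpecLin 𝒜 p).map_par d x hx

theorem stToMat_br (x y : St 𝒜 p) :
    stToMat 𝒜 p (br K x y) = br K (stToMat 𝒜 p x) (stToMat 𝒜 p y) :=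
  congrArg Subtype.val ((stToSpecLin 𝒜 p).map_br x y)

theorem stToMat_stLin {i j : Fin 4} (hij : i ≠ j) (a : A) :
    stToMat 𝒜 p (stLin 𝒜 p i j a) = elemMat 𝒜 p i j a := by
  induction a using graded_induction (𝒜 := 𝒜) with
  | hadd h h' => rw [map_add, map_add, h, h', elemMat_add]
  | h ha =>
    rw [stLin_eq 𝒜 hij ha]
    exact stToSpecLin_stF hij _

/-- A bracket of opposite elementary matrices is diagonal; hence ℋ is invisible to the off-diagonal
entries. -/
theorem matEntry_hGen {h : St 𝒜 p} (hh : h ∈ hGen 𝒜 p) {i j : Fin 4} (hij : i ≠ j) :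
    matEntry 𝒜 p i j (stToMat 𝒜 p h) = 0 := by
  obtain ⟨k, l, d, e, a, b, hkl, ha, hb, rfl⟩ := hh
  have hz : ∀ m : Fin 4, ¬ (m = i ∧ m = j) := by
    rintro m ⟨rfl, rfl⟩
    exact hij rfl
  rw [stToMat_br, stToMat_stLin hkl, stToMat_stLin hkl.symm, br_elemMat k l l k ha hb,
    if_pos rfl, if_pos rfl, map_sub, map_units_smul, matEntry_elemMat, matEntry_elemMat,
    if_neg (hz k), if_neg (hz l), smul_zero, sub_zero]

theorem matEntry_stH {h : St 𝒜 p} (hh : h ∈ stH 𝒜 p) {i j : Fin 4} (hij : i ≠ j) :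
    matEntry 𝒜 p i j (stToMat 𝒜 p h) = 0 := by
  rw [stH_eq_span] at hh
  induction hh using Submodule.span_induction with
  | zero => rw [map_zero, map_zero]
  | add x y _ _ hx hy => rw [map_add, map_add, hx, hy, add_zero]
  | smul c x _ hx => rw [map_smul, map_smul, hx, smul_zero]
  | mem x hx => exact matEntry_hGen hx hij

/-- The off-diagonal entries of the image are the coefficients of the root components, since ℋ
contributes nothing to them. If they vanish, only the ℋ-component remains. -/
theorem mem_stH_of_stToMat_eq_zero {x : St 𝒜 p} (hx : stToMat 𝒜 p x = 0) : x ∈ stH 𝒜 p := by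
  obtain ⟨h, hh, a, rfl⟩ := exists_stH_add x
  have key : ∀ i j, stLin 𝒜 p i j (a i j) = 0 := by
    intro i j
    by_cases hij : i = j
    · subst hij; rw [stLin_self]; rfl
    have h0 : ∀ i' j', matEntry 𝒜 p i j (stToMat 𝒜 p (stLin 𝒜 p i' j' (a i' j')))
        = if i' = i ∧ j' = j then a i j else 0 := by
      intro i' j'
      by_cases hij' : i' = j'
      · subst hij'
        rw [stLin_self, if_neg (by rintro ⟨rfl, rfl⟩; exact hij rfl)]
        simp only [LinearMap.zero_apply, map_zero]
      · rw [stToMat_stLin hij', matEntry_elemMat]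
        split_ifs with h
        · obtain ⟨rfl, rfl⟩ := h; rfl
        · rfl
    have h1 := congrArg (matEntry 𝒜 p i j) hx
    simp only [map_add, map_sum, h0, matEntry_stH hh hij, zero_add, map_zero, ite_and,
      Finset.sum_ite_eq', Finset.mem_univ, if_true, Finset.sum_const_zero, Finset.sum_ite_irrel] at h1
    rw [h1, map_zero]
  simp only [key, Finset.sum_const_zero, add_zero]
  exact hh

/-- A kernel element lies in ℋ, so it maps F_ij(a) to some F_ij(b). The matrix of F_ij(b) is E_ij(b)
and must be zero, whence b = 0. The derivation rule extends this from root elements to ℋ. -/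
theorem br_eq_zero_of_stToMat_eq_zero {x : St 𝒜 p} (hx : stToMat 𝒜 p x = 0) (y : St 𝒜 p) :
    br K x y = 0 := by
  have key : ∀ {d : ZMod 2} {x : St 𝒜 p}, x ∈ par K d → stToMat 𝒜 p x = 0 → br K x y = 0 := by
    intro d x hd hx
    have hF : ∀ i j a, br K x (stLin 𝒜 p i j a) = 0 := by
      intro i j a
      by_cases hij : i = j
      · subst hij; rw [stLin_self]; simp
      obtain ⟨b, hb⟩ := br_stH_mem (mem_stH_of_stToMat_eq_zero hx) i j a
      have h := stToMat_stLin (𝒜 := 𝒜) (p := p) hij b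
      rw [hb, stToMat_br, hx, map_zero, LinearMap.zero_apply] at h
      have hb0 := congrArg (matEntry 𝒜 p i j) h
      rw [matEntry_elemMat, if_pos ⟨rfl, rfl⟩, map_zero] at hb0
      rw [← hb, ← hb0, map_zero]
    have hy := span_hGen_union y
    induction hy using Submodule.span_induction with
    | zero => simp
    | add y y' _ _ h h' => rw [map_add, h, h', add_zero]
    | smul c y _ h => rw [map_smul, h, smul_zero]
    | mem y hy =>
      rcases hy with ⟨i, j, e, f, a, b, hij, ha, hb, rfl⟩ | ⟨i, j, e, a, ha, rfl⟩
      · rw [leibniz hd (stLin_mem ha), hF, hF]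
        simp
      · exact hF i j a
  obtain ⟨x0, h0, x1, h1, rfl⟩ := exists_add (K := K) x
  rw [map_add] at hx
  obtain ⟨h0', h1'⟩ := par_eq_zero (stToMat_mem h0) (stToMat_mem h1) hx
  rw [map_add, LinearMap.add_apply, key h0 h0', key h1 h1', add_zero]

/-- Brackets involving off-diagonal elementary matrices are visibly in the image; the only delicate
generators of 𝔰𝔩 are brackets of two diagonal matrices. -/
theorem stToSpecLin_surjective : Function.Surjective (stToSpecLin 𝒜 p) := by
  have hE : ∀ {i j : Fin 4}, i ≠ j → ∀ a : A,
      elemMat 𝒜 p i j a ∈ LinearMap.range (stToMat 𝒜 p) :=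
    fun hij a => ⟨_, stToMat_stLin hij a⟩
  have hbr : ∀ {x y : GenLin 𝒜 p}, x ∈ LinearMap.range (stToMat 𝒜 p) →
      y ∈ LinearMap.range (stToMat 𝒜 p) → br K x y ∈ LinearMap.range (stToMat 𝒜 p) := by
    rintro _ _ ⟨x, rfl⟩ ⟨y, rfl⟩
    exact ⟨_, stToMat_br x y⟩
  have hs : ∀ x : GenLin 𝒜 p, x ∈ Submodule.span K {x : GenLin 𝒜 p | ∃ (i j : Fin 4) (d : ZMod 2) (a : A),
      a ∈ 𝒜 d ∧ x = elemMat 𝒜 p i j a} := by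
    intro x
    have hx : x = ∑ i, ∑ j, elemMat 𝒜 p i j ((x : Matrix (Fin 4) (Fin 4) A) i j) :=
      Matrix.matrix_eq_sum_single _
    rw [hx]
    refine Submodule.sum_mem _ fun i _ => Submodule.sum_mem _ fun j _ => ?_
    generalize (x : Matrix (Fin 4) (Fin 4) A) i j = a
    induction a using graded_induction (𝒜 := 𝒜) with
    | @hadd a b h h' =>
      rw [elemMat_add]
      exact add_mem h h'
    | h ha => exact Submodule.subset_span ⟨i, j, _, _, ha, rfl⟩
  have key : derived K (GenLin 𝒜 p) ≤ LinearMap.range (stToMat 𝒜 p) := by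
    refine Submodule.span_le.2 ?_
    rintro _ ⟨x, y, rfl⟩
    refine apply₂_mem_of_span (br K) ?_ (hs x) (hs y)
    rintro _ ⟨i, j, d, a, ha, rfl⟩ _ ⟨k, l, e, b, hb, rfl⟩
    by_cases hij : i = j
    · subst hij
      by_cases hkl : k = l
      · subst hkl
        rw [br_elemMat i i k k ha hb]
        by_cases hik : i = k
        · subst hik
          -- The bracket [E_ii(a), E_ii(b)] is [E_im(a), E_mi(b)] minus (-1)^{de} times [E_im(1),
          -- E_mi(ba)] for an auxiliary m: the entries at (m, m), both multiples of ba, cancel.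
          obtain ⟨m, hm, -⟩ := exists_third i i
          rw [if_pos rfl, if_pos rfl]
          have h1 := br_elemMat (p := p) i m m i ha hb
          have h2 := br_elemMat (p := p) i m m i (SetLike.one_mem_graded 𝒜)
            (SetLike.mul_mem_graded hb ha)
          rw [if_pos rfl, if_pos rfl] at h1 h2
          rw [one_mul, mul_one] at h2
          have h3 := sub_mem (hbr (hE hm.symm a) (hE hm b)) (units_smul_mem _
            ((-1 : ℤˣ) ^ (d * e)) (hbr (hE hm.symm 1) (hE hm (b * a))))
          rw [h1, h2] at h3
          convert h3 using 1
          have h4 : ∀ P Q d e : ZMod 2,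
              d * e + (P + Q + 0) * (Q + P + (e + d)) = (P + Q + d) * (Q + P + e) := by decide
          have h5 : (p i + p i + d) * (p i + p i + e) = d * e := by
            rw [CharTwo.add_self_eq_zero, zero_add, zero_add]
          rw [smul_sub, smul_smul, ← uzpow_add, h4, h5]
          abel
        · rw [if_neg hik, if_neg (Ne.symm hik), smul_zero, sub_zero]
          exact zero_mem _
      · rw [br_elemMat i i k l ha hb]
        refine sub_mem ?_ (units_smul_mem _ _ ?_)
        · split_ifs with h
          · subst h; exact hE hkl _
          · exact zero_mem _
        · split_ifs with h
          · subst h; exact hE hkl _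
          · exact zero_mem _
    · by_cases hkl : k = l
      · subst hkl
        rw [br_elemMat i j k k ha hb]
        refine sub_mem ?_ (units_smul_mem _ _ ?_)
        · split_ifs with h
          · subst h; exact hE hij _
          · exact zero_mem _
        · split_ifs with h
          · subst h; exact hE hij _
          · exact zero_mem _
      · exact hbr (hE hij a) (hE hkl b)
  rintro ⟨x, hx⟩
  obtain ⟨y, hy⟩ := key hx
  exact ⟨y, Subtype.ext hy⟩

theorem stToSpecLin_isCentralExtension : IsCentralExtension (stToSpecLin 𝒜 p) :=
  ⟨stToSpecLin_surjective, fun _ hx y =>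
    br_eq_zero_of_stToMat_eq_zero (congrArg Subtype.val hx) y⟩

end CanonicalHom

/-! ## The cocycle on the Steinberg Lie superalgebra -/

theorem apply₂_eq_of_span {K : Type u} [CommRing K] {L : Type v} [AddCommGroup L] [Module K L]
    {M : Type w} [AddCommGroup M] [Module K M] {β β' : L →ₗ[K] L →ₗ[K] M} {s s' : Set L}
    (h : ∀ x ∈ s, ∀ y ∈ s', β x y = β' x y) {x y : L}
    (hx : x ∈ Submodule.span K s) (hy : y ∈ Submodule.span K s') : β x y = β' x y := by
  have h' := apply₂_mem_of_span (β - β') (N := ⊥) (fun x hx y hy => by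
    rw [Submodule.mem_bot, LinearMap.sub_apply, LinearMap.sub_apply, h x hx y hy, sub_self]) hx hy
  rwa [Submodule.mem_bot, LinearMap.sub_apply, LinearMap.sub_apply, sub_eq_zero] at h'

/-! ### Representatives of the six cosets of quadruples -/

section Cosets

/-- The first index of the representative `(repI m, repJ m, repK m, repL m)` of the `m`-th coset of
quadruples. -/
def repI : Fin 6 → Fin 4 := ![0, 0, 1, 1, 0, 2]

/-- The second index of the representative of the `m`-th coset. -/
def repJ : Fin 6 → Fin 4 := ![1, 1, 0, 0, 2, 0]

/-- The third index of the representative of the `m`-th coset. -/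
def repK : Fin 6 → Fin 4 := ![2, 3, 2, 3, 1, 3]

/-- The fourth index of the representative of the `m`-th coset. -/
def repL : Fin 6 → Fin 4 := ![3, 2, 3, 2, 3, 1]

theorem rep_allDistinct (m : Fin 6) : AllDistinct (repI m) (repJ m) (repK m) (repL m) := by
  revert m; decide

theorem theta_rep (m : Fin 6) : theta (repI m) (repK m) = m := by
  revert m; decide

theorem theta_comm (i k : Fin 4) : theta i k = theta k i := by
  revert i k; decide

/-- The dichotomy behind W: either the summand is annihilated by 2, or rows and columns have
opposite parities. Each cocycle axiom for ψ is checked by the matching version of the minor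
identities. -/
theorem rep_cases (m : Fin 6) : torsion m = 2 ∧ m ≠ 4 ∧ m ≠ 5 ∨
    torsion m = 0 ∧ (m = 4 ∨ m = 5) ∧ par22 (repK m) = par22 (repI m) ∧
      par22 (repJ m) = par22 (repI m) + 1 ∧ par22 (repL m) = par22 (repI m) + 1 := by
  revert m; decide

theorem par22_rep (m : Fin 6) :
    par22 (repI m) + par22 (repJ m) + par22 (repK m) + par22 (repL m) = 0 := by
  revert m; decide

/-- A quadruple arises from its representative by exchanging rows, columns, both or neither. A minor
changes sign under a single exchange, which is what σ records on P₅ and P₆. -/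
theorem coset_cases {i j k l : Fin 4} (h : AllDistinct i j k l) :
    (i = repI (theta i k) ∧ j = repJ (theta i k) ∧ k = repK (theta i k) ∧ l = repL (theta i k) ∧
      sigma i j k l = 1) ∨
    (k = repI (theta i k) ∧ l = repJ (theta i k) ∧ i = repK (theta i k) ∧ j = repL (theta i k) ∧
      sigma i j k l = 1) ∨
    (i = repI (theta i k) ∧ l = repJ (theta i k) ∧ k = repK (theta i k) ∧ j = repL (theta i k) ∧
      (theta i k = 4 ∨ theta i k = 5 → sigma i j k l = -1)) ∨
    (k = repI (theta i k) ∧ j = repJ (theta i k) ∧ i = repK (theta i k) ∧ l = repL (theta i k) ∧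
      (theta i k = 4 ∨ theta i k = 5 → sigma i j k l = -1)) := by
  revert i j k l; decide

end Cosets

section Psi

variable {K : Type u} [CommRing K] {A : Type v} [Ring A] [Algebra K A]
  (𝒜 : ZMod 2 → Submodule K A) [GradedAlgebra 𝒜]

theorem killsComm_mkQ (n : ℕ) : KillsComm 𝒜 (commIdeal 𝒜 n).mkQ :=
  fun _ _ _ _ x y ha hb => mkQ_mul_sub_mul ha hb x y

theorem mkQ_add_self (a : A) : (commIdeal 𝒜 2).mkQ a + (commIdeal 𝒜 2).mkQ a = 0 := by
  rw [← two_nsmul]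
  exact mkQ_nsmul a

/-- The form on matrices whose components are polarized minors. -/
def psiMat : Matrix (Fin 4) (Fin 4) A →ₗ[K] Matrix (Fin 4) (Fin 4) A →ₗ[K] W 𝒜 :=
  LinearMap.mk₂ K (fun x y m => (commIdeal 𝒜 (torsion m)).mkQ
      (polar 𝒜 (repI m) (repJ m) (repK m) (repL m) x y))
    (fun _ _ _ => funext fun _ => by simp only [map_add, LinearMap.add_apply, Pi.add_apply])
    (fun _ _ _ => funext fun _ => by simp only [map_smul, LinearMap.smul_apply, Pi.smul_apply])
    (fun _ _ _ => funext fun _ => by simp only [map_add, Pi.add_apply])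
    (fun _ _ _ => funext fun _ => by simp only [map_smul, Pi.smul_apply])

/-- The cocycle `ψ`: on each summand of `W`, a polarized minor of the images in the special linear
Lie superalgebra. -/
def psi : St 𝒜 par22 →ₗ[K] St 𝒜 par22 →ₗ[K] W 𝒜 :=
  (psiMat 𝒜).compl₁₂ (stToMat 𝒜 par22) (stToMat 𝒜 par22)

theorem psi_apply (x y : St 𝒜 par22) (m : Fin 6) :
    psi 𝒜 x y m = (commIdeal 𝒜 (torsion m)).mkQ
      (polar 𝒜 (repI m) (repJ m) (repK m) (repL m) (stToMat 𝒜 par22 x) (stToMat 𝒜 par22 y)) :=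
  rfl

theorem isEvenSuperCocycle_psi : IsEvenSuperCocycle (Wpar 𝒜) (psi 𝒜) where
  even hx hy m _ := Submodule.mem_map_of_mem
    (polar_mem (par22_rep m) (stToMat_mem hx) (stToMat_mem hy))
  skew {d e x y} hx hy := by
    ext m
    rw [Pi.neg_apply, Pi.smul_apply, psi_apply, psi_apply]
    have hq := killsComm_mkQ 𝒜 (torsion m)
    rcases rep_cases m with ⟨h, -⟩ | ⟨-, -, hk, hj, hl⟩
    · refine polar_skew_of_char_two ?_ hq _
      rw [h]
      exact mkQ_add_self 𝒜
    · exact polar_skew hk hj hl hq (stToMat_mem hx) (stToMat_mem hy)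
  cyclic {d e f x y z} hx hy hz := by
    ext m
    rw [Pi.add_apply, Pi.add_apply, Pi.smul_apply, Pi.smul_apply, Pi.smul_apply, psi_apply,
      psi_apply, psi_apply, stToMat_br, stToMat_br, stToMat_br]
    have hq := killsComm_mkQ 𝒜 (torsion m)
    have sx := strZero_of_mem_derived (n := torsion m) (stToMat_mem_derived x) (stToMat_mem hx)
    have sy := strZero_of_mem_derived (n := torsion m) (stToMat_mem_derived y) (stToMat_mem hy)
    have sz := strZero_of_mem_derived (n := torsion m) (stToMat_mem_derived z) (stToMat_mem hz)
    rcases rep_cases m with ⟨h, -⟩ | ⟨-, -, hk, hj, hl⟩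
    · refine polar_cyclic_of_char_two ?_ (rep_allDistinct m) hq (stToMat_mem hx) (stToMat_mem hy)
        (stToMat_mem hz) sx sy sz _ _ _
      rw [h]
      exact mkQ_add_self 𝒜
    · exact polar_cyclic (rep_allDistinct m) hk hj hl hq (stToMat_mem hx) (stToMat_mem hy)
        (stToMat_mem hz) sx sy sz
  alt {x} hx := by
    ext m
    rw [psi_apply]
    have hq := killsComm_mkQ 𝒜 (torsion m)
    rcases rep_cases m with ⟨h, -⟩ | ⟨-, -, hk, hj, hl⟩
    · refine polar_alt_of_char_two ?_ hq
      rw [h]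
      exact mkQ_add_self 𝒜
    · exact polar_alt hk hj hl hq (stToMat_mem hx)

variable {𝒜}

theorem eps_apply (n m : Fin 6) (a : A) :
    eps 𝒜 n a m = if n = m then (commIdeal 𝒜 (torsion m)).mkQ a else 0 := by
  split_ifs with h
  · subst h
    exact Pi.single_eq_same _ _
  · exact Pi.single_eq_of_ne (Ne.symm h) _

theorem psiVal_apply (i j k l : Fin 4) (e : ZMod 2) (c : A) (m : Fin 6) :
    psiVal 𝒜 i j k l e c m = if AllDistinct i j k l ∧ theta i k = m then
      (if m = 4 ∨ m = 5 then (-1 : ℤˣ) ^ e * sigma i j k l else 1) •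
        (commIdeal 𝒜 (torsion m)).mkQ c else 0 := by
  unfold psiVal
  by_cases hd : AllDistinct i j k l
  · rw [if_pos hd]
    by_cases hm : theta i k = m
    · subst hm
      rw [if_pos (show AllDistinct i j k l ∧ theta i k = theta i k from ⟨hd, rfl⟩)]
      by_cases h : theta i k = 4 ∨ theta i k = 5
      · rw [if_pos h, if_pos h, Pi.smul_apply, eps_apply, if_pos rfl]
      · rw [if_neg h, if_neg h, one_smul, eps_apply, if_pos rfl]
    · rw [if_neg (show ¬ (AllDistinct i j k l ∧ theta i k = m) from fun h => hm h.2)]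
      by_cases h : theta i k = 4 ∨ theta i k = 5
      · rw [if_pos h, Pi.smul_apply, eps_apply, if_neg hm, smul_zero]
      · rw [if_neg h, eps_apply, if_neg hm]
  · rw [if_neg hd, if_neg (show ¬ (AllDistinct i j k l ∧ theta i k = m) from fun h => hd h.1)]
    rfl

theorem polar_eq_zero_of_left {i j k l : Fin 4} (hd : AllDistinct i j k l)
    {x : Matrix (Fin 4) (Fin 4) A} (h : ∀ ⦃i j : Fin 4⦄, i ≠ j → x i j = 0)
    (y : Matrix (Fin 4) (Fin 4) A) : polar 𝒜 i j k l x y = 0 := by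
  obtain ⟨h1, h2, h3, h4, h5, h6⟩ := hd
  rw [polar_apply, h h1, h h3, h h6, h h4.symm]
  simp

theorem polar_eq_zero_of_right {i j k l : Fin 4} (hd : AllDistinct i j k l)
    {y : Matrix (Fin 4) (Fin 4) A} (h : ∀ ⦃i j : Fin 4⦄, i ≠ j → y i j = 0)
    (x : Matrix (Fin 4) (Fin 4) A) : polar 𝒜 i j k l x y = 0 := by
  obtain ⟨h1, h2, h3, h4, h5, h6⟩ := hd
  rw [polar_apply, h h1, h h3, h h6, h h4.symm]
  simp

theorem polar_single {i j k l i' j' k' l' : Fin 4} (hd : AllDistinct i j k l) (a b : A) :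
    polar 𝒜 i j k l (Matrix.single i' j' a) (Matrix.single k' l' b) =
      (if (i' = i ∧ j' = j ∧ k' = k ∧ l' = l) ∨ (k' = i ∧ l' = j ∧ i' = k ∧ j' = l) then
        a * parityInv 𝒜 b
      else if (i' = i ∧ l' = j ∧ k' = k ∧ j' = l) ∨ (k' = i ∧ j' = j ∧ i' = k ∧ l' = l) then
        -(a * parityInv 𝒜 b) else 0) := by
  have h : ∀ P Q : Prop, ∀ [Decidable P] [Decidable Q],
      (if P then a else 0) * parityInv 𝒜 (if Q then b else 0)
        = if P ∧ Q then a * parityInv 𝒜 b else 0 := by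
    intro P Q _ _
    by_cases hP : P <;> by_cases hQ : Q <;> simp [hP, hQ]
  simp only [polar_apply, Matrix.single_apply, h]
  obtain ⟨h1, h2, h3, h4, h5, h6⟩ := hd
  clear h
  split_ifs <;> first | (simp; done) | (exfalso; grind)

theorem psi_stF_stF {i j k l : Fin 4} (hij : i ≠ j) (hkl : k ≠ l) {d e : ZMod 2} (a : 𝒜 d)
    (b : 𝒜 e) : psi 𝒜 (stF 𝒜 par22 hij a) (stF 𝒜 par22 hkl b)
      = psiVal 𝒜 i j k l e ((a : A) * b) := by
  ext m
  rw [psi_apply, stToMat_apply, stToMat_apply, stToSpecLin_stF, stToSpecLin_stF]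
  refine (congrArg _ (polar_single (rep_allDistinct m) (a : A) (b : A))).trans ?_
  rw [parityInv_of_mem b.2, mul_smul_comm, psiVal_apply]
  obtain ⟨h1, h2, h3, h4, h5, h6⟩ := rep_allDistinct m
  by_cases h : AllDistinct i j k l ∧ theta i k = m
  · rw [if_pos h]
    obtain ⟨hd, rfl⟩ := h
    have hc := coset_cases hd
    set m := theta i k
    -- On the four summands annihilated by 2 signs are immaterial, so only P₅ and P₆ require a
    -- comparison of signs.
    have hs : ∀ s s' : ℤˣ, (m = 4 ∨ m = 5 → s = s') →
        s • (commIdeal 𝒜 (torsion m)).mkQ ((a : A) * b)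
          = s' • (commIdeal 𝒜 (torsion m)).mkQ ((a : A) * b) := by
      intro s s' hs
      rcases rep_cases m with ⟨h, -⟩ | ⟨-, h, -⟩
      · rw [units_smul_eq_of_char_two, units_smul_eq_of_char_two] <;>
        · rw [h]
          exact mkQ_add_self 𝒜
      · rw [hs h]
    rcases hc with ⟨e1, e2, e3, e4, hσ⟩ | ⟨e1, e2, e3, e4, hσ⟩ | ⟨e1, e2, e3, e4, hσ⟩ |
      ⟨e1, e2, e3, e4, hσ⟩
    · rw [if_pos (.inl ⟨e1, e2, e3, e4⟩), map_units_smul]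
      apply hs
      intro h
      rw [if_pos h, hσ, mul_one]
    · rw [if_pos (.inr ⟨e1, e2, e3, e4⟩), map_units_smul]
      apply hs
      intro h
      rw [if_pos h, hσ, mul_one]
    · rw [if_neg, if_pos (.inl ⟨e1, e2, e3, e4⟩), ← Units.neg_smul, map_units_smul]
      · apply hs
        intro h
        rw [if_pos h, hσ h, mul_neg_one]
      · rintro (h | h)
        · exact h5 (h.2.1.symm.trans e4)
        · exact h2 (h.1.symm.trans e3)
    · rw [if_neg, if_pos (.inr ⟨e1, e2, e3, e4⟩), ← Units.neg_smul, map_units_smul]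
      · apply hs
        intro h
        rw [if_pos h, hσ h, mul_neg_one]
      · rintro (h | h)
        · exact h2 (h.1.symm.trans e3)
        · exact h5 (h.2.1.symm.trans e4)
  · rw [if_neg h, if_neg, if_neg, map_zero]
    · rintro (⟨rfl, rfl, rfl, rfl⟩ | ⟨rfl, rfl, rfl, rfl⟩)
      · exact h ⟨⟨h3, h2, h1, h6.symm, h5.symm, h4.symm⟩, theta_rep m⟩
      · exact h ⟨⟨h4.symm, h2.symm, h6, h1.symm, h5, h3⟩, (theta_comm _ _).trans (theta_rep m)⟩
    · rintro (⟨rfl, rfl, rfl, rfl⟩ | ⟨rfl, rfl, rfl, rfl⟩)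
      · exact h ⟨⟨h1, h2, h3, h4, h5, h6⟩, theta_rep m⟩
      · exact h ⟨⟨h6, h2.symm, h4.symm, h3.symm, h5.symm, h1⟩,
          (theta_comm _ _).trans (theta_rep m)⟩

variable (𝒜) in
theorem hasPsiValues_psi : HasPsiValues 𝒜 (psi 𝒜) := by
  refine ⟨fun i j k l hij hkl d e a b => psi_stF_stF hij hkl a b, fun x y h => ?_⟩
  ext m
  rw [psi_apply]
  rcases h with h | h
  · exact (congrArg _ (polar_eq_zero_of_left (rep_allDistinct m)
      (fun _ _ hij => matEntry_stH h hij) _)).trans (map_zero _)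
  · exact (congrArg _ (polar_eq_zero_of_right (rep_allDistinct m)
      (fun _ _ hij => matEntry_stH h hij) _)).trans (map_zero _)

/-- ℋ and the root elements span, so the prescribed values leave no freedom. -/
theorem HasPsiValues.eq {ψ ψ' : St 𝒜 par22 →ₗ[K] St 𝒜 par22 →ₗ[K] W 𝒜}
    (h : HasPsiValues 𝒜 ψ) (h' : HasPsiValues 𝒜 ψ') : ψ = ψ' := by
  refine LinearMap.ext fun x => LinearMap.ext fun y => ?_
  refine apply₂_eq_of_span ?_ (span_hGen_union x) (span_hGen_union y)
  have hH : ∀ z ∈ hGen 𝒜 par22, z ∈ stH 𝒜 par22 := fun z hz => by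
    rw [stH_eq_span]
    exact Submodule.subset_span hz
  rintro x hx y hy
  rcases hx with hx | ⟨i, j, d, a, ha, rfl⟩
  · rw [h.2 _ _ (.inl (hH _ hx)), h'.2 _ _ (.inl (hH _ hx))]
  rcases hy with hy | ⟨k, l, e, b, hb, rfl⟩
  · rw [h.2 _ _ (.inr (hH _ hy)), h'.2 _ _ (.inr (hH _ hy))]
  by_cases hij : i = j
  · subst hij; rw [stLin_self]; simp
  by_cases hkl : k = l
  · subst hkl; rw [stLin_self]; simp
  rw [stLin_eq 𝒜 hij ha, stLin_eq 𝒜 hkl hb, h.1, h'.1]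

end Psi

/-! ## The central extension of `𝔰𝔱(2, 2, A)` by `W` -/

section WGrading

variable {K : Type u} [CommRing K] {A : Type v} [Ring A] [Algebra K A]
  (𝒜 : ZMod 2 → Submodule K A) [GradedAlgebra 𝒜]

/-- The ideal is generated by homogeneous elements: expanding the outer factors, and `a` in the
generators n • a, leaves homogeneous generators. This is what makes the induced grading of W a
direct decomposition. -/
theorem proj_mem_commIdeal {n : ℕ} (d : ZMod 2) {a : A} (ha : a ∈ commIdeal 𝒜 n) :
    GradedAlgebra.proj 𝒜 d a ∈ commIdeal 𝒜 n := by
  have hom : ∀ {e : ZMod 2} {a : A}, a ∈ 𝒜 e → a ∈ commIdeal 𝒜 n →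
      GradedAlgebra.proj 𝒜 d a ∈ commIdeal 𝒜 n := by
    intro e a he ha
    rw [proj_of_mem he]
    split_ifs
    · exact ha
    · exact zero_mem _
  induction ha using Submodule.span_induction with
  | zero => simp
  | add a b _ _ h h' => rw [map_add]; exact add_mem h h'
  | smul c a _ h => rw [map_smul]; exact Submodule.smul_mem _ _ h
  | mem a ha =>
    obtain ⟨x, y, g, hg, rfl⟩ := ha
    have hmem : ∀ x y g : A, ((∃ a : A, g = n • a) ∨ ∃ (d e : ZMod 2) (a b : A), a ∈ 𝒜 d ∧
        b ∈ 𝒜 e ∧ g = a * b - (-1 : ℤˣ) ^ (d * e) • (b * a)) → x * g * y ∈ commIdeal 𝒜 n :=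
      fun x y g h => Submodule.subset_span ⟨x, y, g, h, rfl⟩
    induction x using graded_induction (𝒜 := 𝒜) with
    | hadd h h' => rw [add_mul, add_mul, map_add]; exact add_mem h h'
    | h hx =>
      induction y using graded_induction (𝒜 := 𝒜) with
      | hadd h h' => rw [mul_add, map_add]; exact add_mem h h'
      | h hy =>
        rcases hg with ⟨a, rfl⟩ | ⟨e, f, a, b, ha, hb, rfl⟩
        · induction a using graded_induction (𝒜 := 𝒜) with
          | hadd h h' => rw [nsmul_add, mul_add, add_mul, map_add]; exact add_mem h h'
          | h ha =>
            exact hom (SetLike.mul_mem_graded (SetLike.mul_mem_graded hx (nsmul_mem ha n)) hy)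
              (hmem _ _ _ (.inl ⟨_, rfl⟩))
        · exact hom (SetLike.mul_mem_graded (SetLike.mul_mem_graded hx
            (sub_mem (SetLike.mul_mem_graded ha hb) (units_smul_mem _ _
              (add_comm f e ▸ SetLike.mul_mem_graded hb ha)))) hy)
            (hmem _ _ _ (.inr ⟨_, _, _, _, ha, hb, rfl⟩))

/-- The projection of `W` to its part of parity `d`. -/
def wProj (d : ZMod 2) : W 𝒜 →ₗ[K] Wpar 𝒜 d :=
  LinearMap.codRestrict (Wpar 𝒜 d) (LinearMap.pi fun m =>
    (commIdeal 𝒜 (torsion m)).mapQ (commIdeal 𝒜 (torsion m)) (GradedAlgebra.proj 𝒜 d)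
      (fun _ ha => proj_mem_commIdeal 𝒜 d ha) ∘ₗ LinearMap.proj m) (by
    intro w m _
    obtain ⟨a, ha⟩ := (commIdeal 𝒜 (torsion m)).mkQ_surjective (w m)
    refine ⟨GradedAlgebra.proj 𝒜 d a, ?_, ?_⟩
    · rw [GradedAlgebra.proj_apply]
      exact SetLike.coe_mem _
    · simp only [LinearMap.pi_apply, LinearMap.comp_apply, LinearMap.proj_apply]
      rw [← ha]
      rfl)

variable {𝒜}

theorem wProj_apply (d : ZMod 2) (w : W 𝒜) (m : Fin 6) :
    (wProj 𝒜 d w : W 𝒜) m = (commIdeal 𝒜 (torsion m)).mapQ (commIdeal 𝒜 (torsion m)) (GradedAlgebra.proj 𝒜 d)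
      (fun _ ha => proj_mem_commIdeal 𝒜 d ha) (w m) := rfl

theorem wProj_add (w : W 𝒜) : (wProj 𝒜 0 w : W 𝒜) + (wProj 𝒜 1 w : W 𝒜) = w := by
  ext m
  rw [Pi.add_apply, wProj_apply, wProj_apply]
  obtain ⟨a, ha⟩ := (commIdeal 𝒜 (torsion m)).mkQ_surjective (w m)
  rw [← ha, Submodule.mkQ_apply, Submodule.mapQ_apply, Submodule.mapQ_apply,
    ← Submodule.Quotient.mk_add, proj_zero_add]

theorem wProj_of_mem {d : ZMod 2} {w : W 𝒜} (hw : w ∈ Wpar 𝒜 d) (e : ZMod 2) :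
    (wProj 𝒜 e w : W 𝒜) = if d = e then w else 0 := by
  ext m
  obtain ⟨a, ha, haw⟩ := hw m (Set.mem_univ _)
  rw [wProj_apply, ← haw, Submodule.mkQ_apply, Submodule.mapQ_apply, proj_of_mem ha]
  split_ifs
  · exact haw
  · exact Submodule.Quotient.mk_zero _

theorem wpar_eq_zero {d e : ZMod 2} (hde : d ≠ e) {w : W 𝒜} (hd : w ∈ Wpar 𝒜 d)
    (he : w ∈ Wpar 𝒜 e) : w = 0 := by
  have h := wProj_of_mem hd e
  rwa [wProj_of_mem he, if_pos rfl, if_neg hde] at h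

end WGrading

/-! ### Centralizers of homogeneous elements -/

section Centre

variable {K : Type u} [CommRing K] {L : Type v} [AddCommGroup L] [Module K L]
  [LieSuperalgebra K L]

/-- The centralizer of a homogeneous element is a subalgebra. It is graded, because the brackets of
`x` with the two components of `y` have different parities and must vanish separately; so the
derivation rule applies to each component. -/
theorem br_br_eq_zero {d : ZMod 2} {x y z : L} (hx : x ∈ par K d) (hy : br K x y = 0)
    (hz : br K x z = 0) : br K x (br K y z) = 0 := by
  obtain ⟨y0, h0, y1, h1, rfl⟩ := exists_add (K := K) y
  have h01 : br K x y0 = 0 ∧ br K x y1 = 0 := by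
    rw [map_add] at hy
    have h0' := br_mem hx h0
    have h1' := br_mem hx h1
    rcases zmod_two_cases d with rfl | rfl
    · exact par_eq_zero (by simpa using h0') (by simpa using h1') hy
    · exact (par_eq_zero h1' (by simpa using h0') (by rwa [add_comm])).symm
  rw [map_add, LinearMap.add_apply, map_add, leibniz hx h0, leibniz hx h1, h01.1, h01.2, hz]
  simp

theorem br_comm_eq_zero {d : ZMod 2} {x y : L} (hx : x ∈ par K d) (h : ∀ y, br K x y = 0) :
    br K y x = 0 := by
  obtain ⟨y0, h0, y1, h1, rfl⟩ := exists_add (K := K) y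
  rw [map_add, LinearMap.add_apply, LieSuperalgebra.skew h0 hx, LieSuperalgebra.skew h1 hx, h, h]
  simp

end Centre

section Sharp

variable {K : Type u} [CommRing K] {A : Type v} [Ring A] [Algebra K A]
  (𝒜 : ZMod 2 → Submodule K A) [GradedAlgebra 𝒜]

variable {𝒜} in
theorem sharp_mk_eq_zero {r : FreeNonUnitalNonAssocAlgebra K (SharpGen 𝒜)} (h : SharpRel 𝒜 r) :
    ((relIdeal K (SharpGen.par 𝒜) {r | SharpRel 𝒜 r}).mkQ r : Sharp 𝒜) = 0 :=
  (Submodule.Quotient.mk_eq_zero _).2 (Submodule.subset_span (.rel h))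

theorem sharpF_add {i j : Fin 4} (h : i ≠ j) {d : ZMod 2} (a b : 𝒜 d) :
    sharpF 𝒜 h (a + b) = sharpF 𝒜 h a + sharpF 𝒜 h b := by
  rw [← sub_eq_zero, ← sub_sub]
  exact sharp_mk_eq_zero (.addF h a b)

theorem sharpF_smul {i j : Fin 4} (h : i ≠ j) {d : ZMod 2} (c : K) (a : 𝒜 d) :
    sharpF 𝒜 h (c • a) = c • sharpF 𝒜 h a := by
  rw [← sub_eq_zero]
  exact sharp_mk_eq_zero (.smulF h c a)

theorem sharpW_add {d : ZMod 2} (w w' : Wpar 𝒜 d) :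
    sharpW 𝒜 (w + w') = sharpW 𝒜 w + sharpW 𝒜 w' := by
  rw [← sub_eq_zero, ← sub_sub]
  exact sharp_mk_eq_zero (.addW w w')

theorem sharpW_smul {d : ZMod 2} (c : K) (w : Wpar 𝒜 d) :
    sharpW 𝒜 (c • w) = c • sharpW 𝒜 w := by
  rw [← sub_eq_zero]
  exact sharp_mk_eq_zero (.smulW c w)

theorem br_sharpW_sharpW {d e : ZMod 2} (w : Wpar 𝒜 d) (w' : Wpar 𝒜 e) :
    br K (sharpW 𝒜 w) (sharpW 𝒜 w') = 0 :=
  sharp_mk_eq_zero (.centralW w w')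

theorem br_sharpF_sharpW {i j : Fin 4} (h : i ≠ j) {d e : ZMod 2} (a : 𝒜 d) (w : Wpar 𝒜 e) :
    br K (sharpF 𝒜 h a) (sharpW 𝒜 w) = 0 :=
  sharp_mk_eq_zero (.centralF h a w)

theorem br_sharpF_sharpF {i j k : Fin 4} (hij : i ≠ j) (hjk : j ≠ k) (hik : i ≠ k) {d e : ZMod 2}
    (a : 𝒜 d) (b : 𝒜 e) : br K (sharpF 𝒜 hij a) (sharpF 𝒜 hjk b)
      = sharpF 𝒜 hik (⟨a * b, SetLike.mul_mem_graded a.2 b.2⟩ : 𝒜 (d + e)) := by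
  rw [← sub_eq_zero]
  exact sharp_mk_eq_zero (.mul hij hjk hik a b)

theorem br_sharpF_sharpF_eq_zero {i j k l : Fin 4} (hij : i ≠ j) (hkl : k ≠ l) (hjk : j ≠ k)
    (hil : i ≠ l) (h : i = k ∨ j = l) {d e : ZMod 2} (a : 𝒜 d) (b : 𝒜 e) :
    br K (sharpF 𝒜 hij a) (sharpF 𝒜 hkl b) = 0 :=
  sharp_mk_eq_zero (.zero hij hkl hjk hil h a b)

theorem br_sharpF_sharpF_eq_psiVal {i j k l : Fin 4} (hij : i ≠ j) (hkl : k ≠ l)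
    (h : AllDistinct i j k l) {d e : ZMod 2} (a : 𝒜 d) (b : 𝒜 e) :
    br K (sharpF 𝒜 hij a) (sharpF 𝒜 hkl b)
      = sharpW 𝒜 (⟨psiVal 𝒜 i j k l e ((a : A) * b),
          psiVal_mem i j k l e (SetLike.mul_mem_graded a.2 b.2)⟩ : Wpar 𝒜 (d + e)) := by
  rw [← sub_eq_zero]
  exact sharp_mk_eq_zero (.psi hij hkl h a b)

theorem sharpF_mem {i j : Fin 4} (h : i ≠ j) {d : ZMod 2} (a : 𝒜 d) :
    sharpF 𝒜 h a ∈ par K (par22 i + par22 j + d) :=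
  ⟨_, freeSharpF_mem 𝒜 h a, rfl⟩

theorem sharpW_mem {d : ZMod 2} (w : Wpar 𝒜 d) : sharpW 𝒜 w ∈ par K d :=
  ⟨_, freeSharpW_mem 𝒜 w, rfl⟩

variable {𝒜} in
/-- Elements of `𝔰𝔱(2, 2, A)^♯` lie in every submodule that contains the generators and is closed
under brackets. -/
theorem sharp_mem {S : Submodule K (Sharp 𝒜)}
    (hF : ∀ (i j : Fin 4) (h : i ≠ j) (d : ZMod 2) (a : 𝒜 d), sharpF 𝒜 h a ∈ S)
    (hW : ∀ (d : ZMod 2) (w : Wpar 𝒜 d), sharpW 𝒜 w ∈ S)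
    (hbr : ∀ x ∈ S, ∀ y ∈ S, br K x y ∈ S) (x : Sharp 𝒜) : x ∈ S :=
  presented_mem (p := SharpGen.par 𝒜) (R := {r | SharpRel 𝒜 r}) S
    (fun g => match g with
      | .F ⟨i, j, h, d, a⟩ => hF i j h d a
      | .W d w => hW d w) hbr x

/-- The inclusion of `W`. -/
def sharpIncl : W 𝒜 →ₗ[K] Sharp 𝒜 :=
  ({ toFun := fun w => sharpW 𝒜 w
     map_add' := sharpW_add 𝒜
     map_smul' := sharpW_smul 𝒜 } : Wpar 𝒜 0 →ₗ[K] Sharp 𝒜) ∘ₗ wProj 𝒜 0 +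
  ({ toFun := fun w => sharpW 𝒜 w
     map_add' := sharpW_add 𝒜
     map_smul' := sharpW_smul 𝒜 } : Wpar 𝒜 1 →ₗ[K] Sharp 𝒜) ∘ₗ wProj 𝒜 1

theorem sharpIncl_apply (w : W 𝒜) :
    sharpIncl 𝒜 w = sharpW 𝒜 (wProj 𝒜 0 w) + sharpW 𝒜 (wProj 𝒜 1 w) := rfl

theorem sharpW_zero (d : ZMod 2) : sharpW 𝒜 (0 : Wpar 𝒜 d) = 0 := by
  simpa using sharpW_smul 𝒜 0 (0 : Wpar 𝒜 d)

theorem sharpIncl_coe {d : ZMod 2} (w : Wpar 𝒜 d) : sharpIncl 𝒜 w = sharpW 𝒜 w := by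
  have h : ∀ e, wProj 𝒜 e w = if h : d = e then h ▸ w else 0 := by
    intro e
    apply Subtype.ext
    rw [wProj_of_mem w.2]
    split_ifs with h
    · subst h; rfl
    · rfl
  -- Of the two projections of a homogeneous element, one is the element itself and the other is 0.
  rw [sharpIncl_apply, h, h]
  rcases zmod_two_cases d with rfl | rfl <;> simp [sharpW_zero]

variable {𝒜} in
-- The relations say that w commutes with all generators, and the centralizer of w is a subalgebra.
theorem br_sharpW_left {d : ZMod 2} (w : Wpar 𝒜 d) (x : Sharp 𝒜) : br K (sharpW 𝒜 w) x = 0 := by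
  refine sharp_mem (S := LinearMap.ker (br K (sharpW 𝒜 w))) ?_ ?_ ?_ x
  · intro i j h e a
    rw [LinearMap.mem_ker, LieSuperalgebra.skew (sharpW_mem 𝒜 w) (sharpF_mem 𝒜 h a),
      br_sharpF_sharpW, smul_zero, neg_zero]
  · intro e w'
    exact br_sharpW_sharpW 𝒜 w w'
  · intro x hx y hy
    exact br_br_eq_zero (sharpW_mem 𝒜 w) hx hy

theorem br_sharpIncl_left (w : W 𝒜) (x : Sharp 𝒜) : br K (sharpIncl 𝒜 w) x = 0 := by
  rw [sharpIncl_apply, map_add, LinearMap.add_apply, br_sharpW_left, br_sharpW_left, add_zero]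

theorem br_sharpIncl_right (w : W 𝒜) (x : Sharp 𝒜) : br K x (sharpIncl 𝒜 w) = 0 := by
  rw [sharpIncl_apply, map_add, br_comm_eq_zero (sharpW_mem 𝒜 _) (br_sharpW_left _),
    br_comm_eq_zero (sharpW_mem 𝒜 _) (br_sharpW_left _), add_zero]

/-! ### Maps out of `𝔰𝔱(2, 2, A)^♯` -/

variable {𝒜} in
/-- A cocycle on `𝔰𝔱(2, 2, A)` that satisfies the relations of `𝔰𝔱(2, 2, A)^♯` defines a linear map
on `𝔰𝔱(2, 2, A)^♯`. -/
theorem exists_sharpLift {M : Type w} [AddCommGroup M] [Module K M] {Mpar : ZMod 2 → Submodule K M}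
    {β : St 𝒜 par22 →ₗ[K] St 𝒜 par22 →ₗ[K] M} (hβ : IsEvenSuperCocycle Mpar β)
    (G : Fin 4 → Fin 4 → A →ₗ[K] M) (η : W 𝒜 →ₗ[K] M)
    (hG : ∀ {i j d a}, i ≠ j → a ∈ 𝒜 d → G i j a ∈ Mpar (par22 i + par22 j + d))
    (hη : ∀ {d w}, w ∈ Wpar 𝒜 d → η w ∈ Mpar d)
    (hmul : ∀ {i j k d e} (hij : i ≠ j) (hjk : j ≠ k) (_ : i ≠ k) (a : 𝒜 d) (b : 𝒜 e),
      β (stF 𝒜 par22 hij a) (stF 𝒜 par22 hjk b) = G i k ((a : A) * b))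
    (hzero : ∀ {i j k l d e} (hij : i ≠ j) (hkl : k ≠ l), j ≠ k → i ≠ l → i = k ∨ j = l →
      ∀ (a : 𝒜 d) (b : 𝒜 e), β (stF 𝒜 par22 hij a) (stF 𝒜 par22 hkl b) = 0)
    (hpsi : ∀ {i j k l d e} (hij : i ≠ j) (hkl : k ≠ l), AllDistinct i j k l →
      ∀ (a : 𝒜 d) (b : 𝒜 e), β (stF 𝒜 par22 hij a) (stF 𝒜 par22 hkl b)
        = η (psiVal 𝒜 i j k l e ((a : A) * b))) :
    ∃ (π : Hom K (Sharp 𝒜) (St 𝒜 par22)) (ρ : Sharp 𝒜 →ₗ[K] M),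
      (∀ {i j d} (h : i ≠ j) (a : 𝒜 d), π (sharpF 𝒜 h a) = stF 𝒜 par22 h a) ∧
      (∀ {d} (w : Wpar 𝒜 d), π (sharpW 𝒜 w) = 0) ∧
      (∀ {i j d} (h : i ≠ j) (a : 𝒜 d), ρ (sharpF 𝒜 h a) = G i j a) ∧
      (∀ w, ρ (sharpIncl 𝒜 w) = η w) ∧
      (∀ x y, ρ (br K x y) = β (π x) (π y)) ∧
      ∀ {d} {x : Sharp 𝒜}, x ∈ par K d → ρ x ∈ Mpar d := by
  -- The product ((m, x), (n, y)) ↦ (β(x, y), [x, y]) of the extension of `St` by M. The submodules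
  -- `Mpar` need not decompose M, so this is not a Lie superalgebra in the strict sense, but it
  -- satisfies the identities required of a target of the presentation.
  let μ : M × St 𝒜 par22 →ₗ[K] M × St 𝒜 par22 →ₗ[K] M × St 𝒜 par22 :=
    (β.compr₂ (LinearMap.inl K M (St 𝒜 par22)) + (br K).compr₂ (LinearMap.inr K M (St 𝒜 par22))).compl₁₂
      (LinearMap.snd K M (St 𝒜 par22)) (LinearMap.snd K M (St 𝒜 par22))
  have hμ : ∀ x y, μ x y = (β x.2 y.2, br K x.2 y.2) := by
    intro x y
    change (β x.2 y.2, (0 : St 𝒜 par22)) + ((0 : M), br K x.2 y.2) = _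
    rw [Prod.mk_add_mk, add_zero, zero_add]
  let f : SharpGen 𝒜 → M × St 𝒜 par22
    | .F x => (G x.i x.j x.a, stF 𝒜 par22 x.ne x.a)
    | .W _ w => (η w, 0)
  let P : ZMod 2 → Submodule K (M × St 𝒜 par22) := fun d => (Mpar d).prod (par K d)
  have hf : ∀ x, f x ∈ P (SharpGen.par 𝒜 x) := by
    rintro (⟨i, j, h, d, a⟩ | ⟨d, w⟩)
    · exact ⟨hG h a.2, stF_mem 𝒜 par22 h a⟩
    · exact ⟨hη w.2, zero_mem _⟩
  have hP : ∀ {d e x y}, x ∈ P d → y ∈ P e → μ x y ∈ P (d + e) := by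
    rintro d e x y ⟨-, hx⟩ ⟨-, hy⟩
    rw [hμ]
    exact ⟨hβ.even hx hy, br_mem hx hy⟩
  have hrel : ∀ r ∈ relIdeal K (SharpGen.par 𝒜) {r | SharpRel 𝒜 r},
      freeLift μ f r = 0 := by
    intro r hr
    refine (Submodule.mem_bot K).1 (freeLift_mem_of_mem_relIdeal hf hP ?_ ?_ ?_ ?_ ?_ hr)
    · intro x n hn
      rw [(Submodule.mem_bot K).1 hn]
      simp
    · rintro d e x y ⟨-, hx⟩ ⟨-, hy⟩
      rw [Submodule.mem_bot, hμ, hμ, hβ.skew hx hy, LieSuperalgebra.skew hx hy, Prod.smul_mk,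
        Prod.mk_add_mk, neg_add_cancel, neg_add_cancel]
      rfl
    · rintro d e f x y z ⟨-, hx⟩ ⟨-, hy⟩ ⟨-, hz⟩
      rw [Submodule.mem_bot, hμ, hμ, hμ, hμ, hμ, hμ, Prod.smul_mk, Prod.smul_mk, Prod.smul_mk,
        Prod.mk_add_mk, Prod.mk_add_mk]
      exact Prod.ext (hβ.cyclic hx hy hz) (LieSuperalgebra.jacobi hx hy hz)
    · rintro x ⟨-, hx⟩
      rw [Submodule.mem_bot, hμ, hβ.alt hx, LieSuperalgebra.alt hx]
      rfl
    · intro r hr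
      rw [Submodule.mem_bot]
      have hF : ∀ {i j d} (h : i ≠ j) (a : 𝒜 d),
          freeLift μ f (freeSharpF 𝒜 h a) = (G i j a, stF 𝒜 par22 h a) :=
        fun _ _ => freeLift_of μ f _
      have hW : ∀ {d} (w : Wpar 𝒜 d), freeLift μ f (freeSharpW 𝒜 w) = (η w, 0) :=
        fun _ => freeLift_of μ f _
      cases hr with
      | addF h a b =>
        rw [map_sub, map_sub, hF, hF, hF, stF_add, Submodule.coe_add, map_add]
        simp
      | smulF h c a =>
        rw [map_sub, map_smul, hF, hF, stF_smul, Submodule.coe_smul, map_smul]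
        simp
      | addW w w' =>
        rw [map_sub, map_sub, hW, hW, hW, Submodule.coe_add, map_add]
        simp
      | smulW c w =>
        rw [map_sub, map_smul, hW, hW, Submodule.coe_smul, map_smul]
        simp
      | centralW w w' =>
        rw [freeLift_mul, hW, hW, hμ]
        simp
      | centralF h a w =>
        rw [freeLift_mul, hF, hW, hμ]
        simp
      | mul hij hjk hik a b =>
        rw [map_sub, freeLift_mul, hF, hF, hF, hμ, hmul hij hjk hik, br_stF_stF 𝒜 _ hij hjk hik,
          sub_self]
      | zero hij hkl hjk hil h a b =>
        rw [freeLift_mul, hF, hF, hμ, hzero hij hkl hjk hil h,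
          br_stF_stF_eq_zero 𝒜 _ hij hkl hjk hil]
        rfl
      | psi hij hkl h a b =>
        rw [map_sub, freeLift_mul, hF, hF, hW, hμ, hpsi hij hkl h,
          br_stF_stF_eq_zero 𝒜 _ hij hkl h.2.2.2.1 h.2.2.1, sub_self]
  let Φ : Sharp 𝒜 →ₗ[K] M × St 𝒜 par22 := (relIdeal K (SharpGen.par 𝒜) {r | SharpRel 𝒜 r}).liftQ
    (freeLift μ f) hrel
  have hΦF : ∀ {i j d} (h : i ≠ j) (a : 𝒜 d), Φ (sharpF 𝒜 h a) = (G i j a, stF 𝒜 par22 h a) :=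
    fun _ _ => freeLift_of μ f _
  have hΦW : ∀ {d} (w : Wpar 𝒜 d), Φ (sharpW 𝒜 w) = (η w, 0) :=
    fun _ => freeLift_of μ f _
  have hΦbr : ∀ x y : Sharp 𝒜, Φ (br K x y) = (β (Φ x).2 (Φ y).2, br K (Φ x).2 (Φ y).2) := by
    intro x y
    obtain ⟨x, rfl⟩ := (relIdeal K (SharpGen.par 𝒜) {r | SharpRel 𝒜 r}).mkQ_surjective x
    obtain ⟨y, rfl⟩ := (relIdeal K (SharpGen.par 𝒜) {r | SharpRel 𝒜 r}).mkQ_surjective y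
    exact (freeLift_mul μ f x y).trans (hμ _ _)
  have hΦpar : ∀ {d} {x : Sharp 𝒜}, x ∈ par K d → Φ x ∈ P d := by
    rintro d _ ⟨x, hx, rfl⟩
    exact freeLift_mem hf hP hx
  refine ⟨⟨LinearMap.snd K _ _ ∘ₗ Φ, fun d x hx => (hΦpar hx).2,
    fun x y => congrArg Prod.snd (hΦbr x y)⟩, LinearMap.fst K _ _ ∘ₗ Φ,
    fun h a => congrArg Prod.snd (hΦF h a), fun w => congrArg Prod.snd (hΦW w),
    fun h a => congrArg Prod.fst (hΦF h a), fun w => ?_,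
    fun x y => congrArg Prod.fst (hΦbr x y), fun hx => (hΦpar hx).1⟩
  rw [sharpIncl_apply, map_add]
  refine (congrArg₂ (· + ·) (congrArg Prod.fst (hΦW (wProj 𝒜 0 w)))
    (congrArg Prod.fst (hΦW (wProj 𝒜 1 w)))).trans ?_
  change η _ + η _ = η w
  rw [← map_add, wProj_add]

end Sharp

/-! ### The splitting as 𝔰𝔱(2, 2, A) ⊕ W, and perfectness -/

section SharpStructure

variable {K : Type u} [CommRing K] {A : Type v} [Ring A] [Algebra K A]
  (𝒜 : ZMod 2 → Submodule K A) [GradedAlgebra 𝒜]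

theorem psiVal_eq_zero {i j k l : Fin 4} (h : ¬ AllDistinct i j k l) (e : ZMod 2) (c : A) :
    psiVal 𝒜 i j k l e c = 0 := if_neg h

/-- Here the root elements get component 0 in W and W is mapped identically; the values of ψ are
exactly those that the relations demand. -/
theorem exists_sharpLift_psi :
    ∃ (π : Hom K (Sharp 𝒜) (St 𝒜 par22)) (ρ : Sharp 𝒜 →ₗ[K] W 𝒜),
      (∀ {i j d} (h : i ≠ j) (a : 𝒜 d), π (sharpF 𝒜 h a) = stF 𝒜 par22 h a) ∧
      (∀ {d} (w : Wpar 𝒜 d), π (sharpW 𝒜 w) = 0) ∧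
      (∀ {i j d} (h : i ≠ j) (a : 𝒜 d), ρ (sharpF 𝒜 h a) = 0) ∧
      (∀ w, ρ (sharpIncl 𝒜 w) = w) ∧
      (∀ x y, ρ (br K x y) = psi 𝒜 (π x) (π y)) ∧
      ∀ {d} {x : Sharp 𝒜}, x ∈ par K d → ρ x ∈ Wpar 𝒜 d := by
  refine exists_sharpLift (isEvenSuperCocycle_psi 𝒜) 0 LinearMap.id (fun _ _ => zero_mem _)
    (fun h => h) ?_ ?_ ?_
  · intro i j k d e hij hjk hik a b
    rw [psi_stF_stF, psiVal_eq_zero 𝒜 fun h => h.2.2.2.1 rfl]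
    rfl
  · intro i j k l d e hij hkl hjk hil h a b
    rw [psi_stF_stF, psiVal_eq_zero 𝒜 fun h' => h.elim h'.2.1 h'.2.2.2.2.1]
  · intro i j k l d e hij hkl h a b
    exact psi_stF_stF hij hkl a b

/-- The canonical projection of `𝔰𝔱(2, 2, A)^♯` onto `𝔰𝔱(2, 2, A)`. -/
def sharpToSt : Hom K (Sharp 𝒜) (St 𝒜 par22) := (exists_sharpLift_psi 𝒜).choose

/-- The projection of `𝔰𝔱(2, 2, A)^♯` onto `W` which vanishes on the generators `F^♯_{ij}(a)`. -/
def sharpToW : Sharp 𝒜 →ₗ[K] W 𝒜 := (exists_sharpLift_psi 𝒜).choose_spec.choose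

variable {𝒜}

theorem sharpToSt_sharpF {i j : Fin 4} (h : i ≠ j) {d : ZMod 2} (a : 𝒜 d) :
    sharpToSt 𝒜 (sharpF 𝒜 h a) = stF 𝒜 par22 h a :=
  (exists_sharpLift_psi 𝒜).choose_spec.choose_spec.1 h a

theorem sharpToSt_sharpW {d : ZMod 2} (w : Wpar 𝒜 d) : sharpToSt 𝒜 (sharpW 𝒜 w) = 0 :=
  (exists_sharpLift_psi 𝒜).choose_spec.choose_spec.2.1 w

theorem sharpToW_sharpF {i j : Fin 4} (h : i ≠ j) {d : ZMod 2} (a : 𝒜 d) :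
    sharpToW 𝒜 (sharpF 𝒜 h a) = 0 :=
  (exists_sharpLift_psi 𝒜).choose_spec.choose_spec.2.2.1 h a

theorem sharpToW_sharpIncl (w : W 𝒜) : sharpToW 𝒜 (sharpIncl 𝒜 w) = w :=
  (exists_sharpLift_psi 𝒜).choose_spec.choose_spec.2.2.2.1 w

theorem sharpToW_br (x y : Sharp 𝒜) :
    sharpToW 𝒜 (br K x y) = psi 𝒜 (sharpToSt 𝒜 x) (sharpToSt 𝒜 y) :=
  (exists_sharpLift_psi 𝒜).choose_spec.choose_spec.2.2.2.2.1 x y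

theorem sharpToW_mem {d : ZMod 2} {x : Sharp 𝒜} (hx : x ∈ par K d) : sharpToW 𝒜 x ∈ Wpar 𝒜 d :=
  (exists_sharpLift_psi 𝒜).choose_spec.choose_spec.2.2.2.2.2 hx

theorem sharpToSt_mem {d : ZMod 2} {x : Sharp 𝒜} (hx : x ∈ par K d) :
    sharpToSt 𝒜 x ∈ par K d := (sharpToSt 𝒜).map_par d x hx

theorem sharpToSt_br (x y : Sharp 𝒜) :
    sharpToSt 𝒜 (br K x y) = br K (sharpToSt 𝒜 x) (sharpToSt 𝒜 y) := (sharpToSt 𝒜).map_br x y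

theorem sharpToSt_sharpIncl (w : W 𝒜) : sharpToSt 𝒜 (sharpIncl 𝒜 w) = 0 := by
  rw [sharpIncl_apply, map_add, sharpToSt_sharpW, sharpToSt_sharpW, add_zero]

/-- A homomorphism from `𝔰𝔱(2, 2, A)^♯` is determined by its values on the generators. -/
theorem sharp_hom_ext {L : Type w} [AddCommGroup L] [Module K L] [LieSuperalgebra K L]
    {f g : Hom K (Sharp 𝒜) L}
    (hF : ∀ {i j d} (h : i ≠ j) (a : 𝒜 d), f (sharpF 𝒜 h a) = g (sharpF 𝒜 h a))
    (hW : ∀ {d} (w : Wpar 𝒜 d), f (sharpW 𝒜 w) = g (sharpW 𝒜 w)) (x : Sharp 𝒜) : f x = g x := by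
  refine sharp_mem (S := LinearMap.eqLocus f.toLinearMap g.toLinearMap)
    (fun i j h d a => hF h a) (fun d w => hW w) (fun x hx y hy => ?_) x
  refine (f.map_br x y).trans (Eq.trans ?_ (g.map_br x y).symm)
  exact congrArg₂ (fun a b => br K a b) hx hy

/-- Modulo W the relations of `St` hold for the F^♯_ij(a), which gives a map s from `St` to `Sharp`
modulo W. Its composite with the projection is the quotient map, so whatever projects to 0 lies in
W. -/
theorem mem_range_sharpIncl {x : Sharp 𝒜} (hx : sharpToSt 𝒜 x = 0) :
    x ∈ LinearMap.range (sharpIncl 𝒜) := by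
  let g : FGen 𝒜 (Fin 4) → Sharp 𝒜 := fun x => sharpF 𝒜 x.ne x.a
  let N := LinearMap.range (sharpIncl 𝒜)
  have hN : ∀ (x : Sharp 𝒜), ∀ n ∈ N, br K x n = 0 ∧ br K n x = 0 := by
    rintro x _ ⟨w, rfl⟩
    exact ⟨br_sharpIncl_right 𝒜 w x, br_sharpIncl_left 𝒜 w x⟩
  have hg : ∀ x, g x ∈ par K (FGen.par 𝒜 par22 x) := fun x => sharpF_mem 𝒜 x.ne x.a
  have hrel : ∀ r ∈ relIdeal K (FGen.par 𝒜 par22) {r | StRel 𝒜 (Fin 4) r},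
      (N.mkQ ∘ₗ freeLift (br K) g) r = 0 := by
    intro r hr
    refine (Submodule.Quotient.mk_eq_zero N).2
      (freeLift_mem_of_mem_relIdeal hg br_mem ?_ ?_ ?_ ?_ ?_ hr)
    · intro x n hn
      rw [(hN x n hn).1, (hN x n hn).2]
      exact ⟨zero_mem _, zero_mem _⟩
    · intro d e x y hx hy
      rw [LieSuperalgebra.skew hx hy, neg_add_cancel]
      exact zero_mem _
    · intro d e f x y z hx hy hz
      rw [LieSuperalgebra.jacobi hx hy hz]
      exact zero_mem _
    · intro x hx
      rw [LieSuperalgebra.alt hx]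
      exact zero_mem _
    · have hF : ∀ {i j d} (h : i ≠ j) (a : 𝒜 d), freeLift (br K) g (freeF 𝒜 h a) = sharpF 𝒜 h a :=
        fun _ _ => freeLift_of (br K) g _
      rintro r hr
      cases hr with
      | add h a b =>
        rw [map_sub, map_sub, hF, hF, hF, sharpF_add, add_sub_cancel_left, sub_self]
        exact zero_mem _
      | smul h c a =>
        rw [map_sub, map_smul, hF, hF, sharpF_smul, sub_self]
        exact zero_mem _
      | mul hij hjk hik a b =>
        rw [map_sub, freeLift_mul, hF, hF, hF, br_sharpF_sharpF 𝒜 hij hjk hik, sub_self]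
        exact zero_mem _
      | @zero i j k l hij hkl hjk hil d e a b =>
        rw [freeLift_mul, hF, hF]
        by_cases hik : i = k
        · rw [br_sharpF_sharpF_eq_zero 𝒜 hij hkl hjk hil (.inl hik)]
          exact zero_mem _
        by_cases hjl : j = l
        · rw [br_sharpF_sharpF_eq_zero 𝒜 hij hkl hjk hil (.inr hjl)]
          exact zero_mem _
        · rw [br_sharpF_sharpF_eq_psiVal 𝒜 hij hkl ⟨hij, hik, hil, hjk, hjl, hkl⟩]
          exact ⟨_, sharpIncl_coe 𝒜 _⟩
  let s : St 𝒜 par22 →ₗ[K] Sharp 𝒜 ⧸ N :=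
    (relIdeal K (FGen.par 𝒜 par22) {r | StRel 𝒜 (Fin 4) r}).liftQ
      (N.mkQ ∘ₗ freeLift (br K) g) hrel
  have hs : ∀ x : Sharp 𝒜, s (sharpToSt 𝒜 x) = N.mkQ x := by
    refine sharp_mem (S := LinearMap.eqLocus (s ∘ₗ (sharpToSt 𝒜).toLinearMap) N.mkQ) ?_ ?_ ?_
    · intro i j h d a
      refine (congrArg s (sharpToSt_sharpF h a)).trans ?_
      exact congrArg N.mkQ (freeLift_of (br K) g _)
    · intro d w
      refine (congrArg s (sharpToSt_sharpW w)).trans ?_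
      rw [map_zero]
      exact ((Submodule.Quotient.mk_eq_zero N).2 ⟨w, sharpIncl_coe 𝒜 w⟩).symm
    · intro x hx y hy
      change s (sharpToSt 𝒜 x) = N.mkQ x at hx
      change s (sharpToSt 𝒜 y) = N.mkQ y at hy
      change s (sharpToSt 𝒜 (br K x y)) = N.mkQ (br K x y)
      rw [sharpToSt_br]
      obtain ⟨x', hx'⟩ := (relIdeal K (FGen.par 𝒜 par22) {r | StRel 𝒜 (Fin 4) r}).mkQ_surjective
        (sharpToSt 𝒜 x)
      obtain ⟨y', hy'⟩ := (relIdeal K (FGen.par 𝒜 par22) {r | StRel 𝒜 (Fin 4) r}).mkQ_surjective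
        (sharpToSt 𝒜 y)
      -- The lift to `Sharp` of a free representative of the image of x differs from x by an element
      -- of W. As W is central, this does not change brackets, so s respects them although the
      -- quotient is only treated as a module.
      have hxN : freeLift (br K) g x' - x ∈ N := by
        rw [← Submodule.Quotient.mk_eq_zero, Submodule.Quotient.mk_sub, sub_eq_zero]
        refine Eq.trans ?_ hx
        rw [← hx']
        rfl
      have hyN : freeLift (br K) g y' - y ∈ N := by
        rw [← Submodule.Quotient.mk_eq_zero, Submodule.Quotient.mk_sub, sub_eq_zero]
        refine Eq.trans ?_ hy
        rw [← hy']
        rfl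
      rw [← hx', ← hy']
      refine (congrArg N.mkQ (freeLift_mul (br K) g x' y')).trans (congrArg N.mkQ ?_)
      have h1 := (hN (freeLift (br K) g y') _ hxN).2
      have h2 := (hN x _ hyN).1
      rw [map_sub, LinearMap.sub_apply, sub_eq_zero] at h1
      rw [map_sub, sub_eq_zero] at h2
      rw [h1, h2]
  have h := hs x
  rw [hx, map_zero] at h
  exact (Submodule.Quotient.mk_eq_zero N).1 h.symm

theorem sharp_eq_zero {x : Sharp 𝒜} (h : sharpToSt 𝒜 x = 0) (h' : sharpToW 𝒜 x = 0) : x = 0 := by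
  obtain ⟨w, rfl⟩ := mem_range_sharpIncl h
  rw [sharpToW_sharpIncl] at h'
  rw [h', map_zero]

theorem sharpToSt_surjective : Function.Surjective (sharpToSt 𝒜) := by
  intro x
  refine st_mem 𝒜 par22 (S := LinearMap.range (sharpToSt 𝒜).toLinearMap) ?_ ?_ x
  · intro i j h d a
    exact ⟨_, sharpToSt_sharpF h a⟩
  · rintro _ ⟨x, rfl⟩ _ ⟨y, rfl⟩
    exact ⟨_, sharpToSt_br x y⟩

variable (𝒜) in
/-- The algebra `𝔰𝔱(2, 2, A)^♯` is `𝔰𝔱(2, 2, A) ⊕ W`. -/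
def sharpEquiv : Sharp 𝒜 ≃ₗ[K] St 𝒜 par22 × W 𝒜 :=
  LinearEquiv.ofBijective ((sharpToSt 𝒜).toLinearMap.prod (sharpToW 𝒜)) (by
    constructor
    · rw [← LinearMap.ker_eq_bot, LinearMap.ker_eq_bot']
      intro x hx
      exact sharp_eq_zero (congrArg Prod.fst hx) (congrArg Prod.snd hx)
    · rintro ⟨s, w⟩
      obtain ⟨x, rfl⟩ := sharpToSt_surjective s
      refine ⟨x + sharpIncl 𝒜 (w - sharpToW 𝒜 x), Prod.ext ?_ ?_⟩
      · change sharpToSt 𝒜 (x + _) = _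
        rw [map_add, sharpToSt_sharpIncl, add_zero]
      · change sharpToW 𝒜 (x + _) = _
        rw [map_add, sharpToW_sharpIncl, add_sub_cancel])

theorem sharpEquiv_apply (x : Sharp 𝒜) : sharpEquiv 𝒜 x = (sharpToSt 𝒜 x, sharpToW 𝒜 x) := rfl

theorem mem_par_sharp {d : ZMod 2} {x : Sharp 𝒜} :
    x ∈ par K d ↔ sharpToSt 𝒜 x ∈ par K d ∧ sharpToW 𝒜 x ∈ Wpar 𝒜 d := by
  refine ⟨fun h => ⟨sharpToSt_mem h, sharpToW_mem h⟩, fun ⟨h, h'⟩ => ?_⟩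
  -- Here z is the component of the wrong parity: both of its coordinates would be homogeneous of
  -- two different parities, so they vanish.
  have key : ∀ {d e : ZMod 2} {y z : Sharp 𝒜}, d ≠ e → y ∈ par K d → z ∈ par K e →
      sharpToSt 𝒜 (y + z) ∈ par K d → sharpToW 𝒜 (y + z) ∈ Wpar 𝒜 d → z = 0 := by
    intro d e y z hde hy hz h h'
    rw [map_add] at h h'
    have h1 := (Submodule.add_mem_iff_right _ (sharpToSt_mem hy)).1 h
    have h2 := (Submodule.add_mem_iff_right _ (sharpToW_mem hy)).1 h'
    refine sharp_eq_zero ?_ (wpar_eq_zero hde h2 (sharpToW_mem hz))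
    have h3 := sharpToSt_mem hz
    rcases zmod_two_cases d with rfl | rfl <;> rcases zmod_two_cases e with rfl | rfl
    · exact absurd rfl hde
    · exact Submodule.disjoint_def.1 isCompl.disjoint _ h1 h3
    · exact Submodule.disjoint_def.1 isCompl.disjoint _ h3 h1
    · exact absurd rfl hde
  obtain ⟨x0, h0, x1, h1, rfl⟩ := exists_add (K := K) x
  rcases zmod_two_cases d with rfl | rfl
  · rw [key (by decide) h0 h1 h h', add_zero]
    exact h0
  · rw [add_comm] at h h'
    rw [key (by decide) h1 h0 h h', zero_add]
    exact h1

theorem sigma_rep (m : Fin 6) : sigma (repI m) (repJ m) (repK m) (repL m) = 1 := by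
  revert m; decide

theorem psiVal_rep (m : Fin 6) (c : A) :
    psiVal 𝒜 (repI m) (repJ m) (repK m) (repL m) 0 c = eps 𝒜 m c := by
  rw [psiVal, if_pos (rep_allDistinct m), theta_rep, sigma_rep, uzpow_zero, mul_one, one_smul, ite_self]

theorem exists_eps_sum (w : W 𝒜) : ∃ a : Fin 6 → A, w = ∑ m, eps 𝒜 m (a m) := by
  choose a ha using fun m => (commIdeal 𝒜 (torsion m)).mkQ_surjective (w m)
  refine ⟨a, ?_⟩
  ext m
  rw [Finset.sum_apply, Finset.sum_eq_single m]
  · rw [eps_apply, if_pos rfl, ha]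
  · intro n _ h
    rw [eps_apply, if_neg h]
  · simp

theorem eps_add (m : Fin 6) (a b : A) : eps 𝒜 m (a + b) = eps 𝒜 m a + eps 𝒜 m b := by
  rw [eps, map_add, Pi.single_add]
  rfl

/-- At the representative of the m-th coset, [F^♯_ij(a), F^♯_kl(1)] is ε_m(a) without a sign,
because 1 is even and σ is 1 there. -/
theorem sharpIncl_mem_derived (w : W 𝒜) : sharpIncl 𝒜 w ∈ derived K (Sharp 𝒜) := by
  obtain ⟨a, rfl⟩ := exists_eps_sum w
  rw [map_sum]
  refine Submodule.sum_mem _ fun m _ => ?_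
  generalize a m = a
  induction a using graded_induction (𝒜 := 𝒜) with
  | hadd h h' => rw [eps_add, map_add]; exact add_mem h h'
  | @h d a ha =>
    have hd := rep_allDistinct m
    have h := br_sharpF_sharpF_eq_psiVal 𝒜 hd.1 hd.2.2.2.2.2 hd (⟨a, ha⟩ : 𝒜 d)
      (⟨1, SetLike.one_mem_graded 𝒜⟩ : 𝒜 0)
    rw [← sharpIncl_coe] at h
    change _ = sharpIncl 𝒜 (psiVal 𝒜 _ _ _ _ 0 (a * 1)) at h
    rw [psiVal_rep, mul_one] at h
    rw [← h]
    exact br_mem_derived _ _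

theorem sharpF_congr {i j : Fin 4} (h : i ≠ j) {d e : ZMod 2} (hde : d = e) {a : 𝒜 d} {b : 𝒜 e}
    (hab : (a : A) = b) : sharpF 𝒜 h a = sharpF 𝒜 h b := by
  subst hde
  rw [Subtype.ext hab]

/-- Perfectness: F^♯_ij(a) = [F^♯_im(a), F^♯_mj(1)] for a third index m, and W consists of sums of
brackets as well. -/
theorem derived_sharp : derived K (Sharp 𝒜) = ⊤ := by
  rw [eq_top_iff]
  intro x _
  refine sharp_mem ?_ ?_ (fun x _ y _ => br_mem_derived x y) x
  · intro i j h d a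
    obtain ⟨m, hmi, hmj⟩ := exists_third i j
    have h' := br_sharpF_sharpF 𝒜 hmi.symm hmj h a (⟨1, SetLike.one_mem_graded 𝒜⟩ : 𝒜 0)
    rw [sharpF_congr (b := ⟨_, SetLike.mul_mem_graded a.2 (SetLike.one_mem_graded 𝒜)⟩) h
      (add_zero d).symm (mul_one (a : A)).symm, ← h']
    exact br_mem_derived _ _
  · intro d w
    rw [← sharpIncl_coe]
    exact sharpIncl_mem_derived _

end SharpStructure

/-! ## Cocycles on `𝔰𝔱(2, 2, A)` factor through `𝔰𝔱(2, 2, A)^♯` -/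

section Cocycle

variable {K : Type u} [CommRing K] {A : Type v} [Ring A] [Algebra K A]
  {𝒜 : ZMod 2 → Submodule K A} [GradedAlgebra 𝒜]
  {M : Type w} [AddCommGroup M] [Module K M] {Mpar : ZMod 2 → Submodule K M}
  {β : St 𝒜 par22 →ₗ[K] St 𝒜 par22 →ₗ[K] M}
  {i j k l : Fin 4} {d e f : ZMod 2} {a b c : A}

theorem units_smul_of_add_self {x : M} (hx : x + x = 0) (s : ℤˣ) : s • x = x := by
  rcases Int.units_eq_one_or s with rfl | rfl
  · rw [one_smul]
  · rw [Units.neg_smul, one_smul, neg_eq_of_add_eq_zero_left hx]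

theorem one_mem_zero : (1 : A) ∈ 𝒜 0 := SetLike.one_mem_graded 𝒜

namespace IsEvenSuperCocycle

/-- With a common row or column at most three indices occur, so a fourth index m is free. Splitting
F_kl(b) = [F_km(b), F_ml(1)], the element F_ij(a) commutes with both factors. -/
theorem apply_stLin_eq_zero (hβ : IsEvenSuperCocycle Mpar β) (hjk : j ≠ k) (hil : i ≠ l)
    (h : i = k ∨ j = l) (hkl : k ≠ l) (ha : a ∈ 𝒜 d) (hb : b ∈ 𝒜 e) :
    β (stLin 𝒜 par22 i j a) (stLin 𝒜 par22 k l b) = 0 := by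
  obtain ⟨m, hmi, hmj, hmk, hml⟩ : ∃ m, m ≠ i ∧ m ≠ j ∧ m ≠ k ∧ m ≠ l := by
    clear hjk hil hkl
    revert i j k l; decide
  have hm : stLin 𝒜 par22 k l b = br K (stLin 𝒜 par22 k m b) (stLin 𝒜 par22 m l 1) := by
    rw [br_stLin hmk.symm hml hkl, mul_one]
  rw [hm, hβ.leibniz (stLin_mem ha) (stLin_mem hb), br_stLin_eq_zero hjk hmi.symm,
    br_stLin_eq_zero hmj.symm hil]
  simp

/-- The Leibniz rule for F_lk(bc) = [F_lj(b), F_jk(c)]; the second term vanishes as F_il(a) and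
F_jk(c) commute. The intermediate index and the position of b change together. -/
theorem apply_stLin_mul (hβ : IsEvenSuperCocycle Mpar β) (hd : AllDistinct i j k l)
    (ha : a ∈ 𝒜 d) (hb : b ∈ 𝒜 e) (c : A) :
    β (stLin 𝒜 par22 i j (a * b)) (stLin 𝒜 par22 j k c)
      = β (stLin 𝒜 par22 i l a) (stLin 𝒜 par22 l k (b * c)) := by
  obtain ⟨hij, hik, hil, hjk, hjl, hkl⟩ := hd
  rw [← br_stLin (p := par22) hjl.symm hjk hkl.symm b c,
    hβ.leibniz (stLin_mem ha) (stLin_mem hb), br_stLin_eq_zero hjl.symm hik,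
    br_stLin hil hjl.symm hij]
  simp

/-- `β(F_{ij}(a), F_{jk}(b))` depends only on `i`, `k` and `ab`. -/
theorem apply_stLin_stLin (hβ : IsEvenSuperCocycle Mpar β) (hij : i ≠ j) (hjk : j ≠ k)
    (hik : i ≠ k) {m : Fin 4} (hmi : m ≠ i) (hmk : m ≠ k) (ha : a ∈ 𝒜 d) (hb : b ∈ 𝒜 e) :
    β (stLin 𝒜 par22 i j a) (stLin 𝒜 par22 j k b)
      = β (stLin 𝒜 par22 i m (a * b)) (stLin 𝒜 par22 m k 1) := by
  have key : ∀ {j m : Fin 4}, i ≠ j → j ≠ k → m ≠ i → m ≠ k → j ≠ m → ∀ {d e a b}, a ∈ 𝒜 d →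
      b ∈ 𝒜 e → β (stLin 𝒜 par22 i j a) (stLin 𝒜 par22 j k b)
        = β (stLin 𝒜 par22 i m (a * b)) (stLin 𝒜 par22 m k 1) := by
    intro j m hij hjk hmi hmk hjm d e a b ha hb
    rw [hβ.apply_stLin_mul ⟨hmi.symm, hik, hij, hmk, hjm.symm, hjk.symm⟩ ha hb, mul_one]
  by_cases hjm : j = m
  · subst hjm
    -- If the intermediate index is to stay the same, a detour through the fourth index n still
    -- moves b into the first argument.
    obtain ⟨n, hn1, hn2, hn3⟩ : ∃ n, n ≠ i ∧ n ≠ j ∧ n ≠ k := by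
      clear hij hjk hik hmi hmk key ha hb
      revert i j k; decide
    rw [key hij hjk hn1 hn3 hn2.symm ha hb, key hn1.symm hn3 hmi hmk hn2
      (SetLike.mul_mem_graded ha hb) one_mem_zero, mul_one]
  · exact key hij hjk hmi hmk hjm ha hb

/-- Insert F_kl(bc) = [F_ki(b), F_il(c)]. F_ij(a) commutes with F_il(c), so only the term in which
F_ki(b) acts on F_ij(a) remains: the rows are exchanged and b changes sides. -/
theorem apply_transfer (hβ : IsEvenSuperCocycle Mpar β) (hd : AllDistinct i j k l)
    (ha : a ∈ 𝒜 d) (hb : b ∈ 𝒜 e) (c : A) :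
    β (stLin 𝒜 par22 i j a) (stLin 𝒜 par22 k l (b * c))
      = -((-1 : ℤˣ) ^ ((par22 i + par22 j + d) * (par22 k + par22 i + e)) •
        β (stLin 𝒜 par22 k j (b * a)) (stLin 𝒜 par22 i l c)) := by
  obtain ⟨hij, hik, hil, hjk, hjl, hkl⟩ := hd
  rw [← br_stLin (p := par22) hik.symm hil hkl b c,
    hβ.leibniz (stLin_mem ha) (stLin_mem hb), br_stLin_eq_zero hij.symm hil, map_zero, smul_zero,
    add_zero, LieSuperalgebra.skew (stLin_mem ha) (stLin_mem hb), br_stLin hik.symm hij hjk.symm,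
    map_neg, LinearMap.neg_apply, map_units_smul₂]

/-- Two exchanges of rows, the second with coefficient 1, restore the indices but leave b in the
first argument. -/
theorem apply_shift_aux (hβ : IsEvenSuperCocycle Mpar β) (hd : AllDistinct i j k l)
    (ha : a ∈ 𝒜 d) (hb : b ∈ 𝒜 e) (c : A) :
    β (stLin 𝒜 par22 i j a) (stLin 𝒜 par22 k l (b * c))
      = (-1 : ℤˣ) ^ ((par22 i + par22 j + d) * (par22 k + par22 i + e)
          + (par22 k + par22 j + (e + d)) * (par22 i + par22 k + 0)) •
        β (stLin 𝒜 par22 i j (b * a)) (stLin 𝒜 par22 k l c) := by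
  have hd' : AllDistinct k j i l := ⟨hd.2.2.2.1.symm, hd.2.1.symm, hd.2.2.2.2.2, hd.1.symm,
    hd.2.2.2.2.1, hd.2.2.1⟩
  have h := hβ.apply_transfer hd' (SetLike.mul_mem_graded hb ha) one_mem_zero c
  rw [one_mul, one_mul] at h
  rw [hβ.apply_transfer hd ha hb c, h, smul_neg, neg_neg, smul_smul, uzpow_add]

/-- Source of the summands A₂: two exchanges of rows with coefficient 1 reproduce the value with
sign -1 when the rows have different parities, so the value equals its own negative. -/
theorem apply_add_self (hβ : IsEvenSuperCocycle Mpar β) (hd : AllDistinct i j k l)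
    (hp : par22 k = par22 i + 1) (a c : A) :
    β (stLin 𝒜 par22 i j a) (stLin 𝒜 par22 k l c)
      + β (stLin 𝒜 par22 i j a) (stLin 𝒜 par22 k l c) = 0 := by
  induction a using graded_induction (𝒜 := 𝒜) with
  | hadd h h' =>
    rw [map_add, map_add, LinearMap.add_apply, add_add_add_comm, h, h', add_zero]
  | @h d a ha =>
    have h := hβ.apply_shift_aux hd ha one_mem_zero c
    have hE : ∀ P Q d : ZMod 2, (P + Q + d) * (P + 1 + P + 0)
        + (P + 1 + Q + (0 + d)) * (P + (P + 1) + 0) = 1 := by decide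
    rw [hp, hE, one_mul, one_mul, uzpow_one, Units.neg_smul, one_smul] at h
    exact add_eq_zero_iff_eq_neg.2 h

theorem par22_cases (hd : AllDistinct i j k l) : par22 k = par22 i + 1 ∨
    (par22 k = par22 i ∧ par22 j = par22 i + 1 ∧ par22 l = par22 i + 1) := by
  revert i j k l; decide

/-- The sign is the one found for rows of equal parity. In the other case the value is annihilated
by 2 and any sign is correct, so one formula covers all cosets. -/
theorem apply_shift (hβ : IsEvenSuperCocycle Mpar β) (hd : AllDistinct i j k l)
    (ha : a ∈ 𝒜 d) (hb : b ∈ 𝒜 e) (c : A) :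
    β (stLin 𝒜 par22 i j a) (stLin 𝒜 par22 k l (b * c))
      = (-1 : ℤˣ) ^ ((1 + d) * e) •
        β (stLin 𝒜 par22 i j (b * a)) (stLin 𝒜 par22 k l c) := by
  rw [hβ.apply_shift_aux hd ha hb c]
  rcases par22_cases hd with h | ⟨hk, hj, hl⟩
  · have ht := hβ.apply_add_self hd h (b * a) c
    rw [units_smul_of_add_self ht, units_smul_of_add_self ht]
  · have hE : ∀ P d e : ZMod 2, (P + (P + 1) + d) * (P + P + e)
        + (P + (P + 1) + (e + d)) * (P + P + 0) = (1 + d) * e := by decide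
    rw [hk, hj, hE]

variable (β) in
/-- The map `a ↦ β(F_{ij}(a), F_{kl}(1))`. -/
def traceMap (i j k l : Fin 4) : A →ₗ[K] M :=
  β.flip (stLin 𝒜 par22 k l 1) ∘ₗ stLin 𝒜 par22 i j

theorem traceMap_apply (a : A) :
    traceMap β i j k l a = β (stLin 𝒜 par22 i j a) (stLin 𝒜 par22 k l 1) := rfl

theorem apply_eq_traceMap (hβ : IsEvenSuperCocycle Mpar β) (hd : AllDistinct i j k l)
    (ha : a ∈ 𝒜 d) (hb : b ∈ 𝒜 e) :
    β (stLin 𝒜 par22 i j a) (stLin 𝒜 par22 k l b)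
      = (-1 : ℤˣ) ^ ((1 + d) * e) • traceMap β i j k l (b * a) := by
  have h := hβ.apply_shift hd ha hb 1
  rwa [mul_one] at h

/-- The product bc is shifted to the first argument as a whole, giving bca, or first b and then c,
giving cba. Comparison yields supercommutation of b and c in front of a. -/
theorem traceMap_mul_mul (hβ : IsEvenSuperCocycle Mpar β) (hd : AllDistinct i j k l)
    (ha : a ∈ 𝒜 d) (hb : b ∈ 𝒜 e) (hc : c ∈ 𝒜 f) :
    traceMap β i j k l (b * c * a) = (-1 : ℤˣ) ^ (e * f) • traceMap β i j k l (c * b * a) := by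
  have h1 := hβ.apply_eq_traceMap hd ha (SetLike.mul_mem_graded hb hc)
  have h2 := hβ.apply_shift hd ha hb c
  rw [hβ.apply_eq_traceMap hd (SetLike.mul_mem_graded hb ha) hc, smul_smul, ← uzpow_add] at h2
  have h3 := h1.symm.trans h2
  have h4 := congrArg (fun x => (-1 : ℤˣ) ^ ((1 + d) * (e + f)) • x) h3
  simp only [smul_smul, ← uzpow_add] at h4
  have hE1 : ∀ d e f : ZMod 2, (1 + d) * (e + f) + (1 + d) * (e + f) = 0 := by decide
  have hE2 : ∀ d e f : ZMod 2,
      (1 + d) * (e + f) + ((1 + d) * e + (1 + (e + d)) * f) = e * f := by decide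
  rw [hE1, hE2, uzpow_zero, one_smul] at h4
  rw [h4, mul_assoc c b a]

theorem killsComm_traceMap (hβ : IsEvenSuperCocycle Mpar β) (hd : AllDistinct i j k l) :
    KillsComm 𝒜 (traceMap β i j k l) := by
  -- With third factor 1 the previous identity is supercommutation of two factors. A left factor x
  -- can thus be rotated to the end, where a and b may be exchanged, and then rotated back.
  have rot : ∀ {d e : ZMod 2} {x y : A}, x ∈ 𝒜 d → y ∈ 𝒜 e →
      traceMap β i j k l (x * y) = (-1 : ℤˣ) ^ (d * e) • traceMap β i j k l (y * x) := by
    intro d e x y hx hy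
    simpa using hβ.traceMap_mul_mul hd one_mem_zero hx hy
  intro d e a b x y ha hb
  induction x using graded_induction (𝒜 := 𝒜) with
  | hadd h h' => simp only [add_mul, map_add, smul_add, h, h']
  | @h f x hx =>
    induction y using graded_induction (𝒜 := 𝒜) with
    | hadd h h' => simp only [mul_add, map_add, smul_add, h, h']
    | @h g y hy =>
      have h1 := rot hx (SetLike.mul_mem_graded (SetLike.mul_mem_graded ha hb) hy)
      have h2 := rot hx (SetLike.mul_mem_graded (SetLike.mul_mem_graded hb ha) hy)
      have h3 := hβ.traceMap_mul_mul hd (SetLike.mul_mem_graded hy hx) ha hb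
      rw [mul_assoc x, h1, mul_assoc x, h2, mul_assoc (a * b), h3, mul_assoc (b * a), smul_comm,
        add_comm e d]

theorem apply_eq_traceMap' (hβ : IsEvenSuperCocycle Mpar β) (hd : AllDistinct i j k l)
    (ha : a ∈ 𝒜 d) (hb : b ∈ 𝒜 e) :
    β (stLin 𝒜 par22 i j a) (stLin 𝒜 par22 k l b)
      = (-1 : ℤˣ) ^ e • traceMap β i j k l (a * b) := by
  have hE : ∀ d e : ZMod 2, (1 + d) * e + d * e = e := by decide
  rw [hβ.apply_eq_traceMap hd ha hb, (hβ.killsComm_traceMap hd).swap ha hb, smul_smul,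
    ← uzpow_add, hE]

/-- `apply_transfer` with both coefficients 1. For rows of equal parity the Koszul exponent is 0;
otherwise signs are irrelevant. -/
theorem traceMap_swap_rows (hβ : IsEvenSuperCocycle Mpar β) (hd : AllDistinct i j k l) (a : A) :
    traceMap β i j k l a = - traceMap β k j i l a := by
  have hd' : AllDistinct k j i l := ⟨hd.2.2.2.1.symm, hd.2.1.symm, hd.2.2.2.2.2, hd.1.symm,
    hd.2.2.2.2.1, hd.2.2.1⟩
  induction a using graded_induction (𝒜 := 𝒜) with
  | hadd h h' => rw [map_add, h, h', map_add, neg_add]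
  | @h d a ha =>
    have h := hβ.apply_transfer hd ha one_mem_zero 1
    rw [one_mul, one_mul] at h
    rw [traceMap_apply, traceMap_apply, h]
    rcases par22_cases hd with hp | ⟨hk, hj, hl⟩
    · rw [units_smul_of_add_self (hβ.apply_add_self hd' (by rw [hp, add_assoc,
        show (1 + 1 : ZMod 2) = 0 by decide, add_zero]) _ _)]
    · rw [hk, CharTwo.add_self_eq_zero, add_zero, mul_zero, uzpow_zero, one_smul]

/-- Exchanging rows and columns simultaneously is super-antisymmetry of β: for rows of equal parity
the entry at (i, j) is an odd position, and the Koszul signs compensate the minus sign. -/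
theorem traceMap_skew (hβ : IsEvenSuperCocycle Mpar β) (hd : AllDistinct i j k l) (a : A) :
    traceMap β i j k l a = traceMap β k l i j a := by
  have hd' : AllDistinct k l i j := ⟨hd.2.2.2.2.2, hd.2.1.symm, hd.2.2.2.1.symm, hd.2.2.1.symm,
    hd.2.2.2.2.1.symm, hd.1⟩
  induction a using graded_induction (𝒜 := 𝒜) with
  | hadd h h' => rw [map_add, h, h', map_add]
  | @h d a ha =>
    rw [traceMap_apply, hβ.skew (stLin_mem ha) (stLin_mem one_mem_zero),
      hβ.apply_eq_traceMap' hd' one_mem_zero ha, one_mul, smul_smul, ← uzpow_add]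
    rcases par22_cases hd with hp | ⟨hk, hj, hl⟩
    · have ht := hβ.apply_add_self hd' (by rw [hp, add_assoc,
        show (1 + 1 : ZMod 2) = 0 by decide, add_zero]) a 1
      rw [← traceMap_apply] at ht
      rw [units_smul_of_add_self ht, neg_eq_of_add_eq_zero_left ht]
    · have hE : ∀ P d : ZMod 2, (P + (P + 1) + d) * (P + (P + 1) + 0) + d = 1 := by decide
      rw [hk, hj, hl, hE, uzpow_one, Units.neg_smul, one_smul, neg_neg]

theorem traceMap_mem (hβ : IsEvenSuperCocycle Mpar β) (hd : AllDistinct i j k l) (ha : a ∈ 𝒜 d) :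
    traceMap β i j k l a ∈ Mpar d := by
  have h := hβ.even (stLin_mem (p := par22) (i := i) (j := j) ha)
    (stLin_mem (p := par22) (i := k) (j := l) (one_mem_zero (𝒜 := 𝒜)))
  rwa [show par22 i + par22 j + d + (par22 k + par22 l + 0) = d by
    linear_combination par22_sum hd] at h

/-- The multiples of 2 are killed by `apply_add_self`, the supercommutators by `killsComm_traceMap`;
this is why β induces a map on W. -/
theorem commIdeal_le_ker (hβ : IsEvenSuperCocycle Mpar β) (m : Fin 6) :
    commIdeal 𝒜 (torsion m) ≤ LinearMap.ker (traceMap β (repI m) (repJ m) (repK m) (repL m)) := by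
  refine Submodule.span_le.2 ?_
  rintro _ ⟨x, y, g, ⟨a, rfl⟩ | ⟨d, e, a, b, ha, hb, rfl⟩, rfl⟩
  · rw [SetLike.mem_coe, LinearMap.mem_ker]
    rcases rep_cases m with ⟨h, h4, h5⟩ | ⟨h, -⟩
    · rw [h, two_nsmul, mul_add, add_mul, map_add]
      refine hβ.apply_add_self (rep_allDistinct m) ?_ _ _
      revert h h4 h5
      clear x y a
      revert m
      decide
    · rw [h, zero_nsmul, mul_zero, zero_mul, map_zero]
  · rw [SetLike.mem_coe, LinearMap.mem_ker, mul_sub, sub_mul, map_sub, sub_eq_zero,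
      hβ.killsComm_traceMap (rep_allDistinct m) x y ha hb, mul_smul_comm, smul_mul_assoc,
      map_units_smul]

/-- The map on `W` induced by a cocycle. -/
def wMap (hβ : IsEvenSuperCocycle Mpar β) : W 𝒜 →ₗ[K] M :=
  ∑ m, (commIdeal 𝒜 (torsion m)).liftQ _ (hβ.commIdeal_le_ker m) ∘ₗ LinearMap.proj m

theorem wMap_apply (hβ : IsEvenSuperCocycle Mpar β) (w : W 𝒜) :
    hβ.wMap w = ∑ m, (commIdeal 𝒜 (torsion m)).liftQ _ (hβ.commIdeal_le_ker m) (w m) := by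
  simp [wMap, LinearMap.sum_apply]

theorem wMap_eps (hβ : IsEvenSuperCocycle Mpar β) (m : Fin 6) (a : A) :
    hβ.wMap (eps 𝒜 m a) = traceMap β (repI m) (repJ m) (repK m) (repL m) a := by
  rw [wMap_apply, Finset.sum_eq_single m]
  · rw [eps_apply, if_pos rfl]
    exact Submodule.liftQ_apply _ _ _
  · intro n _ h
    rw [eps_apply, if_neg h.symm, map_zero]
  · simp

theorem wMap_mem (hβ : IsEvenSuperCocycle Mpar β) {w : W 𝒜} (hw : w ∈ Wpar 𝒜 d) :
    hβ.wMap w ∈ Mpar d := by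
  rw [wMap_apply]
  refine Submodule.sum_mem _ fun m _ => ?_
  obtain ⟨a, ha, haw⟩ := hw m (Set.mem_univ _)
  rw [← haw]
  exact hβ.traceMap_mem (rep_allDistinct m) ha

theorem apply_eq_wMap (hβ : IsEvenSuperCocycle Mpar β) (hd : AllDistinct i j k l)
    (ha : a ∈ 𝒜 d) (hb : b ∈ 𝒜 e) :
    β (stLin 𝒜 par22 i j a) (stLin 𝒜 par22 k l b) = hβ.wMap (psiVal 𝒜 i j k l e (a * b)) := by
  have hd' : AllDistinct k j i l := ⟨hd.2.2.2.1.symm, hd.2.1.symm, hd.2.2.2.2.2, hd.1.symm,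
    hd.2.2.2.2.1, hd.2.2.1⟩
  have ht : ¬ (theta i k = 4 ∨ theta i k = 5) → par22 k = par22 i + 1 := by
    clear hd hd'
    revert i k; decide
  -- Reduction to the representative of the coset. Row exchange gives -1 and simultaneous exchange
  -- gives 1, in agreement with σ on P₅ and P₆; elsewhere the sign is absorbed by 2-torsion.
  have hT : ∀ x : A, traceMap β i j k l x = (if theta i k = 4 ∨ theta i k = 5 then
      sigma i j k l else 1) • traceMap β (repI (theta i k)) (repJ (theta i k)) (repK (theta i k))
        (repL (theta i k)) x := by
    intro x
    have hneg : ∀ y, (theta i k = 4 ∨ theta i k = 5 → sigma i j k l = -1) →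
        traceMap β i j k l x = -y → traceMap β i j k l x =
          (if theta i k = 4 ∨ theta i k = 5 then sigma i j k l else 1) • y := by
      intro y hσ hy
      split_ifs with h
      · rw [hσ h, Units.neg_smul, one_smul, hy]
      · have h2 := hβ.apply_add_self hd (ht h) x 1
        rw [← traceMap_apply] at h2
        rw [one_smul, ← neg_eq_of_add_eq_zero_left h2, hy, neg_neg]
    rcases coset_cases hd with ⟨e1, e2, e3, e4, hσ⟩ | ⟨e1, e2, e3, e4, hσ⟩ |
      ⟨e1, e2, e3, e4, hσ⟩ | ⟨e1, e2, e3, e4, hσ⟩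
    · rw [← e1, ← e2, ← e3, ← e4, hσ, ite_self, one_smul]
    · rw [← e1, ← e2, ← e3, ← e4, hσ, ite_self, one_smul, hβ.traceMap_skew hd]
    · rw [← e1, ← e2, ← e3, ← e4]
      exact hneg _ hσ (by rw [hβ.traceMap_swap_rows hd, hβ.traceMap_skew hd'])
    · rw [← e1, ← e2, ← e3, ← e4]
      exact hneg _ hσ (hβ.traceMap_swap_rows hd x)
  rw [hβ.apply_eq_traceMap' hd ha hb, psiVal, if_pos hd]
  by_cases h : theta i k = 4 ∨ theta i k = 5
  · rw [if_pos h, map_units_smul, wMap_eps, hT, if_pos h, smul_smul]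
  · have h1 := hT (a * b)
    rw [if_neg h, one_smul] at h1
    rw [if_neg h, wMap_eps, ← h1]
    exact units_smul_of_add_self (hβ.apply_add_self hd (ht h) (a * b) 1) _

/-- Every cocycle on `𝔰𝔱(2, 2, A)` comes from a linear map on `𝔰𝔱(2, 2, A)^♯`. -/
theorem exists_sharp_map (hβ : IsEvenSuperCocycle Mpar β) : ∃ ρ : Sharp 𝒜 →ₗ[K] M,
    (∀ x y, ρ (br K x y) = β (sharpToSt 𝒜 x) (sharpToSt 𝒜 y)) ∧
      ∀ {d} {x : Sharp 𝒜}, x ∈ par K d → ρ x ∈ Mpar d := by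
  choose third h3i h3j using exists_third
  -- The value that ρ must take at F^♯_ik(a) = [F^♯_im(a), F^♯_mk(1)]; by `apply_stLin_stLin` the
  -- choice of m is immaterial.
  let G : Fin 4 → Fin 4 → A →ₗ[K] M := fun i k => traceMap β i (third i k) (third i k) k
  have hG : ∀ {i k d a}, i ≠ k → a ∈ 𝒜 d → G i k a ∈ Mpar (par22 i + par22 k + d) := by
    intro i k d a _ ha
    have h := hβ.even (stLin_mem (p := par22) (i := i) (j := third i k) ha)
      (stLin_mem (p := par22) (i := third i k) (j := k) (one_mem_zero (𝒜 := 𝒜)))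
    rwa [show par22 i + par22 (third i k) + d + (par22 (third i k) + par22 k + 0)
      = par22 i + par22 k + d by
        linear_combination CharTwo.add_self_eq_zero (par22 (third i k))] at h
  obtain ⟨π, ρ, hπF, hπW, -, -, hρ, hρpar⟩ := exists_sharpLift hβ G hβ.wMap hG hβ.wMap_mem
    (fun hij hjk hik a b => by
      rw [stF_eq, stF_eq]
      exact hβ.apply_stLin_stLin hij hjk hik (h3i _ _) (h3j _ _) a.2 b.2)
    (fun hij hkl hjk hil h a b => by
      rw [stF_eq, stF_eq]
      exact hβ.apply_stLin_eq_zero hjk hil h hkl a.2 b.2)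
    (fun hij hkl h a b => by
      rw [stF_eq, stF_eq]
      exact hβ.apply_eq_wMap h a.2 b.2)
  have hπ : ∀ x, π x = sharpToSt 𝒜 x := sharp_hom_ext
    (fun h a => (hπF h a).trans (sharpToSt_sharpF h a).symm)
    (fun w => (hπW w).trans (sharpToSt_sharpW w).symm)
  exact ⟨ρ, fun x y => by rw [hρ, hπ, hπ], hρpar⟩

end IsEvenSuperCocycle

end Cocycle

/-! ## Central extensions -/

section Extension

variable {K : Type u} [CommRing K] {E : Type v} [AddCommGroup E] [Module K E] [LieSuperalgebra K E]
  {L : Type w} [AddCommGroup L] [Module K L] [LieSuperalgebra K L] {τ : Hom K E L}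

theorem Hom.homogeneous_ker (τ : Hom K E L) {x y : E} (hx : x ∈ par K 0) (hy : y ∈ par K 1)
    (h : τ (x + y) = 0) : τ x = 0 ∧ τ y = 0 :=
  par_eq_zero (τ.map_par 0 x hx) (τ.map_par 1 y hy) (by rw [← map_add, h])

namespace IsCentralExtension

theorem br_left (hτ : IsCentralExtension τ) {x : E} (hx : τ x = 0) (y : E) : br K x y = 0 :=
  hτ.2 x hx y

theorem br_right (hτ : IsCentralExtension τ) {x : E} (hx : τ x = 0) (y : E) : br K y x = 0 := by
  obtain ⟨x0, h0, x1, h1, rfl⟩ := exists_add (K := K) x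
  obtain ⟨e0, e1⟩ := τ.homogeneous_ker h0 h1 hx
  rw [map_add, br_comm_eq_zero h0 (hτ.2 _ e0), br_comm_eq_zero h1 (hτ.2 _ e1), add_zero]

/-- The bracket of a central extension depends only on the images, so it defines a bilinear map on
the base. -/
theorem br_congr (hτ : IsCentralExtension τ) {x x' y y' : E} (hx : τ x = τ x') (hy : τ y = τ y') :
    br K x y = br K x' y' := by
  have h1 := hτ.br_left (x := x - x') (by rw [map_sub, hx, sub_self]) y
  have h2 := hτ.br_right (x := y - y') (by rw [map_sub, hy, sub_self]) x'
  rw [map_sub, LinearMap.sub_apply, sub_eq_zero] at h1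
  rw [map_sub, sub_eq_zero] at h2
  rw [h1, h2]

theorem exists_mem (hτ : IsCentralExtension τ) {d : ZMod 2} {y : L} (hy : y ∈ par K d) :
    ∃ x ∈ par K d, τ x = y := by
  obtain ⟨x, rfl⟩ := hτ.1 y
  obtain ⟨x0, h0, x1, h1, rfl⟩ := exists_add (K := K) x
  rw [map_add] at hy ⊢
  rcases zmod_two_cases d with rfl | rfl
  · refine ⟨x0, h0, ?_⟩
    have h : τ x1 = 0 := Submodule.disjoint_def.1 isCompl.disjoint _
      (by simpa using sub_mem hy (τ.map_par 0 x0 h0)) (τ.map_par 1 x1 h1)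
    rw [h, add_zero]
  · refine ⟨x1, h1, ?_⟩
    have h : τ x0 = 0 := Submodule.disjoint_def.1 isCompl.disjoint _ (τ.map_par 0 x0 h0)
      (by simpa using sub_mem hy (τ.map_par 1 x1 h1))
    rw [h, zero_add]

variable {S : Type t} [AddCommGroup S] [Module K S] [LieSuperalgebra K S]

/-- The bracket in a central extension of `L`, as a bilinear map on a Lie superalgebra
over `L`. -/
theorem exists_cocycle (hτ : IsCentralExtension τ) (χ : Hom K S L) :
    ∃ β : S →ₗ[K] S →ₗ[K] E, IsEvenSuperCocycle (par K) β ∧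
      ∀ (x y : S) (x' y' : E), τ x' = χ x → τ y' = χ y → β x y = br K x' y' := by
  -- A set-theoretic section suffices: by `br_congr` the bracket of lifts is bilinear even though s
  -- is not linear. The cocycle axioms are then checked on homogeneous lifts.
  choose s hs using hτ.1
  have h1 : ∀ x y : S, τ (s (χ x) + s (χ y)) = χ (x + y) := fun x y => by
    rw [map_add, hs, hs, map_add]
  have h2 : ∀ (c : K) (x : S), τ (c • s (χ x)) = χ (c • x) := fun c x => by
    rw [map_smul, hs, map_smul]
  let β : S →ₗ[K] S →ₗ[K] E := LinearMap.mk₂ K (fun x y => br K (s (χ x)) (s (χ y)))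
    (fun x y z => by
      rw [← LinearMap.add_apply, ← map_add]
      exact hτ.br_congr (by rw [hs, h1]) rfl)
    (fun c x y => by
      rw [← LinearMap.smul_apply, ← map_smul]
      exact hτ.br_congr (by rw [hs, h2]) rfl)
    (fun x y z => by
      rw [← map_add]
      exact hτ.br_congr rfl (by rw [hs, h1]))
    (fun c x y => by
      rw [← map_smul]
      exact hτ.br_congr rfl (by rw [hs, h2]))
  have hβ : ∀ (x y : S) (x' y' : E), τ x' = χ x → τ y' = χ y → β x y = br K x' y' :=
    fun x y x' y' hx hy => hτ.br_congr (by rw [hs, hx]) (by rw [hs, hy])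
  have hbr : ∀ {x y : S} {x' y' : E}, τ x' = χ x → τ y' = χ y →
      τ (br K x' y') = χ (br K x y) := fun {x y x' y'} hx hy =>
    (τ.map_br x' y').trans ((congrArg₂ (fun a b => br K a b) hx hy).trans (χ.map_br x y).symm)
  refine ⟨β, ⟨?_, ?_, ?_, ?_⟩, hβ⟩
  · intro d e x y hx hy
    obtain ⟨x', hx', ex⟩ := hτ.exists_mem (χ.map_par d x hx)
    obtain ⟨y', hy', ey⟩ := hτ.exists_mem (χ.map_par e y hy)
    rw [hβ x y x' y' ex ey]
    exact br_mem hx' hy'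
  · intro d e x y hx hy
    obtain ⟨x', hx', ex⟩ := hτ.exists_mem (χ.map_par d x hx)
    obtain ⟨y', hy', ey⟩ := hτ.exists_mem (χ.map_par e y hy)
    rw [hβ x y x' y' ex ey, hβ y x y' x' ey ex]
    exact LieSuperalgebra.skew hx' hy'
  · intro d e f x y z hx hy hz
    obtain ⟨x', hx', ex⟩ := hτ.exists_mem (χ.map_par d x hx)
    obtain ⟨y', hy', ey⟩ := hτ.exists_mem (χ.map_par e y hy)
    obtain ⟨z', hz', ez⟩ := hτ.exists_mem (χ.map_par f z hz)
    rw [hβ _ _ _ _ (hbr ex ey) ez, hβ _ _ _ _ (hbr ey ez) ex, hβ _ _ _ _ (hbr ez ex) ey]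
    exact jacobi hx' hy' hz'
  · intro x hx
    obtain ⟨x', hx', ex⟩ := hτ.exists_mem (χ.map_par 0 x hx)
    rw [hβ x x x' x' ex ex]
    exact LieSuperalgebra.alt hx'

end IsCentralExtension

theorem Hom.ext {f g : Hom K E L} (h : ∀ x, f x = g x) : f = g := by
  obtain ⟨f, hf1, hf2⟩ := f
  obtain ⟨g, hg1, hg2⟩ := g
  obtain rfl : f = g := LinearMap.ext h
  rfl

theorem eq_of_eq_br (hE : derived K E = ⊤) {M : Type t} [AddCommGroup M] [Module K M]
    {f g : E →ₗ[K] M} (h : ∀ x y, f (br K x y) = g (br K x y)) (x : E) : f x = g x := by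
  have hx : x ∈ derived K E := hE ▸ Submodule.mem_top
  have hle : derived K E ≤ LinearMap.eqLocus f g := Submodule.span_le.2 (by
    rintro _ ⟨x, y, rfl⟩
    exact h x y)
  exact hle hx

/-- A central extension of a quotient of a perfect Lie superalgebra by a central subspace. -/
theorem IsCentralExtension.comp_of_perfect (hE : derived K E = ⊤) (hτ : IsCentralExtension τ)
    {L' : Type t} [AddCommGroup L'] [Module K L'] [LieSuperalgebra K L'] {τ' : Hom K L L'}
    (hτ' : IsCentralExtension τ') : IsCentralExtension (τ'.comp τ) := by
  refine ⟨hτ'.1.comp hτ.1, ?_⟩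
  have key : ∀ {d : ZMod 2} {x : E}, x ∈ par K d → τ' (τ x) = 0 → ∀ y, br K x y = 0 := by
    intro d x hd hx
    -- All brackets with x lie in the kernel of τ and are central, so the derivation rule makes x
    -- commute with every bracket, and these span by perfectness.
    have hc : ∀ y, τ (br K x y) = 0 := fun y => (τ.map_br x y).trans (hτ'.2 _ hx _)
    refine fun y => eq_of_eq_br hE (f := br K x) (g := 0) (fun y z => ?_) y
    obtain ⟨y0, h0, y1, h1, rfl⟩ := exists_add (K := K) y
    rw [LinearMap.zero_apply, map_add, LinearMap.add_apply, map_add, leibniz hd h0, leibniz hd h1,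
      hτ.br_left (hc _), hτ.br_left (hc _), hτ.br_right (hc _), hτ.br_right (hc _)]
    simp
  intro x hx y
  obtain ⟨x0, h0, x1, h1, rfl⟩ := exists_add (K := K) x
  obtain ⟨e0, e1⟩ := (τ'.comp τ).homogeneous_ker h0 h1 hx
  rw [map_add, LinearMap.add_apply, key h0 e0, key h1 e1, add_zero]

end Extension

/-! ## The universal property of `𝔰𝔱(2, 2, A)^♯` -/

section Universal

variable {K : Type u} [CommRing K] {A : Type v} [Ring A] [Algebra K A]
  {𝒜 : ZMod 2 → Submodule K A} [GradedAlgebra 𝒜]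

/-- An arbitrary χ is allowed so that the identity of `St` and the map to 𝔰𝔩 are treated at once.
The bracket of E pulled back along χ is a cocycle on `St`, and the ρ it provides is the lift. -/
theorem existsUnique_sharp_lift {L : Type w} [AddCommGroup L] [Module K L] [LieSuperalgebra K L]
    {E : Type t} [AddCommGroup E] [Module K E] [LieSuperalgebra K E] {τ : Hom K E L}
    (hτ : IsCentralExtension τ) (χ : Hom K (St 𝒜 par22) L) :
    ∃! ρ : Hom K (Sharp 𝒜) E, ∀ x, τ (ρ x) = χ (sharpToSt 𝒜 x) := by
  obtain ⟨β, hβ, hβ'⟩ := hτ.exists_cocycle χ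
  obtain ⟨ρ, hρ, hρpar⟩ := hβ.exists_sharp_map
  -- Both sides agree on brackets, and `Sharp` is perfect. Only after this can ρ x serve as a lift
  -- of χ(πx), which turns the cocycle identity for ρ into multiplicativity.
  have hτρ : ∀ x, τ (ρ x) = χ (sharpToSt 𝒜 x) := by
    refine eq_of_eq_br derived_sharp (f := τ.toLinearMap ∘ₗ ρ)
      (g := χ.toLinearMap ∘ₗ (sharpToSt 𝒜).toLinearMap) fun x y => ?_
    obtain ⟨x', hx'⟩ := hτ.1 (χ (sharpToSt 𝒜 x))
    obtain ⟨y', hy'⟩ := hτ.1 (χ (sharpToSt 𝒜 y))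
    rw [LinearMap.comp_apply, LinearMap.comp_apply, hρ, hβ' _ _ x' y' hx' hy', sharpToSt_br]
    exact (τ.map_br x' y').trans ((congrArg₂ (fun a b => br K a b) hx' hy').trans
      (χ.map_br _ _).symm)
  refine ⟨⟨ρ, fun d x hx => hρpar hx, fun x y => ?_⟩, hτρ, fun ρ' hρ' => Hom.ext fun x => ?_⟩
  · exact (hρ x y).trans (hβ' _ _ _ _ (hτρ x) (hτρ y))
  · refine eq_of_eq_br derived_sharp (f := ρ'.toLinearMap) (g := ρ) (fun x y => ?_) x
    rw [hρ, hβ' _ _ _ _ (hτρ x) (hτρ y)]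
    exact (ρ'.map_br x y).trans (hτ.br_congr ((hρ' x).trans (hτρ x).symm)
      ((hρ' y).trans (hτρ y).symm))

theorem ker_sharpToSt :
    LinearMap.range (sharpIncl 𝒜) = LinearMap.ker (sharpToSt 𝒜).toLinearMap := by
  refine le_antisymm ?_ fun x hx => mem_range_sharpIncl hx
  rintro _ ⟨w, rfl⟩
  exact sharpToSt_sharpIncl w

theorem sharpToSt_isCentralExtension : IsCentralExtension (sharpToSt 𝒜) := by
  refine ⟨sharpToSt_surjective, fun x hx y => ?_⟩
  obtain ⟨w, rfl⟩ := mem_range_sharpIncl hx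
  exact br_sharpIncl_left 𝒜 w y

theorem sharpToSt_isUniversalCentralExtension :
    IsUniversalCentralExtension.{u, max u v, max u v, t} (sharpToSt 𝒜) :=
  ⟨sharpToSt_isCentralExtension, fun _ _ _ _ _ hτ =>
    existsUnique_sharp_lift hτ ⟨LinearMap.id, fun _ _ h => h, fun _ _ => rfl⟩⟩

theorem stToSpecLin_comp_sharpToSt_isUniversalCentralExtension :
    IsUniversalCentralExtension.{u, max u v, v, t} ((stToSpecLin 𝒜 par22).comp (sharpToSt 𝒜)) :=
  ⟨sharpToSt_isCentralExtension.comp_of_perfect derived_sharp stToSpecLin_isCentralExtension,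
    fun _ _ _ _ _ hτ => existsUnique_sharp_lift hτ (stToSpecLin 𝒜 par22)⟩

end Universal

/-! ## The second homology -/

section Homology

open scoped TensorProduct

variable {K : Type u} [CommRing K] {L : Type v} [AddCommGroup L] [Module K L] [LieSuperalgebra K L]

variable (K L) in
/-- The universal cocycle `(x, y) ↦ x ∧ y` modulo boundaries. -/
def wedge : L →ₗ[K] L →ₗ[K] ((L ⊗[K] L) ⧸ boundaries₂ K L) :=
  (TensorProduct.mk K L L).compr₂ (boundaries₂ K L).mkQ

theorem wedge_apply (x y : L) : wedge K L x y = (boundaries₂ K L).mkQ (x ⊗ₜ y) := rfl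

/-- The boundaries are exactly what makes x ∧ y a cocycle. No grading of the target is used here, so
every homogeneous part is taken to be everything. -/
theorem isEvenSuperCocycle_wedge : IsEvenSuperCocycle (fun _ => ⊤) (wedge K L) where
  even _ _ := trivial
  skew {d e x y} hx hy := by
    rw [eq_neg_iff_add_eq_zero, wedge_apply, wedge_apply, ← map_units_smul, ← map_add]
    exact (Submodule.Quotient.mk_eq_zero _).2
      (Submodule.subset_span (Or.inl (Or.inl ⟨d, e, x, y, hx, hy, rfl⟩)))
  cyclic {d e f x y z} hx hy hz := by
    simp only [wedge_apply]
    rw [← map_units_smul, ← map_units_smul, ← map_units_smul, ← map_add, ← map_add]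
    exact (Submodule.Quotient.mk_eq_zero _).2
      (Submodule.subset_span (Or.inr ⟨d, e, f, x, y, z, hx, hy, hz, rfl⟩))
  alt {x} hx := (Submodule.Quotient.mk_eq_zero _).2
      (Submodule.subset_span (Or.inl (Or.inr ⟨x, hx, rfl⟩)))

variable {M : Type w} [AddCommGroup M] [Module K M] {Mpar : ZMod 2 → Submodule K M}
  {β : L →ₗ[K] L →ₗ[K] M}

theorem IsEvenSuperCocycle.boundaries_le_ker (hβ : IsEvenSuperCocycle Mpar β) :
    boundaries₂ K L ≤ LinearMap.ker (TensorProduct.lift β) := by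
  refine Submodule.span_le.2 ?_
  rintro _ ((⟨d, e, x, y, hx, hy, rfl⟩ | ⟨x, hx, rfl⟩) | ⟨d, e, f, x, y, z, hx, hy, hz, rfl⟩)
  · rw [SetLike.mem_coe, LinearMap.mem_ker, map_add, map_units_smul, TensorProduct.lift.tmul,
      TensorProduct.lift.tmul, hβ.skew hx hy, neg_add_cancel]
  · rw [SetLike.mem_coe, LinearMap.mem_ker, TensorProduct.lift.tmul, hβ.alt hx]
  · rw [SetLike.mem_coe, LinearMap.mem_ker]
    simp only [map_add, map_units_smul, TensorProduct.lift.tmul]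
    exact hβ.cyclic hx hy hz

theorem IsEvenSuperCocycle.lift_mem (hβ : IsEvenSuperCocycle Mpar β) {d : ZMod 2} {z : L ⊗[K] L}
    (hz : z ∈ tensorPar K L d) : TensorProduct.lift β z ∈ Mpar d := by
  induction hz using Submodule.span_induction with
  | zero => rw [map_zero]; exact zero_mem _
  | add x y _ _ hx hy => rw [map_add]; exact add_mem hx hy
  | smul c x _ hx => rw [map_smul]; exact Submodule.smul_mem _ _ hx
  | mem x hx =>
    obtain ⟨e, f, x, y, rfl, hx, hy, rfl⟩ := hx
    exact hβ.even hx hy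

theorem exists_tensorPar_add (z : L ⊗[K] L) :
    ∃ x ∈ tensorPar K L 0, ∃ y ∈ tensorPar K L 1, x + y = z := by
  rw [← Submodule.mem_sup]
  induction z using TensorProduct.induction_on with
  | zero => exact zero_mem _
  | add x y hx hy => exact add_mem hx hy
  | tmul x y =>
    have key : ∀ {d e : ZMod 2} {x y : L}, x ∈ par K d → y ∈ par K e →
        x ⊗ₜ[K] y ∈ tensorPar K L 0 ⊔ tensorPar K L 1 := by
      intro d e x y hx hy
      have h : x ⊗ₜ[K] y ∈ tensorPar K L (d + e) :=
        Submodule.subset_span ⟨d, e, x, y, rfl, hx, hy, rfl⟩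
      rcases zmod_two_cases (d + e) with hd | hd <;> rw [hd] at h
      · exact Submodule.mem_sup_left h
      · exact Submodule.mem_sup_right h
    obtain ⟨x0, hx0, x1, hx1, rfl⟩ := exists_add (K := K) x
    obtain ⟨y0, hy0, y1, hy1, rfl⟩ := exists_add (K := K) y
    rw [TensorProduct.add_tmul, TensorProduct.tmul_add, TensorProduct.tmul_add]
    exact add_mem (add_mem (key hx0 hy0) (key hx0 hy1)) (add_mem (key hx1 hy0) (key hx1 hy1))

/-- The homogeneous parts of a cycle are cycles. -/
theorem exists_cycles_add {z : L ⊗[K] L} (hz : z ∈ cycles₂ K L) :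
    ∃ x ∈ tensorPar K L 0 ⊓ cycles₂ K L, ∃ y ∈ tensorPar K L 1 ⊓ cycles₂ K L, x + y = z := by
  obtain ⟨x, hx, y, hy, rfl⟩ := exists_tensorPar_add z
  obtain ⟨h0, h1⟩ := par_eq_zero (isEvenSuperCocycle_br.lift_mem hx)
    (isEvenSuperCocycle_br.lift_mem hy) (by rw [← map_add]; exact hz)
  exact ⟨x, ⟨hx, h0⟩, y, ⟨hy, h1⟩, rfl⟩

end Homology

/-! ### The second homology of 𝔰𝔱(2, 2, A) -/

section SteinbergHomology

open scoped TensorProduct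

variable {K : Type u} [CommRing K] {A : Type v} [Ring A] [Algebra K A]
  (𝒜 : ZMod 2 → Submodule K A) [GradedAlgebra 𝒜]

/-- The map from the second homology to `W` induced by the cocycle `ψ`. -/
def homologyToW : H₂ K (St 𝒜 par22) →ₗ[K] W 𝒜 :=
  Submodule.liftQ _ (TensorProduct.lift (psi 𝒜) ∘ₗ (cycles₂ K (St 𝒜 par22)).subtype)
    fun _ hz => (isEvenSuperCocycle_psi 𝒜).boundaries_le_ker hz

variable {𝒜}

theorem homologyToW_mk (z : cycles₂ K (St 𝒜 par22)) :
    homologyToW 𝒜 (Submodule.Quotient.mk z) = TensorProduct.lift (psi 𝒜) z := rfl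

/-- Λ² modulo boundaries is identified with `Sharp`, that is with `St` ⊕ W: the map ρ given by the
universal cocycle and the map (bracket, ψ) are mutually inverse. On cycles the first coordinate
vanishes and only W remains. -/
theorem exists_sharp_section : ∃ ρ : Sharp 𝒜 →ₗ[K]
    ((St 𝒜 par22 ⊗[K] St 𝒜 par22) ⧸ boundaries₂ K (St 𝒜 par22)),
    (∀ z, ρ ((sharpEquiv 𝒜).symm (TensorProduct.lift (br K) z, TensorProduct.lift (psi 𝒜) z))
      = (boundaries₂ K (St 𝒜 par22)).mkQ z) ∧
    ∀ x z, ρ x = (boundaries₂ K (St 𝒜 par22)).mkQ z →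
      (TensorProduct.lift (br K) z, TensorProduct.lift (psi 𝒜) z) = sharpEquiv 𝒜 x := by
  obtain ⟨ρ, hρ, -⟩ := (isEvenSuperCocycle_wedge (K := K) (L := St 𝒜 par22)).exists_sharp_map
  let Ψ : (St 𝒜 par22 ⊗[K] St 𝒜 par22) ⧸ boundaries₂ K (St 𝒜 par22) →ₗ[K] St 𝒜 par22 × W 𝒜 :=
    (boundaries₂ K (St 𝒜 par22)).liftQ
      ((TensorProduct.lift (br K)).prod (TensorProduct.lift (psi 𝒜))) fun z hz =>
      Prod.ext (isEvenSuperCocycle_br.boundaries_le_ker hz)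
        ((isEvenSuperCocycle_psi 𝒜).boundaries_le_ker hz)
  have hΨ : ∀ z, Ψ ((boundaries₂ K (St 𝒜 par22)).mkQ z)
      = (TensorProduct.lift (br K) z, TensorProduct.lift (psi 𝒜) z) := fun z => rfl
  have hbr : ∀ x y : Sharp 𝒜, sharpEquiv 𝒜 (br K x y)
      = (br K (sharpToSt 𝒜 x) (sharpToSt 𝒜 y), psi 𝒜 (sharpToSt 𝒜 x) (sharpToSt 𝒜 y)) := by
    intro x y
    rw [sharpEquiv_apply, sharpToSt_br, sharpToW_br]
  refine ⟨ρ, fun z => ?_, fun x z h => ?_⟩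
  · induction z using TensorProduct.induction_on with
    | zero => rw [map_zero, map_zero, map_zero, Prod.mk_zero_zero, map_zero, map_zero]
    | add z z' h h' => rw [map_add, map_add, ← Prod.mk_add_mk, map_add, map_add, h, h', map_add]
    | tmul x y =>
      obtain ⟨x, rfl⟩ := sharpToSt_surjective (𝒜 := 𝒜) x
      obtain ⟨y, rfl⟩ := sharpToSt_surjective (𝒜 := 𝒜) y
      rw [TensorProduct.lift.tmul, TensorProduct.lift.tmul, ← hbr, LinearEquiv.symm_apply_apply, hρ,
        wedge_apply]
  · rw [← hΨ, ← h]
    -- The composite is compared with the splitting on brackets only, which is enough by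
    -- perfectness.
    refine eq_of_eq_br derived_sharp (f := Ψ ∘ₗ ρ) (g := (sharpEquiv 𝒜).toLinearMap)
      (fun x y => ?_) x
    rw [LinearMap.comp_apply, hρ, wedge_apply, hΨ, TensorProduct.lift.tmul, TensorProduct.lift.tmul]
    exact (hbr x y).symm

theorem homologyToW_injective : Function.Injective (homologyToW 𝒜) := by
  obtain ⟨ρ, hρ, -⟩ := exists_sharp_section (𝒜 := 𝒜)
  rw [injective_iff_map_eq_zero]
  intro z hz
  obtain ⟨z, rfl⟩ := Submodule.Quotient.mk_surjective _ z
  rw [homologyToW_mk] at hz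
  have h := hρ z
  rw [hz, show TensorProduct.lift (br K) (z : St 𝒜 par22 ⊗[K] St 𝒜 par22) = 0 from z.2,
    Prod.mk_zero_zero, map_zero, map_zero] at h
  have h' : (z : St 𝒜 par22 ⊗[K] St 𝒜 par22) ∈ boundaries₂ K (St 𝒜 par22) :=
    (Submodule.Quotient.mk_eq_zero _).1 h.symm
  exact (Submodule.Quotient.mk_eq_zero _).2 h'

theorem exists_cycle (w : W 𝒜) : ∃ z ∈ cycles₂ K (St 𝒜 par22), TensorProduct.lift (psi 𝒜) z = w := by
  obtain ⟨ρ, -, hρ⟩ := exists_sharp_section (𝒜 := 𝒜)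
  obtain ⟨z, hz⟩ := Submodule.mkQ_surjective _ (ρ (sharpIncl 𝒜 w))
  have h := hρ _ z hz.symm
  rw [sharpEquiv_apply, sharpToSt_sharpIncl, sharpToW_sharpIncl] at h
  exact ⟨z, congrArg Prod.fst h, congrArg Prod.snd h⟩

variable (𝒜) in
/-- The isomorphism of the second homology with `W` induced by `ψ`. -/
def homologyEquiv : H₂ K (St 𝒜 par22) ≃ₗ[K] W 𝒜 :=
  LinearEquiv.ofBijective (homologyToW 𝒜) ⟨homologyToW_injective, fun w => by
    obtain ⟨z, hz, hw⟩ := exists_cycle w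
    exact ⟨Submodule.Quotient.mk ⟨z, hz⟩, hw⟩⟩

theorem map_homologyEquiv (d : ZMod 2) :
    (H₂par K (St 𝒜 par22) d).map (homologyEquiv 𝒜).toLinearMap = Wpar 𝒜 d := by
  apply le_antisymm
  · rintro _ ⟨_, ⟨z, hz, rfl⟩, rfl⟩
    exact (isEvenSuperCocycle_psi 𝒜).lift_mem hz
  · intro w hw
    have key : ∀ {e : ZMod 2} {z : St 𝒜 par22 ⊗[K] St 𝒜 par22} (hz : z ∈ tensorPar K _ e)
        (hc : z ∈ cycles₂ K (St 𝒜 par22)), TensorProduct.lift (psi 𝒜) z ∈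
          (H₂par K (St 𝒜 par22) e).map (homologyEquiv 𝒜).toLinearMap :=
      fun hz hc => ⟨_, ⟨⟨_, hc⟩, hz, rfl⟩, rfl⟩
    obtain ⟨z, hz, rfl⟩ := exists_cycle w
    obtain ⟨x, ⟨hx, hxc⟩, y, ⟨hy, hyc⟩, rfl⟩ := exists_cycles_add hz
    have hx' := (isEvenSuperCocycle_psi 𝒜).lift_mem hx
    have hy' := (isEvenSuperCocycle_psi 𝒜).lift_mem hy
    rw [map_add] at hw ⊢
    -- If w has parity d, the contribution of the cycle component of the other parity lies in both
    -- homogeneous parts of W and is therefore 0.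
    rcases zmod_two_cases d with rfl | rfl
    · rw [wpar_eq_zero (d := 0) (e := 1) (by decide) (by simpa using sub_mem hw hx') hy', add_zero]
      exact key hx hxc
    · rw [wpar_eq_zero (d := 0) (e := 1) (by decide) hx' (by simpa using sub_mem hw hy'), zero_add]
      exact key hy hyc

end SteinbergHomology

end

end SteinbergSuper

theorem theoremT {K : Type u} [CommRing K] {A : Type v} [Ring A] [Algebra K A]
    (𝒜 : ZMod 2 → Submodule K A) [GradedAlgebra 𝒜]
    {κ : Type t} (basis : Module.Basis κ K A) (one_mem_basis : (1 : A) ∈ Set.range basis) :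
    ∃ (ψ : St 𝒜 par22 →ₗ[K] St 𝒜 par22 →ₗ[K] W 𝒜)
      (ι : W 𝒜 →ₗ[K] Sharp 𝒜)
      (π : Hom K (Sharp 𝒜) (St 𝒜 par22))
      (φ : Hom K (St 𝒜 par22) (SpecLin 𝒜 par22)),
      -- `ψ` is the bilinear map with the prescribed values, and it is an even super 2-cocycle
      HasPsiValues 𝒜 ψ ∧ (∀ ψ', HasPsiValues 𝒜 ψ' → ψ' = ψ) ∧ IsEvenSuperCocycle (Wpar 𝒜) ψ ∧
      -- `ι`, `π` and `φ` are the canonical maps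
      (∀ (d : ZMod 2) (w : Wpar 𝒜 d), ι w = sharpW 𝒜 w) ∧
      (∀ (i j : Fin 4) (h : i ≠ j) (d : ZMod 2) (a : 𝒜 d),
        π (sharpF 𝒜 h a) = stF 𝒜 par22 h a) ∧
      (∀ (d : ZMod 2) (w : Wpar 𝒜 d), π (sharpW 𝒜 w) = 0) ∧
      (∀ (i j : Fin 4) (h : i ≠ j) (d : ZMod 2) (a : 𝒜 d),
        (φ (stF 𝒜 par22 h a) : GenLin 𝒜 par22) = elemMat 𝒜 par22 i j a) ∧
      -- `st(2,2,A)^♯` is `st(2,2,A) ⊕ W` with the bracket defined by `ψ`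
      (∃ e : Sharp 𝒜 ≃ₗ[K] St 𝒜 par22 × W 𝒜,
        (∀ (i j : Fin 4) (h : i ≠ j) (d : ZMod 2) (a : 𝒜 d),
          e (sharpF 𝒜 h a) = (stF 𝒜 par22 h a, 0)) ∧
        (∀ w : W 𝒜, e (ι w) = (0, w)) ∧
        (∀ x : Sharp 𝒜, (e x).1 = π x) ∧
        (∀ (d : ZMod 2) (x : Sharp 𝒜),
          x ∈ par K d ↔ (e x).1 ∈ par K d ∧ (e x).2 ∈ Wpar 𝒜 d) ∧
        ∀ x y : Sharp 𝒜, e (br K x y) = (br K (e x).1 (e y).1, ψ (e x).1 (e y).1)) ∧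
      -- `0 → W → st(2,2,A)^♯ → st(2,2,A) → 0` is exact and is a universal central extension
      Function.Injective ι ∧ LinearMap.range ι = LinearMap.ker π.toLinearMap ∧
      IsUniversalCentralExtension.{u, max u v, max u v, w} π ∧
      -- `ψ` induces an isomorphism of supermodules from the second homology to `W`
      (∃ f : H₂ K (St 𝒜 par22) ≃ₗ[K] W 𝒜,
        (∀ z : cycles₂ K (St 𝒜 par22),
          f (Submodule.Quotient.mk z) = TensorProduct.lift ψ z) ∧
        ∀ d : ZMod 2, (H₂par K (St 𝒜 par22) d).map f.toLinearMap = Wpar 𝒜 d) ∧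
      -- `st(2,2,A)^♯` is the universal central extension of `sl(2,2,A)`
      IsUniversalCentralExtension.{u, max u v, v, w} (φ.comp π) := by
  refine ⟨psi 𝒜, sharpIncl 𝒜, sharpToSt 𝒜, stToSpecLin 𝒜 par22, hasPsiValues_psi 𝒜,
    fun ψ' h => h.eq (hasPsiValues_psi 𝒜), isEvenSuperCocycle_psi 𝒜,
    fun d w => sharpIncl_coe 𝒜 w, fun i j h d a => sharpToSt_sharpF h a,
    fun d w => sharpToSt_sharpW w, fun i j h d a => stToSpecLin_stF h a,
    ⟨sharpEquiv 𝒜, fun i j h d a => ?_, fun w => ?_, fun x => rfl, fun d x => mem_par_sharp,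
      fun x y => ?_⟩,
    fun w w' h => ?_, ker_sharpToSt, sharpToSt_isUniversalCentralExtension,
    ⟨homologyEquiv 𝒜, homologyToW_mk, map_homologyEquiv⟩,
    stToSpecLin_comp_sharpToSt_isUniversalCentralExtension⟩
  · rw [sharpEquiv_apply, sharpToSt_sharpF, sharpToW_sharpF]
  · rw [sharpEquiv_apply, sharpToSt_sharpIncl, sharpToW_sharpIncl]
  · rw [sharpEquiv_apply, sharpToSt_br, sharpToW_br]
    rfl
  · rw [← sharpToW_sharpIncl w, h, sharpToW_sharpIncl]
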